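/- Let $p,q,r\ge 0$ be integers, at most one of which is $0$. Let $\theta(p,q,r)$ be the simple graph on $p+q+r+2$ vertices consisting of two given vertices joined by three internally disjoint paths that have $p$, $q$ and $r$ internal vertices, respectively (a path with $0$ internal vertices is an edge joining the two given vertices). For a finite simple graph $G$ with $n$ vertices let $Q(G)=D(G)+A(G)$ be its signless Laplacian matrix, where $D(G)$ is the diagonal matrix of vertex degrees and $A(G)$ is the adjacency matrix, and let $\pi(Q(G);x)=\operatorname{per}(xI-Q(G))$, where $I$ is the $n\times n$ identity matrix and $\operatorname{per}(M)=\sum_{\sigma}\prod_{i=1}^n m_{i\sigma(i)}$, the sum running over all permutations $\sigma$ of $\{1,\dots,n\}$, be its signless Laplacian permanental polynomial. Then $\theta(p,q,r)$ is determined by its signless Laplacian permanental polynomial: every finite simple graph $H$ (connected or not) with $\pi(Q(H);x)=\pi(Q(\theta(p,q,r));x)$ is isomorphic to $\theta(p,q,r)$. -/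

import Mathlib

/-- The signless Laplacian matrix `Q(G) = D(G) + A(G)`, with integer entries. -/
def SimpleGraph.signlessLapMatrix {V : Type*} [Fintype V] [DecidableEq V] (G : SimpleGraph V)
    [DecidableRel G.Adj] : Matrix V V ℤ :=
  G.degMatrix ℤ + G.adjMatrix ℤ

/-- The signless Laplacian permanental polynomial `per(x I - Q(G))`, as a polynomial over `ℤ`. -/
noncomputable def SimpleGraph.signlessLapPermPoly {V : Type*} [Fintype V] [DecidableEq V]
    (G : SimpleGraph V) [DecidableRel G.Adj] : Polynomial ℤ :=
  (Matrix.scalar V (Polynomial.X : Polynomial ℤ) -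
    G.signlessLapMatrix.map (Polynomial.C : ℤ →+* Polynomial ℤ)).permanent

/-- The vertices of `θ(l 0, l 1, l 2)`: the two given vertices `Sum.inl false` and `Sum.inl true`,
and, for each `i`, the `l i` vertices of the `i`-th path. -/
abbrev ThetaVertex (l : Fin 3 → ℕ) : Type :=
  Bool ⊕ (Σ i : Fin 3, Fin (l i))

/-- The `k`-th vertex met when walking from `Sum.inl false` (at `k = 0`) along the `i`-th path
to `Sum.inl true` (at `k = l i + 1`). -/
def thetaPathVertex (l : Fin 3 → ℕ) (i : Fin 3) (k : ℕ) : ThetaVertex l :=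
  if k = 0 then Sum.inl false
  else if h : k - 1 < l i then Sum.inr ⟨i, ⟨k - 1, h⟩⟩
  else Sum.inl true

/-- Consecutive vertices along the `i`-th path are distinct. -/
theorem thetaPathVertex_ne_succ (l : Fin 3 → ℕ) (i : Fin 3) (k : ℕ) (hk : k ≤ l i) :
    thetaPathVertex l i k ≠ thetaPathVertex l i (k + 1) := by
  unfold thetaPathVertex
  split_ifs <;> simp <;> omega

/-- The theta graph `θ(p, q, r)`: two given vertices joined by three disjoint paths with `p`, `q`
and `r` vertices; a path with no vertex is an edge between the two given vertices. -/
def thetaGraph (p q r : ℕ) : SimpleGraph (ThetaVertex ![p, q, r]) where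
  Adj x y := ∃ i : Fin 3, ∃ k : Fin (![p, q, r] i + 1),
    (x = thetaPathVertex ![p, q, r] i k ∧ y = thetaPathVertex ![p, q, r] i (k + 1)) ∨
    (y = thetaPathVertex ![p, q, r] i k ∧ x = thetaPathVertex ![p, q, r] i (k + 1))
  symm := ⟨fun _ _ ⟨i, k, h⟩ => ⟨i, k, h.symm⟩⟩
  loopless := ⟨by
    rintro x ⟨i, k, ⟨h₁, h₂⟩ | ⟨h₁, h₂⟩⟩ <;>
      exact thetaPathVertex_ne_succ _ i k (Nat.lt_succ_iff.mp k.2) (h₁.symm.trans h₂)⟩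

instance thetaGraph.decidableRelAdj (p q r : ℕ) : DecidableRel (thetaGraph p q r).Adj :=
  fun x y => inferInstanceAs (Decidable (∃ i : Fin 3, ∃ k : Fin (![p, q, r] i + 1),
    (x = thetaPathVertex ![p, q, r] i k ∧ y = thetaPathVertex ![p, q, r] i (k + 1)) ∨
    (y = thetaPathVertex ![p, q, r] i k ∧ x = thetaPathVertex ![p, q, r] i (k + 1))))

/-! The polynomial fixes the degree sequence, and the graphs with the degree sequence of a theta
graph form explicit families whose polynomials can be told apart.

The leading coefficients give the number of vertices, $\sum d$ and $\sum d^2$, hence $\sum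
(d-2)(d-3)$. This is a sum of non-negative integers that vanishes for a theta graph, so $H$ has
exactly two vertices of degree 3 and all others of degree 2 (`degrees_of_signlessLapPermPoly_eq`).
Following edges through the vertices of degree 2 shows that $H$ is a theta graph or a dumbbell (two
cycles joined by a path), together with disjoint cycles (`exists_permanent_eq_theta_or_dumbbell`).

With $x = y + 2$ the diagonal entries are $y$, and $y - 1$ at the two special vertices. Attaching a
path changes the permanent by a linear recurrence in the length (`permanent_pathMat`), which $y = z
- z^{-1}$ solves. Up to a common factor, the permanents become `thetaPoly`, `dumbbellPoly` and
`cyclePoly`, with the lengths as exponents of $z$.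

At $z = 1$ a theta polynomial takes one of the values 0, 32, 48, 80 and a cycle polynomial the value
2 or 4. Hence extra cycles force all path lengths, and for a dumbbell the lengths of its cycles and
its bridge, to be even. In the all-even case the odd coefficients of a theta polynomial are
non-positive on a long range, while a shortest cycle of $H$ outside a theta component would produce
a positive one.

In the remaining cases there are no extra cycles, and the odd part of $(1-z)^2$ times the polynomial
is compared. Up to the degree given by the number of edges, for a theta graph it depends only on the
lengths of its three cycles and determines them (`eq_of_cycleCoeff_add_add_eq`), hence the lengths
of the paths. For a dumbbell its lowest coefficients cannot come from a theta graph
(`not_odd_odd_loops`, `not_even_odd_loops`). -/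

namespace Matrix

/-! ### Expansion of permanents; a minor is a matrix with a row replaced by a unit vector. -/

variable {n m R : Type*} [DecidableEq n] [Fintype n] [DecidableEq m] [Fintype m]

section updateRow

variable {n R : Type*} [DecidableEq n]

theorem submatrix_some_updateRow_some (M : Matrix (Option n) (Option n) R)
    (i : n) (r : Option n → R) :
    (M.updateRow (some i) r).submatrix some some =
      (M.submatrix some some).updateRow i fun j => r (some j) := by
  ext k l
  by_cases h : k = i
  · subst h
    simp
  · simp [updateRow_ne, h]

theorem submatrix_some_updateRow_none (M : Matrix (Option n) (Option n) R)
    (r : Option n → R) :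
    (M.updateRow none r).submatrix some some = M.submatrix some some := by
  ext k l
  simp [updateRow_ne]

theorem single_some_comp [CommSemiring R] (i : n) :
    (fun j => (Pi.single (some i) 1 : Option n → R) (some j)) = Pi.single i 1 := by
  ext j
  by_cases h : j = i <;> simp [h]

end updateRow

section CommSemiring

variable [CommSemiring R]

theorem permanent_submatrix_equiv_self (e : m ≃ n) (M : Matrix n n R) :
    (M.submatrix e e).permanent = M.permanent := by
  unfold permanent
  refine Fintype.sum_equiv (Equiv.permCongr e) _ _ fun σ => ?_
  exact Fintype.prod_equiv e _ _ fun i => by simp [Equiv.permCongr_apply]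

theorem permanent_updateRow_add (M : Matrix n n R) (j : n) (u v : n → R) :
    (M.updateRow j (u + v)).permanent =
      (M.updateRow j u).permanent + (M.updateRow j v).permanent := by
  unfold permanent
  rw [← Finset.sum_add_distrib]
  refine Finset.sum_congr rfl fun σ _ => ?_
  rw [← Finset.mul_prod_erase _ _ (Finset.mem_univ (σ.symm j)),
    ← Finset.mul_prod_erase _ (fun i => M.updateRow j u (σ i) i) (Finset.mem_univ (σ.symm j)),
    ← Finset.mul_prod_erase _ (fun i => M.updateRow j v (σ i) i) (Finset.mem_univ (σ.symm j))]
  have key : ∀ w : n → R, ∏ i ∈ Finset.univ.erase (σ.symm j), M.updateRow j w (σ i) i =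
      ∏ i ∈ Finset.univ.erase (σ.symm j), M (σ i) i := fun w => by
    refine Finset.prod_congr rfl fun i hi => ?_
    rw [updateRow_ne]
    rintro rfl
    simp at hi
  simp only [key, Equiv.apply_symm_apply, updateRow_self, Pi.add_apply, add_mul]

/-- Expansion of the permanent along the column of `none`. -/
theorem permanent_option (M : Matrix (Option n) (Option n) R) :
    M.permanent = M none none * (M.submatrix some some).permanent +
      ∑ k, M (some k) none *
        ((M.submatrix some some).updateRow k fun j => M none (some j)).permanent := by
  unfold permanent
  rw [← Equiv.Perm.decomposeOption.symm.sum_comp, Fintype.sum_prod_type, Fintype.sum_option]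
  congr 1
  · rw [Finset.mul_sum]
    exact Finset.sum_congr rfl fun σ _ => by simp [Fintype.prod_option]
  · refine Finset.sum_congr rfl fun k _ => ?_
    rw [Finset.mul_sum]
    refine Finset.sum_congr rfl fun σ _ => ?_
    rw [Fintype.prod_option]
    congr 1
    refine Finset.prod_congr rfl fun i _ => ?_
    by_cases h : σ i = k
    · simp [h]
    · rw [updateRow_ne h]
      simp [Equiv.swap_apply_of_ne_of_ne, h]

theorem permanent_option_of_row (M : Matrix (Option n) (Option n) R)
    (hr : ∀ j, M none (some j) = 0) :
    M.permanent = M none none * (M.submatrix some some).permanent := by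
  have : (fun j => M none (some j)) = (0 : R) • (0 : n → R) := by
    ext j
    simp [hr]
  rw [permanent_option, this]
  simp only [permanent_updateRow_smul]
  simp

theorem permanent_fromBlocks_zero (A : Matrix n n R) (D : Matrix m m R) :
    (fromBlocks A 0 0 D).permanent = A.permanent * D.permanent := by
  unfold permanent
  rw [Finset.sum_mul_sum, ← Finset.sum_product', Finset.univ_product_univ]
  symm
  refine Finset.sum_of_injOn (fun p => Equiv.Perm.sumCongr p.1 p.2) ?_ (by simp) ?_ ?_
  · rintro ⟨a, b⟩ - ⟨c, d⟩ - h
    exact Equiv.Perm.sumCongrHom_injective h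
  · intro σ _ hσ
    have hσ' : σ ∉ (Equiv.Perm.sumCongrHom n m).range := by
      rintro ⟨p, rfl⟩
      exact hσ ⟨p, by simp, rfl⟩
    have hne : ¬ Set.MapsTo σ (Set.range Sum.inl) (Set.range Sum.inl) := fun h =>
      hσ' (Equiv.Perm.mem_sumCongrHom_range_of_perm_mapsTo_inl h)
    simp only [Set.MapsTo, not_forall] at hne
    obtain ⟨x, ⟨a, rfl⟩, ha⟩ := hne
    refine Finset.prod_eq_zero (Finset.mem_univ (Sum.inl a)) ?_
    rcases hs : σ (Sum.inl a) with b | b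
    · exact absurd ⟨b, hs.symm⟩ ha
    · rfl
  · rintro ⟨a, b⟩ -
    simp [Fintype.prod_sum_type]

/-- Both sides are the minor without the rows and columns `s` and `t`; exchanging these two columns
turns one matrix into the other. -/
theorem permanent_updateRow_single_swap (M : Matrix n n R) {s t : n} (hst : s ≠ t) :
    ((M.updateRow s (Pi.single t 1)).updateRow t (Pi.single s 1)).permanent =
      ((M.updateRow s (Pi.single s 1)).updateRow t (Pi.single t 1)).permanent := by
  rw [← permanent_permute_cols (Equiv.swap s t)]
  congr 1
  ext i j
  by_cases hs : i = s
  · subst hs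
    simp [updateRow_ne hst]
  · by_cases ht : i = t
    · subst ht
      simp [updateRow_ne hst]
    · simp [Equiv.swap_apply_of_ne_of_ne hs ht, updateRow_ne hs, updateRow_ne ht]

end CommSemiring

section CommRing

variable [CommRing R]

/-- Removal of an index `none` whose row vanishes off the diagonal except at `t`, and whose column
vanishes off the diagonal except at `s`. -/
theorem permanent_option_of_single (M : Matrix (Option n) (Option n) R) (X : Matrix n n R)
    (s t : n) (y b c : R) (hX : M.submatrix some some = X) (hy : M none none = y)
    (hr : ∀ j, M none (some j) = if j = t then b else 0)
    (hc : ∀ i, M (some i) none = if i = s then c else 0) :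
    M.permanent = y * X.permanent + c * b * (X.updateRow s (Pi.single t 1)).permanent := by
  have : (fun j => M none (some j)) = b • Pi.single t (1 : R) := by
    ext j
    rw [hr]
    by_cases h : j = t <;> simp [h]
  rw [permanent_option, hX, hy, this, Finset.sum_eq_single s]
  · simp [hc, mul_assoc]
  · intro i _ hi
    simp [hc, hi]
  · simp

end CommRing

end Matrix

/-! ### Permanents of matrices with attached paths. -/

/-- The polynomials with `contPoly y 0 = 0`, `contPoly y 1 = 1` and
`contPoly y (k + 2) = y * contPoly y (k + 1) + contPoly y k`. The permanent of `y I - A`, where `A`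
is the adjacency matrix of a path with `k` vertices, is `contPoly y (k + 1)`. -/
def contPoly {R : Type*} [CommRing R] (y : R) : ℕ → R
  | 0 => 0
  | 1 => 1
  | k + 2 => y * contPoly y (k + 1) + contPoly y k

namespace Matrix

variable {U R : Type*} [DecidableEq U] [CommRing R]

/-- The matrix obtained from `X` by attaching a path with `a` vertices at the indices `s` and `t`.
The new diagonal entries are `y`, the entries for the edges of the path are `-1`, except that
they are `-σ` in the row of `s` and `-τ` in the row of `t`. -/
def pathMat (y : R) (X : Matrix U U R) (s t : U) (σ τ : R) (a : ℕ) :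
    Matrix (U ⊕ Fin a) (U ⊕ Fin a) R :=
  fromBlocks
    (of fun i j => X i j -
      if a = 0 then (if i = s ∧ j = t then σ else 0) + (if i = t ∧ j = s then τ else 0) else 0)
    (of fun i k => -((if i = s ∧ k.1 = 0 then σ else 0) + (if i = t ∧ k.1 + 1 = a then τ else 0)))
    (of fun k j => -((if k.1 = 0 ∧ j = s then 1 else 0) + (if k.1 + 1 = a ∧ j = t then 1 else 0)))
    (of fun k k' => if k = k' then y else if k.1 + 1 = k'.1 ∨ k'.1 + 1 = k.1 then -1 else 0)

/-- The matrix `X` with a new index `none` with diagonal entry `y`, joined to `t`. -/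
def pendantMat (y : R) (X : Matrix U U R) (t : U) (τ : R) : Matrix (Option U) (Option U) R :=
  of fun i j => match i, j with
    | none, none => y
    | none, some j => if j = t then -1 else 0
    | some i, none => if i = t then -τ else 0
    | some i, some j => X i j

/-- The last vertex of a nonempty path, moved to the left summand. -/
def sumFinSuccEquiv (U : Type*) (a : ℕ) : Option U ⊕ Fin a ≃ U ⊕ Fin (a + 1) where
  toFun
    | .inl none => .inr (Fin.last a)
    | .inl (some u) => .inl u
    | .inr k => .inr k.castSucc
  invFun
    | .inl u => .inl (some u)
    | .inr k => if h : k.1 < a then .inr ⟨k, h⟩ else .inl none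
  left_inv := by
    rintro ((_ | u) | k) <;> simp
  right_inv := by
    rintro (u | k)
    · rfl
    · by_cases h : k.1 < a
      · simp [h]
      · have : k = Fin.last a := by
          ext
          simp
          omega
        simp [this]

/-- This is the induction step on the length: the path vertex next to `t` becomes a pendant vertex
of the base, and the shorter path ends there. The row of the new vertex is an ordinary one, hence
the weight 1. -/
theorem pathMat_succ (y : R) (X : Matrix U U R) (s t : U) (σ τ : R) (a : ℕ) :
    (pathMat y X s t σ τ (a + 1)).submatrix (sumFinSuccEquiv U a) (sumFinSuccEquiv U a) =
      pathMat y (pendantMat y X t τ) (some s) none σ 1 a := by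
  ext ((_ | i) | k) ((_ | j) | k') <;>
    simp only [sumFinSuccEquiv, pathMat, pendantMat, submatrix_apply, Equiv.coe_fn_mk,
      fromBlocks_apply₁₁, fromBlocks_apply₁₂, fromBlocks_apply₂₁, fromBlocks_apply₂₂, of_apply,
      Fin.val_last, Fin.val_castSucc, Fin.ext_iff, reduceCtorEq, Option.some.injEq, and_true,
      true_and, and_false, false_and, if_false, if_true, add_zero, zero_add, Nat.add_eq_zero_iff,
      one_ne_zero, Nat.add_right_cancel_iff]
  · simp
  · split_ifs <;> grind
  · have := k'.2
    split_ifs <;> first | omega | simp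
  · split_ifs <;> grind
  · simp
  · have := k'.2
    simp [this.ne]
  · have := k.2
    split_ifs <;> first | omega | simp
  · have := k.2
    simp [this.ne]

theorem submatrix_pendantMat (y : R) (X : Matrix U U R) (t : U) (τ : R) :
    (pendantMat y X t τ).submatrix some some = X := rfl

/-- The weights `σ` and `τ` exist for this: passing to a minor of the base also erases the path
entries in the deleted row, and with weights the result is again a path matrix. -/
theorem pathMat_updateRow_single (y : R) (X : Matrix U U R) (s t : U) (σ τ : R) (a : ℕ) (i j : U) :
    (pathMat y X s t σ τ a).updateRow (Sum.inl i) (Pi.single (Sum.inl j) 1) =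
      pathMat y (X.updateRow i (Pi.single j 1)) s t (if i = s then 0 else σ)
        (if i = t then 0 else τ) a := by
  ext (u | k) (v | k')
  · by_cases hu : u = i
    · subst hu
      by_cases hv : v = j
      · subst hv
        simp [pathMat]
        grind
      · simp [pathMat, hv]
        grind
    · simp [pathMat, updateRow_ne, hu]
      grind
  · by_cases hu : u = i
    · subst hu
      simp [pathMat]
      grind
    · simp [pathMat, updateRow_ne, hu]
      grind
  · simp [pathMat, updateRow_ne]
  · simp [pathMat, updateRow_ne]

variable [Fintype U]

theorem permanent_pathMat_zero (y : R) (X : Matrix U U R) {s t : U} (hst : s ≠ t) (σ τ : R) :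
    (pathMat y X s t σ τ 0).permanent = X.permanent
      - σ * (X.updateRow s (Pi.single t 1)).permanent
      - τ * (X.updateRow t (Pi.single s 1)).permanent
      + σ * τ * ((X.updateRow s (Pi.single s 1)).updateRow t (Pi.single t 1)).permanent := by
  have h1 : (pathMat y X s t σ τ 0).submatrix (Equiv.sumEmpty U (Fin 0)).symm
      (Equiv.sumEmpty U (Fin 0)).symm =
      (X.updateRow s (X s + -σ • Pi.single t 1)).updateRow t (X t + -τ • Pi.single s 1) := by
    ext i j
    by_cases hs : i = s
    · subst hs
      by_cases h : j = t <;> simp [pathMat, hst, h, sub_eq_add_neg]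
    · by_cases ht : i = t
      · subst ht
        by_cases h : j = s <;> simp [pathMat, hst, hst.symm, h, sub_eq_add_neg]
      · simp [pathMat, hs, ht]
  have h2 : ∀ u : U → R, (X.updateRow s u).updateRow t (X t) = X.updateRow s u := fun u => by
    rw [updateRow_comm _ hst, updateRow_eq_self]
  have h3 : ∀ u : U → R, (X.updateRow s (X s)).updateRow t u = X.updateRow t u := fun u => by
    rw [updateRow_eq_self]
  have h4 : ∀ v : U → R, ((X.updateRow s (X s + -σ • Pi.single t 1)).updateRow t v).permanent =
      (X.updateRow t v).permanent - σ * ((X.updateRow s (Pi.single t 1)).updateRow t v).permanent :=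
    fun v => by
      rw [updateRow_comm _ hst, permanent_updateRow_add, permanent_updateRow_smul,
        updateRow_comm _ hst.symm, updateRow_comm _ hst.symm, h3]
      ring
  rw [← permanent_submatrix_equiv_self (Equiv.sumEmpty U (Fin 0)).symm, h1,
    permanent_updateRow_add, permanent_updateRow_smul, h4, h4, h2,
    permanent_updateRow_single_swap _ hst, updateRow_eq_self]
  ring

section pendantMat

variable (y : R) (X : Matrix U U R) (t : U) (τ : R)

theorem permanent_pendantMat : (pendantMat y X t τ).permanent =
    y * X.permanent + τ * (X.updateRow t (Pi.single t 1)).permanent := by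
  rw [permanent_option_of_single _ X t t y (-1) (-τ) rfl rfl (fun _ => rfl) (fun _ => rfl)]
  ring

theorem permanent_pendantMat_updateRow_none_none :
    ((pendantMat y X t τ).updateRow none (Pi.single none 1)).permanent = X.permanent := by
  rw [permanent_option_of_row _ (by simp), submatrix_some_updateRow_none, submatrix_pendantMat]
  simp

theorem permanent_pendantMat_updateRow_some_some {s : U} (hst : s ≠ t) (j : U) :
    ((pendantMat y X t τ).updateRow (some s) (Pi.single (some j) 1)).permanent =
      y * (X.updateRow s (Pi.single j 1)).permanent +
        τ * ((X.updateRow s (Pi.single j 1)).updateRow t (Pi.single t 1)).permanent := by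
  rw [permanent_option_of_single _ (X.updateRow s (Pi.single j 1)) t t y (-1) (-τ)
    (by rw [submatrix_some_updateRow_some, submatrix_pendantMat, single_some_comp])
    (by simp [updateRow_ne, pendantMat]) (by simp [updateRow_ne, pendantMat]) ?_]
  · ring
  · intro i
    by_cases h : i = s
    · subst h
      simp [hst]
    · simp [updateRow_ne, h, pendantMat]

theorem permanent_pendantMat_updateRow_none_some (s : U) :
    ((pendantMat y X t τ).updateRow none (Pi.single (some s) 1)).permanent =
      -τ * (X.updateRow t (Pi.single s 1)).permanent := by
  rw [permanent_option_of_single _ X t s 0 1 (-τ)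
    (by rw [submatrix_some_updateRow_none, submatrix_pendantMat]) (by simp)
    (fun j => by by_cases h : j = s <;> simp [h])
    (fun i => by simp [updateRow_ne, pendantMat])]
  ring

theorem permanent_pendantMat_updateRow_some_none (s : U) :
    ((pendantMat y X t τ).updateRow (some s) (Pi.single none 1)).permanent =
      -(X.updateRow s (Pi.single t 1)).permanent := by
  rw [← permanent_permute_cols (Equiv.swap none (some s)), permanent_option_of_row _ (by simp)]
  have : (submatrix ((pendantMat y X t τ).updateRow (some s) (Pi.single none 1))
      (Equiv.swap none (some s)) id).submatrix some some =
      X.updateRow s ((-1 : R) • Pi.single t 1) := by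
    ext i j
    by_cases h : i = s
    · subst h
      by_cases hj : j = t <;> simp [updateRow_ne, pendantMat, hj]
    · simp [Equiv.swap_apply_of_ne_of_ne, h, updateRow_ne, pendantMat]
  rw [this, permanent_updateRow_smul]
  simp

end pendantMat

/-- The terms record how a permutation meets the path: not linking it to the base, using a
transposition on an end edge, doing so at both ends, or running through all `a + 1` edges, each with
entry `-1`. The combination `contPoly y (a + 1) - y * contPoly y a` is the value at index `a - 1`,
continued to 1 for `a = 0`. The base is quantified inside because it grows during the induction. -/
theorem permanent_pathMat (y : R) (a : ℕ) : ∀ {U : Type*} [DecidableEq U] [Fintype U]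
    (X : Matrix U U R) {s t : U} (_ : s ≠ t) (σ τ : R),
    (pathMat y X s t σ τ a).permanent = contPoly y (a + 1) * X.permanent
      + contPoly y a * (σ * (X.updateRow s (Pi.single s 1)).permanent
        + τ * (X.updateRow t (Pi.single t 1)).permanent)
      + (contPoly y (a + 1) - y * contPoly y a) *
        (σ * τ * ((X.updateRow s (Pi.single s 1)).updateRow t (Pi.single t 1)).permanent)
      + (-1) ^ (a + 1) * (σ * (X.updateRow s (Pi.single t 1)).permanent
        + τ * (X.updateRow t (Pi.single s 1)).permanent) := by
  induction a with
  | zero =>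
    intro U _ _ X s t hst σ τ
    rw [permanent_pathMat_zero y X hst]
    simp [contPoly]
    ring
  | succ a ih =>
    intro U _ _ X s t hst σ τ
    rw [← permanent_submatrix_equiv_self (sumFinSuccEquiv U a), pathMat_succ,
      ih _ (Option.some_ne_none s), permanent_pendantMat,
      permanent_pendantMat_updateRow_some_some _ _ _ _ hst,
      permanent_pendantMat_updateRow_none_none, permanent_pendantMat_updateRow_some_none,
      permanent_pendantMat_updateRow_none_some]
    have : (((pendantMat y X t τ).updateRow (some s) (Pi.single (some s) 1)).updateRow none
        (Pi.single none 1)).permanent = (X.updateRow s (Pi.single s 1)).permanent := by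
      rw [permanent_option_of_row _ (by simp), submatrix_some_updateRow_none,
        submatrix_some_updateRow_some, submatrix_pendantMat, single_some_comp]
      simp
    rw [this, show contPoly y (a + 1 + 1) = y * contPoly y (a + 1) + contPoly y a from rfl]
    ring

/-- Moving one path vertex into the base gives the remaining path distinct ends, so
`permanent_pathMat` applies. The factors 2 come from the two end edges and the two directions around
the cycle. -/
theorem permanent_pathMat_loop (y : R) {a : ℕ} (ha : a ≠ 0) (X : Matrix U U R) (s : U) (σ : R) :
    (pathMat y X s s σ σ a).permanent = contPoly y (a + 1) * X.permanent
      + σ * (2 * contPoly y a + 2 * (-1) ^ (a + 1)) *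
        (X.updateRow s (Pi.single s 1)).permanent := by
  obtain ⟨b, rfl⟩ := Nat.exists_eq_succ_of_ne_zero ha
  have h1 : ((pendantMat y X s σ).updateRow (some s) (Pi.single (some s) 1)).permanent =
      y * (X.updateRow s (Pi.single s 1)).permanent := by
    rw [permanent_option_of_single _ (X.updateRow s (Pi.single s 1)) s s y (-1) 0
      (by rw [submatrix_some_updateRow_some, submatrix_pendantMat, single_some_comp])
      (by simp [updateRow_ne, pendantMat]) (by simp [updateRow_ne, pendantMat])
      (fun i => by by_cases h : i = s <;> simp [updateRow_ne, h, pendantMat])]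
    ring
  have h2 : (((pendantMat y X s σ).updateRow (some s) (Pi.single (some s) 1)).updateRow none
      (Pi.single none 1)).permanent = (X.updateRow s (Pi.single s 1)).permanent := by
    rw [permanent_option_of_row _ (by simp), submatrix_some_updateRow_none,
      submatrix_some_updateRow_some, submatrix_pendantMat, single_some_comp]
    simp
  rw [Nat.succ_eq_add_one, ← permanent_submatrix_equiv_self (sumFinSuccEquiv U b), pathMat_succ,
    permanent_pathMat _ _ _ (Option.some_ne_none s), permanent_pendantMat, h1, h2,
    permanent_pendantMat_updateRow_none_none, permanent_pendantMat_updateRow_some_none,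
    permanent_pendantMat_updateRow_none_some,
    show contPoly y (b + 1 + 1) = y * contPoly y (b + 1) + contPoly y b from rfl]
  ring

theorem permanent_bool (M : Matrix Bool Bool R) :
    M.permanent = M false false * M true true + M false true * M true false := by
  have h0 : finTwoEquiv 0 = false := rfl
  have h1 : finTwoEquiv 1 = true := rfl
  rw [← permanent_submatrix_equiv_self finTwoEquiv, permanent, Finset.univ_perm_fin_succ]
  simp [h0, h1, ← Finset.univ_product_univ]
  ring

/-- The three-path matrix with two core indices. -/
def thetaMat (y : R) (a b c : ℕ) : Matrix (((Bool ⊕ Fin a) ⊕ Fin b) ⊕ Fin c)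
    (((Bool ⊕ Fin a) ⊕ Fin b) ⊕ Fin c) R :=
  pathMat y (pathMat y (pathMat y (diagonal fun _ => y - 1) false true 1 1 a)
    (.inl false) (.inl true) 1 1 b) (.inl (.inl false)) (.inl (.inl true)) 1 1 c

def dumbbellMat (y : R) (a b c : ℕ) : Matrix (((Bool ⊕ Fin a) ⊕ Fin b) ⊕ Fin c)
    (((Bool ⊕ Fin a) ⊕ Fin b) ⊕ Fin c) R :=
  pathMat y (pathMat y (pathMat y (diagonal fun _ => y - 1) false false 1 1 a)
    (.inl true) (.inl true) 1 1 b) (.inl (.inl false)) (.inl (.inl true)) 1 1 c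

/-- The permanent of `thetaMat`. -/
def thetaPerm (y : R) (a b c : ℕ) : R :=
  (y - 1) ^ 2 * contPoly y (a + 1) * contPoly y (b + 1) * contPoly y (c + 1)
  + 2 * (y - 1) * (contPoly y a * contPoly y (b + 1) * contPoly y (c + 1)
    + contPoly y (a + 1) * contPoly y b * contPoly y (c + 1)
    + contPoly y (a + 1) * contPoly y (b + 1) * contPoly y c)
  + 2 * (contPoly y a * contPoly y b * contPoly y (c + 1)
    + contPoly y a * contPoly y (b + 1) * contPoly y c
    + contPoly y (a + 1) * contPoly y b * contPoly y c)
  + (contPoly y (a + 1) - y * contPoly y a) * contPoly y (b + 1) * contPoly y (c + 1)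
  + contPoly y (a + 1) * (contPoly y (b + 1) - y * contPoly y b) * contPoly y (c + 1)
  + contPoly y (a + 1) * contPoly y (b + 1) * (contPoly y (c + 1) - y * contPoly y c)
  + 2 * ((-1) ^ a * (-1) ^ b * contPoly y (c + 1) + (-1) ^ a * contPoly y (b + 1) * (-1) ^ c
    + contPoly y (a + 1) * (-1) ^ b * (-1) ^ c)

theorem permanent_thetaMat (y : R) (a b c : ℕ) :
    (thetaMat y a b c).permanent = thetaPerm y a b c := by
  have h0 : (false : Bool) ≠ true := by decide
  have h1 : (.inl false : Bool ⊕ Fin a) ≠ .inl true := by simp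
  have h2 : (.inl (.inl false) : (Bool ⊕ Fin a) ⊕ Fin b) ≠ .inl (.inl true) := by simp
  simp only [thetaMat, permanent_pathMat _ _ _ h0, permanent_pathMat _ _ _ h1,
    permanent_pathMat _ _ _ h2, pathMat_updateRow_single, Sum.inl.injEq, reduceCtorEq,
    if_true, if_false]
  simp [permanent_bool, diagonal, updateRow_apply, thetaPerm]
  ring

/-- The contribution of a core vertex with a loop of `a` further vertices. -/
def loopPerm (y : R) (a : ℕ) : R :=
  (y - 1) * contPoly y (a + 1) + 2 * contPoly y a + 2 * (-1) ^ (a + 1)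

/-- The permanent of `dumbbellMat`. -/
def dumbbellPerm (y : R) (a b c : ℕ) : R :=
  loopPerm y a * loopPerm y b * contPoly y (c + 1)
  + (contPoly y (a + 1) * loopPerm y b + loopPerm y a * contPoly y (b + 1)) * contPoly y c
  + contPoly y (a + 1) * contPoly y (b + 1) * (contPoly y (c + 1) - y * contPoly y c)

theorem permanent_dumbbellMat (y : R) {a b : ℕ} (ha : a ≠ 0) (hb : b ≠ 0) (c : ℕ) :
    (dumbbellMat y a b c).permanent = dumbbellPerm y a b c := by
  have h0 : (false : Bool) ≠ true := by decide
  have h2 : (.inl (.inl false) : (Bool ⊕ Fin a) ⊕ Fin b) ≠ .inl (.inl true) := by simp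
  simp only [dumbbellMat, permanent_pathMat_loop _ ha,
    permanent_pathMat_loop _ hb, permanent_pathMat _ _ _ h2, pathMat_updateRow_single,
    Sum.inl.injEq, reduceCtorEq, if_true, if_false]
  simp [permanent_bool, diagonal, updateRow_apply, dumbbellPerm, loopPerm]
  ring

/-- The permanent of `y I - A` for a cycle with `a + 1` vertices. -/
def cyclePerm (y : R) (a : ℕ) : R :=
  contPoly y (a + 1) * y + 2 * contPoly y a + 2 * (-1) ^ (a + 1)

theorem permanent_cycleMat (y : R) {a : ℕ} (ha : a ≠ 0) :
    (pathMat y (diagonal fun _ : Unit => y) () () 1 1 a).permanent = cyclePerm y a := by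
  rw [permanent_pathMat_loop _ ha]
  simp [cyclePerm]
  ring

end Matrix

/-! ### Adjacency in subdivided multigraphs. -/

section Thread

variable {U ι : Type*}

/-- The `k`-th vertex on the `i`-th path from `s i` to `t i` with `l i` inner vertices. -/
def threadVertex (s t : ι → U) (l : ι → ℕ) (i : ι) (k : ℕ) : U ⊕ Σ i, Fin (l i) :=
  if k = 0 then .inl (s i)
  else if h : k - 1 < l i then .inr ⟨i, ⟨k - 1, h⟩⟩
  else .inl (t i)

/-- Adjacency in the multigraph with vertex set `U` and edges `s i`, `t i` in which the `i`-th edge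
is subdivided `l i` times. -/
def threadAdj (s t : ι → U) (l : ι → ℕ) (x y : U ⊕ Σ i, Fin (l i)) : Prop :=
  ∃ i k, k ≤ l i ∧
    ((x = threadVertex s t l i k ∧ y = threadVertex s t l i (k + 1)) ∨
      (y = threadVertex s t l i k ∧ x = threadVertex s t l i (k + 1)))

variable (s t : ι → U) (l : ι → ℕ)

theorem threadAdj_comm (x y : U ⊕ Σ i, Fin (l i)) :
    threadAdj s t l x y ↔ threadAdj s t l y x := by
  simp only [threadAdj, or_comm]

theorem threadVertex_zero (i : ι) : threadVertex s t l i 0 = .inl (s i) := rfl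

theorem threadVertex_succ_of_lt {i : ι} {k : ℕ} (h : k < l i) :
    threadVertex s t l i (k + 1) = .inr ⟨i, ⟨k, h⟩⟩ := by
  simp [threadVertex, h]

theorem threadVertex_last (i : ι) : threadVertex s t l i (l i + 1) = .inl (t i) := by
  simp [threadVertex]

theorem threadAdj_iff (x y : U ⊕ Σ i, Fin (l i)) : threadAdj s t l x y ↔
    (∃ i, l i = 0 ∧ (x = .inl (s i) ∧ y = .inl (t i) ∨ y = .inl (s i) ∧ x = .inl (t i))) ∨
    (∃ i, ∃ h : 0 < l i, (x = .inl (s i) ∧ y = .inr ⟨i, ⟨0, h⟩⟩ ∨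
      y = .inl (s i) ∧ x = .inr ⟨i, ⟨0, h⟩⟩)) ∨
    (∃ i, ∃ k : Fin (l i), k.1 + 1 = l i ∧ (x = .inr ⟨i, k⟩ ∧ y = .inl (t i) ∨
      y = .inr ⟨i, k⟩ ∧ x = .inl (t i))) ∨
    (∃ i, ∃ k k' : Fin (l i), k.1 + 1 = k'.1 ∧ (x = .inr ⟨i, k⟩ ∧ y = .inr ⟨i, k'⟩ ∨
      y = .inr ⟨i, k⟩ ∧ x = .inr ⟨i, k'⟩)) := by
  constructor
  · rintro ⟨i, k, hk, h⟩
    rcases k with _ | k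
    · rcases Nat.eq_zero_or_pos (l i) with h0 | h0
      · left
        refine ⟨i, h0, ?_⟩
        have := threadVertex_last s t l i
        rw [h0] at this
        rwa [this, threadVertex_zero] at h
      · right; left
        refine ⟨i, h0, ?_⟩
        rwa [threadVertex_succ_of_lt s t l h0, threadVertex_zero] at h
    · rw [threadVertex_succ_of_lt s t l hk] at h
      rcases hk.eq_or_lt with h1 | h1
      · right; right; left
        refine ⟨i, ⟨k, hk⟩, h1, ?_⟩
        have := threadVertex_last s t l i
        rw [← h1] at this
        rwa [this] at h
      · right; right; right
        refine ⟨i, ⟨k, hk⟩, ⟨k + 1, h1⟩, rfl, ?_⟩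
        rwa [threadVertex_succ_of_lt s t l h1] at h
  · rintro (⟨i, h0, h⟩ | ⟨i, h0, h⟩ | ⟨i, k, h0, h⟩ | ⟨i, k, k', h0, h⟩)
    · refine ⟨i, 0, by omega, ?_⟩
      have := threadVertex_last s t l i
      rw [h0] at this
      rwa [this, threadVertex_zero]
    · refine ⟨i, 0, by omega, ?_⟩
      rwa [threadVertex_succ_of_lt s t l h0, threadVertex_zero]
    · refine ⟨i, k + 1, by omega, ?_⟩
      have := threadVertex_last s t l i
      rw [← h0] at this
      rwa [this, threadVertex_succ_of_lt s t l k.2]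
    · refine ⟨i, k + 1, by omega, ?_⟩
      have : k.1 + 1 < l i := by omega
      rw [threadVertex_succ_of_lt s t l this, threadVertex_succ_of_lt s t l k.2]
      have : k' = ⟨k.1 + 1, this⟩ := by ext; exact h0.symm
      rwa [← this]

theorem threadAdj_inl_inl (u v : U) : threadAdj s t l (.inl u) (.inl v) ↔
    ∃ i, l i = 0 ∧ (u = s i ∧ v = t i ∨ v = s i ∧ u = t i) := by
  simp [threadAdj_iff]

theorem threadAdj_inl_inr (u : U) (i : ι) (k : Fin (l i)) :
    threadAdj s t l (.inl u) (.inr ⟨i, k⟩) ↔ u = s i ∧ k.1 = 0 ∨ u = t i ∧ k.1 + 1 = l i := by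
  simp only [threadAdj_iff, Sum.inl.injEq, Sum.inr.injEq, reduceCtorEq, false_and, and_false,
    or_false, false_or, exists_false, Sigma.mk.injEq]
  constructor
  · rintro (⟨i, h, rfl, rfl, h'⟩ | ⟨i, k, h, ⟨rfl, h'⟩, rfl⟩)
    · cases h'
      simp
    · cases h'
      simp [h]
  · rintro (⟨h, h'⟩ | ⟨h, h'⟩)
    · have : k = ⟨0, by omega⟩ := by ext; exact h'
      exact .inl ⟨i, by omega, h, rfl, heq_of_eq this⟩
    · exact .inr ⟨i, k, h', ⟨rfl, HEq.rfl⟩, h⟩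

theorem threadAdj_inr_inr (i j : ι) (k : Fin (l i)) (k' : Fin (l j)) :
    threadAdj s t l (.inr ⟨i, k⟩) (.inr ⟨j, k'⟩) ↔
      i = j ∧ (k.1 + 1 = k'.1 ∨ k'.1 + 1 = k.1) := by
  simp only [threadAdj_iff, Sum.inr.injEq, reduceCtorEq, false_and, and_false,
    or_false, false_or, exists_false, Sigma.mk.injEq]
  constructor
  · rintro ⟨i, k, k', h, ⟨⟨rfl, h1⟩, rfl, h2⟩ | ⟨⟨rfl, h1⟩, rfl, h2⟩⟩
    · cases h1
      cases h2
      exact ⟨rfl, .inl h⟩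
    · cases h1
      cases h2
      exact ⟨rfl, .inr h⟩
  · rintro ⟨rfl, h | h⟩
    · exact ⟨i, k, k', h, by simp⟩
    · exact ⟨i, k', k, h, by simp⟩

end Thread

/-! ### Adjacency along threads as attached-path matrices. -/

namespace Matrix

/-- The matrix with diagonal `d` and with entry `-1` at the off-diagonal places related by `r`. -/
noncomputable def relMat {V R : Type*} [Ring R] (r : V → V → Prop) (d : V → R) : Matrix V V R :=
  open Classical in of fun i j => if i = j then d i else if r i j then -1 else 0

/-- The paths of three threads, attached one after the other. -/
def threeThreadEquiv (U : Type*) (l : Fin 3 → ℕ) :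
    ((U ⊕ Fin (l 0)) ⊕ Fin (l 1)) ⊕ Fin (l 2) ≃ U ⊕ Σ i, Fin (l i) where
  toFun
    | .inl (.inl (.inl u)) => .inl u
    | .inl (.inl (.inr k)) => .inr ⟨0, k⟩
    | .inl (.inr k) => .inr ⟨1, k⟩
    | .inr k => .inr ⟨2, k⟩
  invFun
    | .inl u => .inl (.inl (.inl u))
    | .inr ⟨0, k⟩ => .inl (.inl (.inr k))
    | .inr ⟨1, k⟩ => .inl (.inr k)
    | .inr ⟨2, k⟩ => .inr k
  left_inv := by
    rintro (((u | k) | k) | k) <;> rfl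
  right_inv := by
    rintro (u | ⟨i, k⟩)
    · rfl
    · fin_cases i <;> rfl

variable {U R : Type*} [DecidableEq U] [CommRing R]

/-- Attaching paths counts edges with multiplicity and adjacency does not. The hypotheses exclude
the discrepancies: two parallel single edges, a loop edge, and a closed thread with one inner
vertex, which is a double edge. -/
theorem relMat_threadAdj_three (s t : Fin 3 → U) (l : Fin 3 → ℕ)
    (h0 : ∀ i j, l i = 0 → l j = 0 → i = j) (h1 : ∀ i, s i = t i → 2 ≤ l i) (x y : R) :
    (relMat (threadAdj s t l) (Sum.elim (fun _ => x) fun _ => y)).submatrix (threeThreadEquiv U l)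
      (threeThreadEquiv U l) =
    pathMat y (pathMat y (pathMat y (diagonal fun _ => x) (s 0) (t 0) 1 1 (l 0))
      (.inl (s 1)) (.inl (t 1)) 1 1 (l 1)) (.inl (.inl (s 2))) (.inl (.inl (t 2))) 1 1 (l 2) := by
  have e0 := h1 0
  have e1 := h1 1
  have e2 := h1 2
  have f01 := h0 0 1
  have f02 := h0 0 2
  have f12 := h0 1 2
  ext (((u | k) | k) | k) (((v | k') | k') | k')
  · simp only [relMat, threeThreadEquiv, pathMat, submatrix_apply, Equiv.coe_fn_mk, of_apply,
      threadAdj_inl_inl, fromBlocks_apply₁₁, Sum.inl.injEq, diagonal_apply, Fin.exists_fin_succ,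
      Sum.elim_inl, Fin.succ_zero_eq_one, Fin.succ_one_eq_two, IsEmpty.exists_iff, or_false]
    grind
  all_goals
    simp only [relMat, threeThreadEquiv, pathMat, submatrix_apply, Equiv.coe_fn_mk, of_apply,
      threadAdj_inl_inr, fromBlocks_apply₁₁, fromBlocks_apply₁₂, fromBlocks_apply₂₁,
      fromBlocks_apply₂₂, Sum.inl.injEq, reduceCtorEq,
      Sum.elim_inl, Sum.elim_inr, threadAdj_inr_inr, threadAdj_comm s t l (.inr _) (.inl _),
      if_false, and_false, false_and, Sum.inr.injEq, Sigma.mk.injEq, heq_eq_eq]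
  all_goals grind

theorem relMat_threadAdj_one (l : Unit → ℕ) (hl : 2 ≤ l ()) (x y : R) :
    ∃ e : Unit ⊕ Fin (l ()) ≃ Unit ⊕ Σ i, Fin (l i),
      (relMat (threadAdj (fun _ => ()) (fun _ => ()) l)
        (Sum.elim (fun _ => x) fun _ => y)).submatrix e e =
      pathMat y (diagonal fun _ : Unit => x) () () 1 1 (l ()) := by
  refine ⟨Equiv.sumCongr (Equiv.refl _) (Equiv.uniqueSigma fun i => Fin (l i)).symm, ?_⟩
  ext (u | k) (v | k')
  · have : l () ≠ 0 := by omega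
    simp [relMat, pathMat, this]
  · simp [relMat, pathMat, threadAdj_inl_inr, Equiv.uniqueSigma]
    grind
  · simp [relMat, pathMat, threadAdj_comm _ _ _ (.inr _) (.inl _), threadAdj_inl_inr,
      Equiv.uniqueSigma]
    grind
  · simp [relMat, pathMat, threadAdj_inr_inr, Equiv.uniqueSigma]

end Matrix

/-! ### Threads of a graph, traced by iterating a map on darts. -/

namespace SimpleGraph

variable {V : Type*} {G : SimpleGraph V} {C : Set V} {φ : G.Dart → G.Dart}

/-- `φ` moves every dart one step further along the paths whose inner vertices lie outside of `C`,
and reverses the darts that point into `C`. -/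
structure Dart.IsStep (C : Set V) (φ : G.Dart → G.Dart) : Prop where
  eq_symm : ∀ d, d.snd ∈ C → φ d = d.symm
  fst_eq : ∀ d, d.snd ∉ C → (φ d).fst = d.snd
  snd_ne : ∀ d, d.snd ∉ C → (φ d).snd ≠ d.fst
  eq_or_eq : ∀ d, d.snd ∉ C → ∀ c, G.Adj d.snd c → c = d.fst ∨ c = (φ d).snd

/-- A dart that arrives at a vertex with exactly two neighbours has one continuation that does not
turn back. -/
theorem exists_isStep (hC : ∀ v ∉ C, (G.neighborSet v).ncard = 2) :
    ∃ φ : G.Dart → G.Dart, Dart.IsStep C φ := by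
  have key : ∀ d : G.Dart, d.snd ∉ C → ∃ e : G.Dart, e.fst = d.snd ∧ e.snd ≠ d.fst ∧
      ∀ c, G.Adj d.snd c → c = d.fst ∨ c = e.snd := fun d hd => by
    obtain ⟨a, b, hab, h⟩ := Set.ncard_eq_two.1 (hC _ hd)
    have hadj : ∀ c, G.Adj d.snd c ↔ c = a ∨ c = b := fun c => by
      rw [← mem_neighborSet, h]
      simp
    rcases (hadj d.fst).1 d.adj.symm with h1 | h1
    · exact ⟨⟨(d.snd, b), (hadj b).2 (.inr rfl)⟩, rfl, by simpa [h1] using hab.symm,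
        fun c hc => by simpa [h1] using (hadj c).1 hc⟩
    · exact ⟨⟨(d.snd, a), (hadj a).2 (.inl rfl)⟩, rfl, by simpa [h1] using hab,
        fun c hc => by simpa [h1, or_comm] using (hadj c).1 hc⟩
  choose f hf using key
  classical
  refine ⟨fun d => if h : d.snd ∈ C then d.symm else f d h, ?_, ?_, ?_, ?_⟩
  · intro d hd
    simp [hd]
  · intro d hd
    simpa [hd] using (hf d hd).1
  · intro d hd
    simpa [hd] using (hf d hd).2.1
  · intro d hd
    simpa [hd] using (hf d hd).2.2

/-- The number of inner vertices of the path that starts with the dart `d`. -/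
noncomputable def Dart.threadLength (C : Set V) (φ : G.Dart → G.Dart) (d : G.Dart) : ℕ :=
  sInf {m | (φ^[m] d).snd ∈ C}

/-- The first dart of the reversal of the path that starts with the dart `d`. -/
noncomputable def Dart.flip (C : Set V) (φ : G.Dart → G.Dart) (d : G.Dart) : G.Dart :=
  (φ^[d.threadLength C φ] d).symm

namespace Dart.IsStep

variable (h : Dart.IsStep C φ)
include h

/-- Steps can be retraced, also at `C`, where the map reverses the dart. This makes the map
injective and reversal of threads an involution. -/
theorem apply_symm (d : G.Dart) : φ (φ d).symm = d.symm := by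
  by_cases hd : d.snd ∈ C
  · rw [h.eq_symm d hd, Dart.symm_symm, h.eq_symm d hd]
  · have h1 : (φ d).symm.snd = d.snd := h.fst_eq d hd
    have h2 : (φ d).symm.snd ∉ C := h1 ▸ hd
    have h3 : (φ (φ d).symm).fst = d.snd := (h.fst_eq _ h2).trans h1
    have h4 : (φ (φ d).symm).snd ≠ (φ d).snd := h.snd_ne _ h2
    have h5 := h.eq_or_eq d hd _ (h3 ▸ (φ (φ d).symm).adj)
    exact Dart.ext _ _ (Prod.ext h3 (h5.resolve_right h4))

theorem injective : Function.Injective φ := fun d d' e => by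
  have := h.apply_symm d
  rw [e, h.apply_symm d'] at this
  exact (Dart.symm_involutive.injective this).symm

theorem iterate_symm (i j : ℕ) (d : G.Dart) :
    φ^[j] (φ^[j + i] d).symm = (φ^[i] d).symm := by
  induction j with
  | zero => simp
  | succ j ih =>
    rw [Function.iterate_succ_apply, show j + 1 + i = (j + i) + 1 by omega,
      Function.iterate_succ_apply', h.apply_symm, ih]

variable [Finite V] {d d' : G.Dart}

/-- An injective self-map of a finite set returns to `d`. If the dart just before the return ended
outside `C`, then `d` would start there, which it does not; so `C` is reached and the infimum is
attained. -/
theorem snd_threadLength (hd : d.fst ∈ C) : (φ^[d.threadLength C φ] d).snd ∈ C := by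
  have : Finite G.Dart := Finite.of_injective _ Dart.toProd_injective
  refine Nat.sInf_mem (s := {m | (φ^[m] d).snd ∈ C}) ?_
  obtain ⟨n, hn, hp⟩ := h.injective.mem_periodicPts d
  obtain ⟨k, rfl⟩ := Nat.exists_eq_succ_of_ne_zero hn.ne'
  refine ⟨k, by_contra fun hk => hk ?_⟩
  have h1 : φ (φ^[k] d) = d := (Function.iterate_succ_apply' φ k d).symm.trans hp
  have h2 := h.fst_eq _ hk
  rw [h1] at h2
  rw [Set.mem_ofPred_eq, ← h2]
  exact hd

omit h [Finite V] in
theorem snd_notMem {k : ℕ} (hk : k < d.threadLength C φ) : (φ^[k] d).snd ∉ C :=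
  Nat.notMem_of_lt_sInf (s := {m | (φ^[m] d).snd ∈ C}) hk

omit [Finite V] in
theorem fst_succ {k : ℕ} (hk : k < d.threadLength C φ) :
    (φ^[k + 1] d).fst = (φ^[k] d).snd := by
  rw [Function.iterate_succ_apply', h.fst_eq _ (snd_notMem hk)]

omit [Finite V] in
theorem fst_notMem {k : ℕ} (hk : k < d.threadLength C φ) : (φ^[k + 1] d).fst ∉ C :=
  h.fst_succ hk ▸ snd_notMem hk

omit [Finite V] in
theorem iterate_inj (hd : d.fst ∈ C) (hd' : d'.fst ∈ C) {i j : ℕ} (hi : i ≤ d.threadLength C φ)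
    (hj : j ≤ d'.threadLength C φ) (e : φ^[i] d = φ^[j] d') : i = j ∧ d = d' := by
  wlog hij : i ≤ j generalizing d d' i j
  · exact (this hd' hd hj hi e.symm (by omega)).imp Eq.symm Eq.symm
  obtain ⟨k, rfl⟩ := Nat.exists_eq_add_of_le hij
  rw [Function.iterate_add_apply] at e
  have e := h.injective.iterate i e
  rcases k with _ | k
  · exact ⟨rfl, e⟩
  · exact absurd (e ▸ hd) (h.fst_notMem (by omega))

theorem flip_fst_mem (hd : d.fst ∈ C) : (d.flip C φ).fst ∈ C := h.snd_threadLength hd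

omit [Finite V] in
theorem iterate_flip {j : ℕ} (hj : j ≤ d.threadLength C φ) :
    φ^[j] (d.flip C φ) = (φ^[d.threadLength C φ - j] d).symm := by
  have := h.iterate_symm (d.threadLength C φ - j) j d
  rwa [Nat.add_sub_cancel' hj] at this

theorem threadLength_flip (hd : d.fst ∈ C) :
    (d.flip C φ).threadLength C φ = d.threadLength C φ := by
  refine le_antisymm (Nat.sInf_le ?_) (not_lt.1 fun hlt => ?_)
  · rw [Set.mem_ofPred_eq, h.iterate_flip le_rfl]
    simpa using hd
  · have h1 := h.snd_threadLength (h.flip_fst_mem hd)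
    rw [h.iterate_flip hlt.le] at h1
    obtain ⟨k, hk⟩ := Nat.exists_eq_add_of_lt hlt
    rw [show d.threadLength C φ - (d.flip C φ).threadLength C φ = k + 1 by omega] at h1
    exact h.fst_notMem (by omega) h1

theorem flip_flip (hd : d.fst ∈ C) : (d.flip C φ).flip C φ = d := by
  rw [Dart.flip, h.threadLength_flip hd, h.iterate_flip le_rfl]
  simp

omit [Finite V] in
-- A thread equal to its own reversal would fold in its middle: either a dart equals its reverse, or
-- a step turns back.
theorem flip_ne : d.flip C φ ≠ d := fun e => by
  have key := fun j hj => h.iterate_flip (d := d) (j := j) hj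
  rw [e] at key
  rcases Nat.even_or_odd' (d.threadLength C φ) with ⟨m, hm | hm⟩
  · have h1 := key m (by omega)
    rw [show d.threadLength C φ - m = m by omega] at h1
    exact Dart.symm_ne _ h1.symm
  · have h1 := key m (by omega)
    rw [show d.threadLength C φ - m = m + 1 by omega, Function.iterate_succ_apply'] at h1
    have h2 := h.snd_ne _ (snd_notMem (d := d) (k := m) (C := C) (φ := φ) (by omega))
    have h3 := congrArg (fun x : G.Dart => x.fst) h1
    exact h2 h3.symm

/-- An inner vertex has only two neighbours, so two threads through it enter along the same dart or
from opposite sides; they coincide or are reversals of each other. -/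
theorem inner_inj (hd : d.fst ∈ C) (hd' : d'.fst ∈ C) {i j : ℕ} (hi : i < d.threadLength C φ)
    (hj : j < d'.threadLength C φ) (e : (φ^[i + 1] d).fst = (φ^[j + 1] d').fst) :
    i = j ∧ d = d' ∨ d' = d.flip C φ := by
  rw [h.fst_succ hi, h.fst_succ hj] at e
  rcases h.eq_or_eq _ (snd_notMem hi) _ (e ▸ (φ^[j] d').adj.symm) with h1 | h1
  · exact .inl (h.iterate_inj hd hd' hi.le hj.le (Dart.ext _ _ (Prod.ext h1.symm e)))
  · right
    have h2 : φ^[j] d' = φ^[d.threadLength C φ - (i + 1)] (d.flip C φ) := by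
      rw [h.iterate_flip (by omega),
        show d.threadLength C φ - (d.threadLength C φ - (i + 1)) = i + 1 by omega,
        Function.iterate_succ_apply']
      exact Dart.ext _ _ (Prod.ext h1 (e.symm.trans (h.fst_eq _ (snd_notMem hi)).symm))
    exact (h.iterate_inj hd' (h.flip_fst_mem hd) hj.le
      (by rw [h.threadLength_flip hd]; omega) h2).2

/-- The vertices on a family of paths that use each dart at `C` exactly once, up to reversal. -/
theorem exists_threads {U ι : Type*} (c : U → V) (hc : Function.Injective c)
    (hcC : Set.range c = C) (r : ι → G.Dart) (hr : Function.Injective r) (s t : ι → U)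
    (hs : ∀ i, c (s i) = (r i).fst) (ht : ∀ i, c (t i) = ((r i).flip C φ).fst)
    (hflip : ∀ i j, r i ≠ (r j).flip C φ)
    (hcover : ∀ d : G.Dart, d.fst ∈ C → ∃ i, d = r i ∨ d = (r i).flip C φ) :
    ∃ f : (U ⊕ Σ i, Fin ((r i).threadLength C φ)) → V, Function.Injective f ∧
      (∀ u, f (.inl u) = c u) ∧ (∀ x, f (.inr x) ∉ C) ∧
      (∀ x y, threadAdj s t (fun i => (r i).threadLength C φ) x y → G.Adj (f x) (f y)) ∧
      ∀ x w, G.Adj (f x) w →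
        ∃ y, f y = w ∧ threadAdj s t (fun i => (r i).threadLength C φ) x y := by
  set l : ι → ℕ := fun i => (r i).threadLength C φ with hl
  let f : (U ⊕ Σ i, Fin (l i)) → V := Sum.elim c fun x => (φ^[x.2 + 1] (r x.1)).fst
  have hrC : ∀ i, (r i).fst ∈ C := fun i => hcC ▸ ⟨s i, hs i⟩
  have f1 : ∀ i k, k ≤ l i → f (threadVertex s t l i k) = (φ^[k] (r i)).fst := by
    rintro i (_ | k) hk
    · exact hs i
    · rw [threadVertex_succ_of_lt _ _ _ hk]
      rfl
  have f2 : ∀ i k, k ≤ l i → f (threadVertex s t l i (k + 1)) = (φ^[k] (r i)).snd := by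
    intro i k hk
    rcases hk.eq_or_lt with rfl | hk
    · rw [threadVertex_last]
      exact ht i
    · rw [f1 i _ hk, h.fst_succ hk]
  have f3 : ∀ x, f (.inr x) ∉ C := fun x => h.fst_notMem x.2.2
  refine ⟨f, ?_, fun u => rfl, f3, ?_, ?_⟩
  · rintro (u | ⟨i, k⟩) (v | ⟨j, k'⟩) e
    · exact congrArg _ (hc e)
    · exact absurd (hcC ▸ ⟨u, e⟩) (f3 ⟨j, k'⟩)
    · exact absurd (hcC ▸ ⟨v, e.symm⟩) (f3 ⟨i, k⟩)
    · rcases h.inner_inj (hrC i) (hrC j) k.2 k'.2 e with ⟨h1, h2⟩ | h1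
      · obtain rfl := hr h2
        rw [Fin.ext h1]
      · exact absurd h1 (hflip _ _)
  · rintro x y ⟨i, k, hk, ⟨rfl, rfl⟩ | ⟨rfl, rfl⟩⟩
    · rw [f1 i k hk, f2 i k hk]
      exact (φ^[k] (r i)).adj
    · rw [f1 i k hk, f2 i k hk]
      exact (φ^[k] (r i)).adj.symm
  · rintro (u | ⟨i, k⟩) w hw
    · obtain ⟨i, hi | hi⟩ := hcover ⟨(c u, w), hw⟩ (hcC ▸ ⟨u, rfl⟩)
      · have h1 : u = s i := hc (by rw [hs, ← hi])
        refine ⟨threadVertex s t l i 1, ?_, i, 0, by omega, .inl ⟨?_, rfl⟩⟩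
        · rw [f2 i 0 (by omega), Function.iterate_zero_apply, ← hi]
        · rw [h1, threadVertex_zero]
      · have h1 : u = t i := hc (by rw [ht, ← hi])
        refine ⟨threadVertex s t l i (l i), ?_, i, l i, le_rfl, .inr ⟨rfl, ?_⟩⟩
        · rw [f1 i _ le_rfl]
          exact congrArg (fun d : G.Dart => d.snd) hi.symm
        · rw [h1, threadVertex_last]
    · have h1 : threadVertex s t l i (k + 1) = .inr ⟨i, k⟩ :=
        threadVertex_succ_of_lt s t l k.2
      have hw' : G.Adj (φ^[k.1] (r i)).snd w := by
        rw [← f2 i k k.2.le, h1]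
        exact hw
      rcases h.eq_or_eq _ (snd_notMem k.2) _ hw' with h2 | h2
      · exact ⟨threadVertex s t l i k, (f1 i k k.2.le).trans h2.symm, i, k, k.2.le,
          .inr ⟨rfl, h1.symm⟩⟩
      · refine ⟨threadVertex s t l i (k + 1 + 1), (f2 i (k + 1) k.2).trans ?_, i, k + 1, k.2,
          .inl ⟨h1.symm, rfl⟩⟩
        rw [h2, Function.iterate_succ_apply']

end Dart.IsStep

end SimpleGraph

/-! ### Splitting off components, and disjoint unions of cycles. -/

namespace Matrix

/-- No relation leaves the range of `f`, so by symmetry the matrix is block diagonal. -/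
theorem permanent_relMat_split {V X R : Type*} [Fintype V] [DecidableEq V] [Fintype X]
    [DecidableEq X] [CommRing R] {r : V → V → Prop} (hsymm : ∀ a b, r a b → r b a)
    {q : X → X → Prop} {f : X → V} (hf : Function.Injective f)
    (hq : ∀ x y, r (f x) (f y) ↔ q x y) (hcl : ∀ x w, r (f x) w → w ∈ Set.range f)
    [Fintype {w // w ∉ Set.range f}] (d : V → R) :
    (relMat r d).permanent = (relMat q (d ∘ f)).permanent *
      (relMat (fun a b : {w // w ∉ Set.range f} => r a b) fun a => d a).permanent := by
  classical
  let e : X ⊕ {w // w ∉ Set.range f} ≃ V :=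
    (Equiv.sumCongr (Equiv.ofInjective f hf) (Equiv.refl _)).trans
      (Equiv.sumCompl fun w => w ∈ Set.range f)
  have e1 : ∀ x, e (.inl x) = f x := fun x => rfl
  have e2 : ∀ x, e (.inr x) = x.1 := fun x => rfl
  rw [← permanent_submatrix_equiv_self e, ← permanent_fromBlocks_zero]
  congr 1
  ext (x | x) (y | y)
  · simp [relMat, e1, hf.eq_iff, hq]
  · have h1 : f x ≠ y.1 := fun h => y.2 ⟨x, h⟩
    have h2 : ¬ r (f x) y.1 := fun h => y.2 (hcl _ _ h)
    simp [relMat, e1, e2, h1, h2]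
  · have h1 : x.1 ≠ f y := fun h => x.2 ⟨y, h.symm⟩
    have h2 : ¬ r x.1 (f y) := fun h => x.2 (hcl _ _ (hsymm _ _ h))
    simp [relMat, e1, e2, h1, h2]
  · simp [relMat, e2, Subtype.ext_iff]

end Matrix

namespace SimpleGraph

open Matrix

variable {V : Type*} {G : SimpleGraph V}

theorem ncard_neighborSet_induce {s : Set V} (hcl : ∀ a b, G.Adj a b → a ∉ s → b ∉ s)
    (w : {w // w ∉ s}) :
    ((G.induce {w | w ∉ s}).neighborSet w).ncard = (G.neighborSet w.1).ncard := by
  rw [← Set.ncard_image_of_injective _ Subtype.val_injective]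
  congr 1
  ext b
  simp only [Set.mem_image, mem_neighborSet, Subtype.exists]
  constructor
  · rintro ⟨b, hb, h, rfl⟩
    exact h
  · intro h
    exact ⟨b, hcl _ _ h w.2, h, rfl⟩

/-- A closed thread without inner vertices would be a loop edge, and with one inner vertex it would
turn back there. -/
theorem Dart.IsStep.two_le_threadLength {C : Set V} {φ : G.Dart → G.Dart}
    (h : Dart.IsStep C φ) {d : G.Dart} (he : (d.flip C φ).fst = d.fst) :
    2 ≤ d.threadLength C φ := by
  by_contra! hlt
  have : d.threadLength C φ = 0 ∨ d.threadLength C φ = 1 := by omega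
  rcases this with h0 | h1
  · rw [Dart.flip, h0] at he
    exact d.adj.ne he.symm
  · rw [Dart.flip, h1] at he
    exact h.snd_ne d (Dart.IsStep.snd_notMem (k := 0) (d := d) (C := C) (φ := φ) (by omega)) he

theorem exists_dart_of_ncard_two {w : V} (h : (G.neighborSet w).ncard = 2) :
    ∃ d₁ d₂ : G.Dart, d₁ ≠ d₂ ∧ ∀ d : G.Dart, d.fst = w ↔ d = d₁ ∨ d = d₂ := by
  obtain ⟨a, b, hab, hs⟩ := Set.ncard_eq_two.1 h
  have hadj : ∀ c, G.Adj w c ↔ c = a ∨ c = b := fun c => by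
    rw [← mem_neighborSet, hs]
    simp
  refine ⟨⟨(w, a), (hadj a).2 (.inl rfl)⟩, ⟨(w, b), (hadj b).2 (.inr rfl)⟩, by simpa using hab,
    fun d => ⟨?_, ?_⟩⟩
  · rintro rfl
    exact ((hadj d.snd).1 d.adj).imp (fun e => Dart.ext _ _ (Prod.ext rfl e))
      fun e => Dart.ext _ _ (Prod.ext rfl e)
  · rintro (rfl | rfl) <;> rfl

theorem exists_dart_of_ncard_three {w : V} (h : (G.neighborSet w).ncard = 3) :
    ∃ d₁ d₂ d₃ : G.Dart, d₁ ≠ d₂ ∧ d₁ ≠ d₃ ∧ d₂ ≠ d₃ ∧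
      ∀ d : G.Dart, d.fst = w ↔ d = d₁ ∨ d = d₂ ∨ d = d₃ := by
  obtain ⟨a, b, c, hab, hac, hbc, hs⟩ := Set.ncard_eq_three.1 h
  have hadj : ∀ x, G.Adj w x ↔ x = a ∨ x = b ∨ x = c := fun x => by
    rw [← mem_neighborSet, hs]
    simp
  refine ⟨⟨(w, a), (hadj a).2 (.inl rfl)⟩, ⟨(w, b), (hadj b).2 (.inr (.inl rfl))⟩,
    ⟨(w, c), (hadj c).2 (.inr (.inr rfl))⟩, by simpa using hab, by simpa using hac,
    by simpa using hbc, fun d => ⟨?_, ?_⟩⟩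
  · rintro rfl
    exact ((hadj d.snd).1 d.adj).imp (fun e => Dart.ext _ _ (Prod.ext rfl e))
      fun e => e.imp (fun e => Dart.ext _ _ (Prod.ext rfl e))
        fun e => Dart.ext _ _ (Prod.ext rfl e)
  · rintro (rfl | rfl | rfl) <;> rfl

/-- The permanent of `y I - A` for a graph that is a disjoint union of cycles. -/
theorem exists_permanent_eq_prod_cyclePerm (n : ℕ) : ∀ {V : Type*} [Fintype V] [DecidableEq V]
    (G : SimpleGraph V), Fintype.card V = n → (∀ v, (G.neighborSet v).ncard = 2) →
    ∃ ks : List ℕ, (∀ k ∈ ks, 3 ≤ k) ∧ ks.sum = n ∧ ∀ {R : Type} [CommRing R] (y : R),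
      (relMat G.Adj fun _ => y).permanent = (ks.map fun k => cyclePerm y (k - 1)).prod := by
  induction n using Nat.strong_induction_on with
  | _ n ih =>
  intro V _ _ G hn hG
  rcases isEmpty_or_nonempty V with hV | ⟨⟨w⟩⟩
  · refine ⟨[], by simp, by simpa [eq_comm] using hn, fun y => ?_⟩
    simp [permanent_isEmpty]
  obtain ⟨φ, h⟩ := exists_isStep (G := G) (C := {w}) fun v _ => hG v
  obtain ⟨d₁, d₂, hne, hd⟩ := exists_dart_of_ncard_two (hG w)
  have h1 : d₁.fst = w := (hd d₁).2 (.inl rfl)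
  have hf1 : (d₁.flip {w} φ).fst = w := h.flip_fst_mem (d := d₁) h1
  -- With the single core vertex `w`, the thread leaving along `d₁` returns along `d₂`, the only
  -- other dart at `w`; it is the cycle through `w`.
  have hf2 : d₁.flip {w} φ = d₂ := ((hd _).1 hf1).resolve_left h.flip_ne
  have hex := h.exists_threads (U := Unit) (ι := Unit) (fun _ => w)
    (fun _ _ _ => rfl) (by simp) (fun _ => d₁) (fun _ _ _ => rfl) (fun _ => ()) (fun _ => ())
    (fun _ => h1.symm) (fun _ => hf1.symm) (fun _ _ => h.flip_ne.symm)
    (fun d hdw => ⟨(), by rw [hf2]; exact (hd d).1 hdw⟩)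
  have hlen := h.two_le_threadLength (d := d₁) (hf1.trans h1.symm)
  generalize d₁.threadLength {w} φ = a at hex hlen
  obtain ⟨f, hf, -, -, hadj, hcl⟩ := hex
  classical
  have hcl' : ∀ x w, G.Adj (f x) w → w ∈ Set.range f := fun x w hw =>
    let ⟨y, hy, _⟩ := hcl x w hw
    ⟨y, hy⟩
  have hcard : (a + 1) + Fintype.card {w // w ∉ Set.range f} = n := by
    have e := Fintype.card_congr ((Equiv.sumCongr (Equiv.ofInjective f hf) (Equiv.refl _)).trans
      (Equiv.sumCompl fun w => w ∈ Set.range f))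
    simp only [Fintype.card_sum, Fintype.card_unit, Fintype.card_sigma, Fintype.card_fin] at e
    rw [← hn, ← e]
    simp
    ring
  obtain ⟨ks, hk3, hks, hper⟩ := ih (Fintype.card {w // w ∉ Set.range f}) (by omega)
    (G.induce {w | w ∉ Set.range f}) rfl fun w => by
      rw [ncard_neighborSet_induce (fun a b hab ha hb => ha ?_)]
      · exact hG _
      · obtain ⟨x, rfl⟩ := hb
        exact hcl' _ _ hab.symm
  refine ⟨(a + 1) :: ks, ?_, ?_, ?_⟩
  · intro k hk
    rcases List.mem_cons.1 hk with rfl | hk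
    · omega
    · exact hk3 k hk
  · rw [List.sum_cons, hks, hcard]
  · intro R _ y
    rw [permanent_relMat_split (fun _ _ hab => hab.symm) hf (q := threadAdj (fun _ => ()) (fun _ => ())
      fun _ => a) ?_ hcl', List.map_cons, List.prod_cons]
    · congr 1
      · obtain ⟨e, he⟩ := relMat_threadAdj_one (R := R) (fun _ => a) hlen y y
        rw [← permanent_submatrix_equiv_self e, Nat.add_sub_cancel,
          ← permanent_cycleMat y (by omega : a ≠ 0), ← he]
        congr 3
        ext x
        rcases x with x | x <;> rfl
      · rw [← hper]
        rfl
    · refine fun x y => ⟨fun hxy => ?_, hadj x y⟩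
      obtain ⟨z, hz, hxz⟩ := hcl _ _ hxy
      rwa [← hf hz]

end SimpleGraph

/-! ### Graphs with two vertices of degree three and all others of degree two. -/

namespace SimpleGraph

open Matrix

variable {V : Type*} {G : SimpleGraph V}

theorem exists_third {α : Type*} {P : α → Prop} {x₁ x₂ x₃ : α} (h12 : x₁ ≠ x₂) (h13 : x₁ ≠ x₃)
    (h23 : x₂ ≠ x₃) (h : ∀ d, P d ↔ d = x₁ ∨ d = x₂ ∨ d = x₃) {a b : α} (ha : P a) (hb : P b)
    (hab : a ≠ b) : ∃ c, P c ∧ c ≠ a ∧ c ≠ b ∧ ∀ d, P d → d = a ∨ d = b ∨ d = c := by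
  simp only [h] at *
  rcases ha with rfl | rfl | rfl <;> rcases hb with rfl | rfl | rfl <;>
    first
    | exact absurd rfl hab
    | exact ⟨x₁, by tauto⟩
    | exact ⟨x₂, by tauto⟩
    | exact ⟨x₃, by tauto⟩

/-- A fixed-point free involution on two disjoint sets of three elements either exchanges the sets,
or it preserves a pair in each of them. -/
theorem exists_pairing {α : Type*} {P Q : α → Prop} (hPQ : ∀ d, P d → ¬ Q d) {F : α → α}
    (hFm : ∀ d, P d ∨ Q d → P (F d) ∨ Q (F d)) (hFF : ∀ d, P d ∨ Q d → F (F d) = d)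
    (hFn : ∀ d, F d ≠ d) {x₁ x₂ x₃ y₁ y₂ y₃ : α} (x12 : x₁ ≠ x₂) (x13 : x₁ ≠ x₃) (x23 : x₂ ≠ x₃)
    (hx : ∀ d, P d ↔ d = x₁ ∨ d = x₂ ∨ d = x₃) (y12 : y₁ ≠ y₂) (y13 : y₁ ≠ y₃) (y23 : y₂ ≠ y₃)
    (hy : ∀ d, Q d ↔ d = y₁ ∨ d = y₂ ∨ d = y₃) :
    ∃ (r : Fin 3 → α) (s t : Fin 3 → Bool),
      (s = (fun _ => false) ∧ t = (fun _ => true) ∨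
        s = ![false, true, false] ∧ t = ![false, true, true]) ∧ Function.Injective r ∧
      (∀ i, if s i then Q (r i) else P (r i)) ∧ (∀ i, if t i then Q (F (r i)) else P (F (r i))) ∧
      (∀ i j, r i ≠ F (r j)) ∧ ∀ d, P d ∨ Q d → ∃ i, d = r i ∨ d = F (r i) := by
  by_cases hθ : ∀ d, P d → Q (F d)
  · refine ⟨![x₁, x₂, x₃], fun _ => false, fun _ => true, .inl ⟨rfl, rfl⟩, ?_, ?_, ?_, ?_, ?_⟩
    · intro i j hij
      fin_cases i <;> fin_cases j <;> simp_all
    · intro i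
      fin_cases i <;> simp <;> grind
    · intro i
      fin_cases i <;> simp <;> grind
    · intro i j
      fin_cases i <;> fin_cases j <;> simp <;> grind
    · intro d hd
      simp only [Fin.exists_fin_succ]
      simp
      grind
  · push Not at hθ
    obtain ⟨d₁, hd1, hd2⟩ := hθ
    have hF1 : P (F d₁) := (hFm d₁ (.inl hd1)).resolve_right hd2
    obtain ⟨d₃, h31, h32, h33, h34⟩ := exists_third x12 x13 x23 hx hd1 hF1 (hFn d₁).symm
    -- The other two darts of the first triple are already exchanged by `F`, and `F` has no fixed
    -- point, so the third must be matched across.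
    have hF3 : Q (F d₃) := by
      refine (hFm d₃ (.inl h31)).resolve_left fun h3 => ?_
      rcases h34 _ h3 with h4 | h4 | h4 <;> grind
    obtain ⟨e₁, he1, he2⟩ : ∃ e₁, Q e₁ ∧ e₁ ≠ F d₃ := by
      by_cases h1 : y₁ = F d₃
      · exact ⟨y₂, (hy _).2 (.inr (.inl rfl)), h1 ▸ y12.symm⟩
      · exact ⟨y₁, (hy _).2 (.inl rfl), h1⟩
    have hF4 : Q (F e₁) := by
      refine (hFm e₁ (.inr he1)).resolve_left fun h3 => ?_
      rcases h34 _ h3 with h4 | h4 | h4 <;> grind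
    have hF5 : F e₁ ≠ F d₃ := by grind
    have hcov : ∀ d, Q d → d = e₁ ∨ d = F e₁ ∨ d = F d₃ := by
      obtain ⟨e₃, -, -, -, he3⟩ := exists_third y12 y13 y23 hy he1 hF4 (hFn e₁).symm
      intro d hd
      rcases he3 _ hF3 with h4 | h4 | h4
      · exact absurd h4.symm he2
      · exact absurd h4.symm hF5
      · rw [h4]
        exact he3 d hd
    clear hx hy x12 x13 x23 y12 y13 y23
    refine ⟨![d₁, e₁, d₃], ![false, true, false], ![false, true, true], .inr ⟨rfl, rfl⟩,
      ?_, ?_, ?_, ?_, ?_⟩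
    · intro i j hij
      fin_cases i <;> fin_cases j <;> simp at hij ⊢ <;> grind
    · intro i
      fin_cases i <;> simpa
    · intro i
      fin_cases i <;> simpa
    · intro i j
      fin_cases i <;> fin_cases j <;> simp <;> grind
    · intro d hd
      simp only [Fin.exists_fin_succ]
      simp
      grind

theorem exists_theta_or_dumbbell_threads [Finite V] {u v : V} (huv : u ≠ v)
    (hu : (G.neighborSet u).ncard = 3) (hv : (G.neighborSet v).ncard = 3)
    (h2 : ∀ w, w ≠ u → w ≠ v → (G.neighborSet w).ncard = 2) :
    ∃ (s t : Fin 3 → Bool) (l : Fin 3 → ℕ) (f : (Bool ⊕ Σ i, Fin (l i)) → V),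
      (s = (fun _ => false) ∧ t = (fun _ => true) ∨
        s = ![false, true, false] ∧ t = ![false, true, true]) ∧
      (∀ i j, l i = 0 → l j = 0 → i = j) ∧ (∀ i, s i = t i → 2 ≤ l i) ∧
      Function.Injective f ∧ (∀ b, f (.inl b) = if b then v else u) ∧
      (∀ x, f (.inr x) ≠ u ∧ f (.inr x) ≠ v) ∧
      (∀ x y, threadAdj s t l x y → G.Adj (f x) (f y)) ∧
      ∀ x w, G.Adj (f x) w → ∃ y, f y = w ∧ threadAdj s t l x y := by
  obtain ⟨φ, h⟩ := exists_isStep (G := G) (C := {u, v}) fun w hw => by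
    simp only [Set.mem_insert_iff, Set.mem_singleton_iff, not_or] at hw
    exact h2 w hw.1 hw.2
  obtain ⟨x₁, x₂, x₃, x12, x13, x23, hx⟩ := exists_dart_of_ncard_three hu
  obtain ⟨y₁, y₂, y₃, y12, y13, y23, hy⟩ := exists_dart_of_ncard_three hv
  obtain ⟨r, s, t, hst, hr, hs, ht, hrF, hcov⟩ := exists_pairing
    (P := fun d : G.Dart => d.fst = u) (Q := fun d : G.Dart => d.fst = v)
    (F := Dart.flip (G := G) {u, v} φ) (fun d h h' => huv (h.symm.trans h'))
    (fun d hd => h.flip_fst_mem hd) (fun d hd => h.flip_flip hd) (fun d => h.flip_ne)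
    x12 x13 x23 hx y12 y13 y23 hy
  have hs' : ∀ i, (if s i then v else u) = (r i).fst := fun i => by
    cases hsi : s i <;> simpa [hsi, eq_comm] using hs i
  have ht' : ∀ i, (if t i then v else u) = ((r i).flip {u, v} φ).fst := fun i => by
    cases hti : t i <;> simpa [hti, eq_comm] using ht i
  have hb : Function.Injective fun b : Bool => if b then v else u := by
    intro b b'
    cases b <;> cases b' <;> simp [huv, huv.symm]
  have hex := h.exists_threads (fun b : Bool => if b then v else u) hb
    (by ext w; simp [eq_comm]) r hr s t hs' ht' hrF hcov
  have hloop : ∀ i, s i = t i → 2 ≤ (r i).threadLength {u, v} φ := fun i hi =>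
    h.two_le_threadLength (by rw [← ht', ← hi, hs'])
  -- Two threads from `u` to `v` without inner vertices are the same edge of a simple graph; in the
  -- dumbbell case only the bridge can be a single edge.
  have hzero : ∀ i j, (r i).threadLength {u, v} φ = 0 → (r j).threadLength {u, v} φ = 0 →
      i = j := fun i j hi hj => by
    rcases hst with ⟨rfl, rfl⟩ | ⟨rfl, rfl⟩
    · refine hr (Dart.ext _ _ (Prod.ext ?_ ?_))
      · rw [← hs', ← hs']
      · have hi' := ht' i
        have hj' := ht' j
        rw [Dart.flip, hi] at hi'
        rw [Dart.flip, hj] at hj'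
        exact hi'.symm.trans hj'
    · have key : ∀ i, (r i).threadLength {u, v} φ = 0 → i = 2 := fun i hi => by
        have := hloop i
        fin_cases i <;> simp_all
      rw [key i hi, key j hj]
  obtain ⟨f, hf, hfU, hfC, h3, h4⟩ := hex
  exact ⟨s, t, _, f, hst, hzero, hloop, hf, hfU, fun x => by simpa using hfC x, h3, h4⟩

/-- The structure of a graph with two vertices of degree three and all others of degree two, and
the permanent of `(y + 2) I - Q` for it. -/
theorem exists_permanent_eq_theta_or_dumbbell [Fintype V] [DecidableEq V] {u v : V} (huv : u ≠ v)
    (hu : (G.neighborSet u).ncard = 3) (hv : (G.neighborSet v).ncard = 3)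
    (h2 : ∀ w, w ≠ u → w ≠ v → (G.neighborSet w).ncard = 2) :
    ∃ (l : Fin 3 → ℕ) (ks : List ℕ), (∀ k ∈ ks, 3 ≤ k) ∧
      l 0 + l 1 + l 2 + 2 + ks.sum = Fintype.card V ∧
      (((∀ i j, l i = 0 → l j = 0 → i = j) ∧
        (∀ {R : Type} [CommRing R] (y : R),
          (relMat G.Adj fun w => if w = u ∨ w = v then y - 1 else y).permanent =
            thetaPerm y (l 0) (l 1) (l 2) * (ks.map fun k => cyclePerm y (k - 1)).prod) ∧
        (ks = [] → ∃ e : (Bool ⊕ Σ i, Fin (l i)) ≃ V, ∀ x y, G.Adj (e x) (e y) ↔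
          threadAdj (fun _ => false) (fun _ => true) l x y)) ∨
      (2 ≤ l 0 ∧ 2 ≤ l 1 ∧ ∀ {R : Type} [CommRing R] (y : R),
          (relMat G.Adj fun w => if w = u ∨ w = v then y - 1 else y).permanent =
            dumbbellPerm y (l 0) (l 1) (l 2) * (ks.map fun k => cyclePerm y (k - 1)).prod)) := by
  obtain ⟨s, t, l, f, hst, hzero, hloop, hf, hfU, hfC, hadj, hcl⟩ :=
    exists_theta_or_dumbbell_threads huv hu hv h2
  classical
  have hcl' : ∀ x w, G.Adj (f x) w → w ∈ Set.range f := fun x w hw =>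
    let ⟨y, hy, _⟩ := hcl x w hw
    ⟨y, hy⟩
  have hiff : ∀ x y, G.Adj (f x) (f y) ↔ threadAdj s t l x y := fun x y =>
    ⟨fun hxy => by
      obtain ⟨z, hz, hxz⟩ := hcl _ _ hxy
      rwa [← hf hz], hadj x y⟩
  let e := (Equiv.sumCongr (Equiv.ofInjective f hf) (Equiv.refl _)).trans
      (Equiv.sumCompl fun w => w ∈ Set.range f)
  have hcard : l 0 + l 1 + l 2 + 2 + Fintype.card {w // w ∉ Set.range f} = Fintype.card V := by
    have e := Fintype.card_congr e
    simp only [Fintype.card_sum, Fintype.card_bool, Fintype.card_sigma, Fintype.card_fin,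
      Fin.sum_univ_three] at e
    rw [← e]
    simp
    ring
  have hur : ∀ w : {w // w ∉ Set.range f}, w.1 ≠ u ∧ w.1 ≠ v := fun w =>
    ⟨fun h => w.2 ⟨.inl false, by simp [hfU, h]⟩, fun h => w.2 ⟨.inl true, by simp [hfU, h]⟩⟩
  obtain ⟨ks, hk3, hks, hper⟩ := exists_permanent_eq_prod_cyclePerm _
    (G.induce {w | w ∉ Set.range f}) rfl fun w => by
      rw [ncard_neighborSet_induce (fun a b hab ha hb => ha ?_)]
      · exact h2 _ (hur w).1 (hur w).2
      · obtain ⟨x, rfl⟩ := hb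
        exact hcl' _ _ hab.symm
  have hsplit : ∀ {R : Type} [CommRing R] (y : R),
      (relMat G.Adj fun w => if w = u ∨ w = v then y - 1 else y).permanent =
      (pathMat y (pathMat y (pathMat y (diagonal fun _ => y - 1) (s 0) (t 0) 1 1 (l 0))
        (.inl (s 1)) (.inl (t 1)) 1 1 (l 1)) (.inl (.inl (s 2))) (.inl (.inl (t 2)))
          1 1 (l 2)).permanent * (ks.map fun k => cyclePerm y (k - 1)).prod := by
    intro R _ y
    rw [permanent_relMat_split (fun _ _ hab => hab.symm) hf hiff hcl', ← hper,
      ← relMat_threadAdj_three s t l hzero hloop, permanent_submatrix_equiv_self]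
    congr 2
    · congr 1
      ext x
      rcases x with x | x
      · cases x <;> simp [hfU]
      · simp [hfC x]
    · congr 1
      ext w
      simp [hur w]
  refine ⟨l, ks, hk3, hks ▸ hcard, ?_⟩
  rcases hst with ⟨rfl, rfl⟩ | ⟨rfl, rfl⟩
  · refine .inl ⟨hzero, fun y => ?_, fun hnil => ?_⟩
    · rw [hsplit, ← permanent_thetaMat]
      rfl
    · have hemp : IsEmpty {w // w ∉ Set.range f} := by
        rw [hnil] at hks
        exact Fintype.card_eq_zero_iff.1 hks.symm
      refine ⟨Equiv.ofBijective f ⟨hf, fun w => by_contra fun hw => hemp.false ⟨w, hw⟩⟩, hiff⟩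
  · have h0 := hloop 0 rfl
    have h1 := hloop 1 rfl
    refine .inr ⟨h0, h1, fun y => ?_⟩
    rw [hsplit, ← permanent_dumbbellMat y (by omega) (by omega)]
    rfl

end SimpleGraph

/-! ### The degree sequence from the coefficients of the reversed polynomial. -/

namespace Matrix

open Polynomial

theorem map_permanent {n R S : Type*} [Fintype n] [DecidableEq n] [CommRing R] [CommRing S]
    (f : R →+* S) (M : Matrix n n R) : f M.permanent = (M.map f).permanent := by
  simp [permanent, map_sum, map_prod]

theorem permanent_one_updateRow {n R : Type*} [Fintype n] [DecidableEq n] [CommRing R] (k : n)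
    (v : n → R) : ((1 : Matrix n n R).updateRow k v).permanent = v k := by
  unfold permanent
  rw [Finset.sum_eq_single 1]
  · rw [← Finset.mul_prod_erase _ _ (Finset.mem_univ k), Finset.prod_eq_one]
    · simp
    · intro i hi
      simp [updateRow_ne (Finset.ne_of_mem_erase hi)]
  · intro σ _ hσ
    obtain ⟨i, hi⟩ : ∃ i, σ i ≠ i := by
      by_contra! h
      exact hσ (Equiv.ext h)
    by_cases hk : σ i = k
    · have h1 : σ k ≠ k := fun h => hi (by rw [hk]; exact σ.injective (h.trans hk.symm))
      exact Finset.prod_eq_zero (Finset.mem_univ k) (by simp [h1])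
    · exact Finset.prod_eq_zero (Finset.mem_univ i) (by simp [updateRow_ne hk, hi])
  · simp

/-- The reverse `per (I - X Q)` of the permanental polynomial of `Q`. -/
noncomputable def permPolyRev {n : Type*} [Fintype n] [DecidableEq n] (Q : Matrix n n ℤ) : ℤ[X] :=
  (1 - (X : ℤ[X]) • Q.map C).permanent

theorem permPolyRev_submatrix {n m : Type*} [Fintype n] [DecidableEq n] [Fintype m]
    [DecidableEq m] (e : m ≃ n) (Q : Matrix n n ℤ) :
    permPolyRev (Q.submatrix e e) = permPolyRev Q := by
  unfold permPolyRev
  rw [← permanent_submatrix_equiv_self e]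
  congr 1
  ext i j : 2
  simp [one_apply]

/-- The minors `G k` occur behind two factors `X`, so their constant terms are all that matters up
to degree two. -/
theorem permPolyRev_option {n : Type*} [Fintype n] [DecidableEq n]
    (Q : Matrix (Option n) (Option n) ℤ) : ∃ G : n → ℤ[X],
      (∀ k, (G k).coeff 0 = Q none (some k)) ∧
      permPolyRev Q = (1 - X * C (Q none none)) * permPolyRev (Q.submatrix some some) +
        X * (X * ∑ k, C (Q (some k) none) * G k) := by
  refine ⟨fun k => ((1 - (X : ℤ[X]) • (Q.submatrix some some).map C).updateRow k
    fun j => C (Q none (some j))).permanent, fun k => ?_, ?_⟩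
  · rw [coeff_zero_eq_eval_zero, ← coe_evalRingHom, map_permanent,
      ← permanent_one_updateRow k fun j => Q none (some j)]
    congr 1
    ext i j
    by_cases h : i = k
    · subst h
      simp
    · simp only [map_apply, updateRow_ne h, sub_apply, smul_apply, one_apply]
      split_ifs <;> simp
  · have h1 : (1 - (X : ℤ[X]) • Q.map C).submatrix some some =
        1 - (X : ℤ[X]) • (Q.submatrix some some).map C := by
      ext i j : 2
      simp [one_apply]
    have h2 : (fun j => (1 - (X : ℤ[X]) • Q.map C) none (some j)) =
        -(X : ℤ[X]) • fun j => C (Q none (some j)) := by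
      ext j : 1
      simp
    have h3 : ∀ k, (1 - (X : ℤ[X]) • Q.map C) (some k) none = -(X * C (Q (some k) none)) :=
      fun k => by simp
    have h4 : (1 - (X : ℤ[X]) • Q.map C) none none = 1 - X * C (Q none none) := by
      rw [sub_apply, smul_apply, map_apply, one_apply_eq, smul_eq_mul]
    rw [permPolyRev, permanent_option, h1, h2, h4, Finset.mul_sum, Finset.mul_sum]
    refine congrArg₂ _ rfl (Finset.sum_congr rfl fun k _ => ?_)
    rw [h3, permanent_updateRow_smul]
    ring

/-- Reversal puts the top three coefficients at the fixed places 0, 1, 2, so an induction removing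
one index at a time needs no bookkeeping of the degree. -/
theorem permPolyRev_coeff (n : Type*) [Finite n] : ∀ [Fintype n] [DecidableEq n] (Q : Matrix n n ℤ),
    (permPolyRev Q).coeff 0 = 1 ∧ (permPolyRev Q).coeff 1 = -∑ i, Q i i ∧
    2 * (permPolyRev Q).coeff 2 = (∑ i, Q i i) ^ 2 - ∑ i, Q i i ^ 2 +
      ∑ i, ∑ j, if i = j then 0 else Q i j * Q j i := by
  induction n using Finite.induction_empty_option with
  | @of_equiv α β e ih =>
    intro _ _ Q
    classical
    have := Fintype.ofEquiv β e.symm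
    have := ih (Q.submatrix e e)
    rw [permPolyRev_submatrix] at this
    simp only [submatrix_apply] at this
    rw [e.sum_comp fun i => Q i i, e.sum_comp fun i => Q i i ^ 2] at this
    refine ⟨this.1, this.2.1, this.2.2.trans ?_⟩
    congr 1
    refine Fintype.sum_equiv e _ _ fun i => Fintype.sum_equiv e _ _ fun j => ?_
    simp [e.injective.eq_iff]
  | h_empty =>
    intro _ _ Q
    simp [permPolyRev, permanent_isEmpty, coeff_one]
  | @h_option α _ ih =>
    intro hF hD Q
    classical
    obtain rfl : hD = (fun a b => a.instDecidableEq b) := Subsingleton.elim _ _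
    obtain rfl : hF = instFintypeOption := Subsingleton.elim _ _
    obtain ⟨G, hG, hQ⟩ := permPolyRev_option Q
    have hQ' : permPolyRev Q = permPolyRev (Q.submatrix some some) -
        X * (C (Q none none) * permPolyRev (Q.submatrix some some)) +
        X * (X * ∑ k, C (Q (some k) none) * G k) := by
      rw [hQ]
      ring
    obtain ⟨h0, h1, h2⟩ := ih (Q.submatrix some some)
    have e0 : (∑ k, C (Q (some k) none) * G k).coeff 0 = ∑ k, Q (some k) none * Q none (some k) := by
      simp [hG, mul_coeff_zero]
    simp only [submatrix_apply] at h1 h2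
    rw [hQ']
    refine ⟨?_, ?_, ?_⟩
    · simp [mul_coeff_zero, h0]
    · rw [coeff_add, coeff_sub, coeff_X_mul, coeff_X_mul, coeff_C_mul, h0, h1, mul_coeff_zero]
      simp
      ring
    · rw [coeff_add, coeff_sub, coeff_X_mul, coeff_X_mul, coeff_C_mul, h1, coeff_X_mul, e0, mul_add,
        mul_sub, h2]
      simp [Fintype.sum_option, Finset.sum_add_distrib, mul_comm (Q none (some _))]
      ring

end Matrix

namespace SimpleGraph

open Matrix Polynomial

variable {V W : Type*} [Fintype V] [DecidableEq V] [Fintype W] [DecidableEq W]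
  (G : SimpleGraph V) [DecidableRel G.Adj]

theorem signlessLapMatrix_self (v : V) : G.signlessLapMatrix v v = G.degree v := by
  simp [signlessLapMatrix, degMatrix]

theorem signlessLapMatrix_of_ne {v w : V} (h : v ≠ w) :
    G.signlessLapMatrix v w = if G.Adj v w then 1 else 0 := by
  simp [signlessLapMatrix, degMatrix, h]

theorem map_signlessLapPermPoly {R : Type*} [CommRing R] (f : ℤ[X] →+* R) :
    f G.signlessLapPermPoly = (relMat G.Adj fun v => f X - G.degree v).permanent := by
  rw [signlessLapPermPoly, map_permanent]
  congr 1
  ext v w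
  by_cases h : v = w
  · subst h
    simp [relMat, signlessLapMatrix_self]
  · by_cases hA : G.Adj v w <;> simp [relMat, h, hA, signlessLapMatrix_of_ne]

/-- The substitution $x = T^{-1}$, with a factor $T$ moved into each row. -/
theorem toLaurent_permPolyRev :
    toLaurent (permPolyRev G.signlessLapMatrix) = (LaurentPolynomial.T 1) ^ Fintype.card V *
      (relMat G.Adj fun v => (LaurentPolynomial.T (-1) : LaurentPolynomial ℤ) -
        G.degree v).permanent := by
  have hT : (LaurentPolynomial.T 1 : LaurentPolynomial ℤ) * LaurentPolynomial.T (-1) = 1 := by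
    rw [← LaurentPolynomial.T_add]
    simp
  rw [← permanent_smul, permPolyRev, map_permanent]
  congr 1
  ext1 v w
  by_cases h : v = w
  · subst h
    simp [relMat, signlessLapMatrix_self, mul_sub, hT]
  · by_cases hA : G.Adj v w <;> simp [relMat, h, hA, signlessLapMatrix_of_ne]

theorem permPolyRev_eq_of_signlessLapPermPoly_eq {H : SimpleGraph W} [DecidableRel H.Adj]
    (h : G.signlessLapPermPoly = H.signlessLapPermPoly) :
    Fintype.card V = Fintype.card W ∧
      permPolyRev G.signlessLapMatrix = permPolyRev H.signlessLapMatrix := by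
  let f : ℤ[X] →+* LaurentPolynomial ℤ := eval₂RingHom (Int.castRingHom _) (LaurentPolynomial.T (-1))
  have hf : f X = LaurentPolynomial.T (-1) := eval₂_X _ _
  have hper := congrArg f h
  rw [map_signlessLapPermPoly, map_signlessLapPermPoly, hf] at hper
  have h1 : permPolyRev G.signlessLapMatrix * X ^ Fintype.card W =
      permPolyRev H.signlessLapMatrix * X ^ Fintype.card V := by
    apply toLaurent_injective
    simp only [map_mul, map_pow, toLaurent_permPolyRev, toLaurent_X, hper]
    ring
  -- Both reversed polynomials have constant term 1, so the powers of `X` in `h1` must agree.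
  have h2 : Fintype.card V = Fintype.card W := by
    have e1 := congrArg (fun p => p.coeff (Fintype.card W)) h1
    have e2 := congrArg (fun p => p.coeff (Fintype.card V)) h1
    simp only [coeff_mul_X_pow', le_refl, if_true, Nat.sub_self,
      (permPolyRev_coeff _ _).1] at e1 e2
    split_ifs at e1 e2 <;> omega
  refine ⟨h2, ?_⟩
  rw [h2] at h1
  exact mul_right_cancel₀ (pow_ne_zero _ X_ne_zero) h1

theorem permPolyRev_signlessLapMatrix_coeff :
    (permPolyRev G.signlessLapMatrix).coeff 1 = -∑ v, (G.degree v : ℤ) ∧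
    2 * (permPolyRev G.signlessLapMatrix).coeff 2 =
      (∑ v, (G.degree v : ℤ)) ^ 2 - ∑ v, (G.degree v : ℤ) ^ 2 + ∑ v, (G.degree v : ℤ) := by
  obtain ⟨-, h1, h2⟩ := permPolyRev_coeff V G.signlessLapMatrix
  simp only [signlessLapMatrix_self] at h1 h2
  refine ⟨h1, h2.trans ?_⟩
  congr 1
  refine Finset.sum_congr rfl fun v _ => ?_
  rw [← card_neighborFinset_eq_degree, Finset.card_eq_sum_ones, Nat.cast_sum, neighborFinset_eq_filter,
    Finset.sum_filter]
  refine Finset.sum_congr rfl fun w _ => ?_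
  by_cases h : v = w
  · simp [h]
  · by_cases hA : G.Adj v w <;>
      simp [h, hA, signlessLapMatrix_of_ne, G.adj_comm w v, Ne.symm h]

/-- The numbers of vertices of degrees two and three are determined by the signless Laplacian
permanental polynomial if there are no other degrees. -/
theorem degrees_of_signlessLapPermPoly_eq {H : SimpleGraph W} [DecidableRel H.Adj]
    (h : G.signlessLapPermPoly = H.signlessLapPermPoly) {u v : W} (huv : u ≠ v)
    (hu : H.degree u = 3) (hv : H.degree v = 3) (h2 : ∀ w, w ≠ u → w ≠ v → H.degree w = 2) :
    ∃ u v : V, u ≠ v ∧ G.degree u = 3 ∧ G.degree v = 3 ∧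
      ∀ w, w ≠ u → w ≠ v → G.degree w = 2 := by
  obtain ⟨hcard, hF⟩ := permPolyRev_eq_of_signlessLapPermPoly_eq G h
  obtain ⟨g1, g2⟩ := permPolyRev_signlessLapMatrix_coeff G
  obtain ⟨k1, k2⟩ := permPolyRev_signlessLapMatrix_coeff H
  rw [hF] at g1 g2
  have hS : ∑ v, (G.degree v : ℤ) = ∑ v, (H.degree v : ℤ) := by linarith
  have hS2 : ∑ v, (G.degree v : ℤ) ^ 2 = ∑ v, (H.degree v : ℤ) ^ 2 := by
    rw [hS] at g2
    linarith
  have hcardZ : (Fintype.card V : ℤ) = Fintype.card W := by exact_mod_cast hcard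
  have e1 : ∑ v, ((G.degree v : ℤ) - 2) = ∑ v, ((H.degree v : ℤ) - 2) := by
    simp [hS, hcardZ]
  -- This product is non-negative for every integer degree and vanishes only at 2 and 3.
  have e2 : ∑ v, ((G.degree v : ℤ) - 2) * ((G.degree v : ℤ) - 3) =
      ∑ v, ((H.degree v : ℤ) - 2) * ((H.degree v : ℤ) - 3) := by
    have key : ∀ d : ℤ, (d - 2) * (d - 3) = d ^ 2 - 5 * d + 6 := fun d => by ring
    simp [key, Finset.sum_add_distrib, Finset.sum_sub_distrib, ← Finset.mul_sum, hS, hS2, hcardZ]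
  have hH : ∀ w, (H.degree w : ℤ) - 2 = if w = u ∨ w = v then 1 else 0 := fun w => by
    by_cases hw : w = u ∨ w = v
    · rcases hw with rfl | rfl <;> simp [hu, hv]
    · rw [if_neg hw]
      push Not at hw
      simp [h2 w hw.1 hw.2]
  have z1 : ∑ v, ((H.degree v : ℤ) - 2) = 2 := by
    simp only [hH, Finset.sum_boole]
    rw [show (Finset.univ.filter fun w => w = u ∨ w = v) = {u, v} by ext; simp]
    simp [Finset.card_pair huv]
  have z2 : ∑ v, ((H.degree v : ℤ) - 2) * ((H.degree v : ℤ) - 3) = 0 :=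
    Finset.sum_eq_zero fun w _ => by
      have := hH w
      split_ifs at this
      · rw [show (H.degree w : ℤ) = 3 by linarith]
        norm_num
      · rw [this, zero_mul]
  rw [z2] at e2
  have hnn : ∀ d : ℕ, 0 ≤ ((d : ℤ) - 2) * ((d : ℤ) - 3) := fun d => by
    rcases le_or_gt d 2 with h | h
    · exact mul_nonneg_of_nonpos_of_nonpos (by omega) (by omega)
    · exact mul_nonneg (by omega) (by omega)
  have hd : ∀ w, G.degree w = 2 ∨ G.degree w = 3 := fun w => by
    have := (Finset.sum_eq_zero_iff_of_nonneg fun w _ => hnn (G.degree w)).1 e2 w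
      (Finset.mem_univ w)
    rcases mul_eq_zero.1 this with h | h <;> omega
  have hd' : ∀ w, (G.degree w : ℤ) - 2 = if G.degree w = 3 then 1 else 0 := fun w => by
    rcases hd w with h | h <;> simp [h]
  rw [z1] at e1
  simp only [hd', Finset.sum_boole] at e1
  obtain ⟨a, b, hab, hs⟩ := Finset.card_eq_two.1 (by exact_mod_cast e1)
  have hmem : ∀ w, G.degree w = 3 ↔ w = a ∨ w = b := fun w => by
    simpa using congrArg (fun s => w ∈ s) hs
  exact ⟨a, b, hab, (hmem a).2 (.inl rfl), (hmem b).2 (.inr rfl), fun w hwa hwb =>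
    (hd w).resolve_right fun h => ((hmem w).1 h).elim hwa hwb⟩

end SimpleGraph

/-! ### Degrees, permanent and recognition of the given theta graph. -/

section ThetaGraph

open Matrix SimpleGraph

theorem thetaGraph_adj_iff (p q r : ℕ) (x y : ThetaVertex ![p, q, r]) :
    (thetaGraph p q r).Adj x y ↔
      threadAdj (fun _ => false) (fun _ => true) ![p, q, r] x y := by
  constructor
  · rintro ⟨i, k, h⟩
    exact ⟨i, k, Nat.lt_succ_iff.1 k.2, h⟩
  · rintro ⟨i, k, hk, h⟩
    exact ⟨i, ⟨k, Nat.lt_succ_iff.2 hk⟩, h⟩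

section

variable {l : Fin 3 → ℕ}

theorem threadVertex_inj_of_pos {i j : Fin 3} {k k' : ℕ} (hk : 0 < k) (hkl : k ≤ l i)
    (h : threadVertex (fun _ => false) (fun _ => true) l i k =
      threadVertex (fun _ => false) (fun _ => true) l j k') : i = j ∧ k = k' := by
  obtain ⟨k, rfl⟩ := Nat.exists_eq_succ_of_ne_zero hk.ne'
  rw [Nat.succ_eq_add_one, threadVertex_succ_of_lt _ _ _ hkl] at h
  unfold threadVertex at h
  split_ifs at h with h1 h2
  simp only [Sum.inr.injEq, Sigma.mk.injEq] at h
  obtain ⟨rfl, h⟩ := h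
  simp at h
  omega

theorem threadVertex_inner_ne (i : Fin 3) {k : ℕ} (hk : k + 1 ≤ l i) :
    threadVertex (fun _ => false) (fun _ => true) l i k ≠
      threadVertex (fun _ => false) (fun _ => true) l i (k + 2) := by
  unfold threadVertex
  split_ifs <;> simp <;> omega

theorem setOf_threadAdj_false : {y | threadAdj (fun _ => false) (fun _ => true) l (.inl false) y} =
    Set.range fun i => threadVertex (fun _ => false) (fun _ => true) l i 1 := by
  ext y
  constructor
  · rintro ⟨i, k, hk, ⟨h, rfl⟩ | ⟨rfl, h⟩⟩
    · rcases k with _ | k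
      · exact ⟨i, rfl⟩
      · rw [threadVertex_succ_of_lt _ _ _ hk] at h
        simp at h
    · rcases hk.eq_or_lt with rfl | hk
      · rw [threadVertex_last] at h
        simp at h
      · rw [threadVertex_succ_of_lt _ _ _ hk] at h
        simp at h
  · rintro ⟨i, rfl⟩
    exact ⟨i, 0, Nat.zero_le _, .inl ⟨rfl, rfl⟩⟩

theorem setOf_threadAdj_true : {y | threadAdj (fun _ => false) (fun _ => true) l (.inl true) y} =
    Set.range fun i => threadVertex (fun _ => false) (fun _ => true) l i (l i) := by
  ext y
  constructor
  · rintro ⟨i, k, hk, ⟨h, rfl⟩ | ⟨rfl, h⟩⟩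
    · unfold threadVertex at h
      split_ifs at h
      · simp at h
      · omega
    · rcases hk.eq_or_lt with rfl | hk
      · exact ⟨i, rfl⟩
      · rw [threadVertex_succ_of_lt _ _ _ hk] at h
        simp at h
  · rintro ⟨i, rfl⟩
    exact ⟨i, l i, le_rfl, .inr ⟨rfl, (threadVertex_last (fun _ => false) (fun _ => true) l i).symm⟩⟩

theorem setOf_threadAdj_inr (i : Fin 3) (k : Fin (l i)) :
    {y | threadAdj (fun _ => false) (fun _ => true) l (.inr ⟨i, k⟩) y} =
    {threadVertex (fun _ => false) (fun _ => true) l i k,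
      threadVertex (fun _ => false) (fun _ => true) l i (k + 2)} := by
  have hk := threadVertex_succ_of_lt (fun _ : Fin 3 => false) (fun _ => true) l k.2
  ext y
  constructor
  · rintro ⟨j, m, hm, ⟨h, rfl⟩ | ⟨rfl, h⟩⟩
    · obtain ⟨rfl, rfl⟩ := threadVertex_inj_of_pos k.1.succ_pos k.2 (hk.trans h)
      exact .inr rfl
    · obtain ⟨rfl, h⟩ := threadVertex_inj_of_pos k.1.succ_pos k.2 (hk.trans h)
      obtain rfl : k.1 = m := by omega
      exact .inl rfl
  · rintro (rfl | rfl)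
    · exact ⟨i, k, k.2.le, .inr ⟨rfl, hk.symm⟩⟩
    · exact ⟨i, k + 1, k.2, .inl ⟨hk.symm, rfl⟩⟩

end

theorem SimpleGraph.degree_eq_ncard {V : Type*} [Fintype V] (G : SimpleGraph V)
    [DecidableRel G.Adj] (v : V) : G.degree v = (G.neighborSet v).ncard := by
  rw [← card_neighborSet_eq_degree, Set.ncard_eq_toFinset_card', Set.toFinset_card]

variable {p q r : ℕ}

/-- Since at most one path is a single edge, the three neighbours of each end are distinct. -/
theorem degree_thetaGraph (h : ∀ i j, ![p, q, r] i = 0 → ![p, q, r] j = 0 → i = j) :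
    (thetaGraph p q r).degree (.inl false) = 3 ∧ (thetaGraph p q r).degree (.inl true) = 3 ∧
      ∀ w, w ≠ .inl false → w ≠ .inl true → (thetaGraph p q r).degree w = 2 := by
  have hset : ∀ x, (thetaGraph p q r).neighborSet x =
      {y | threadAdj (fun _ => false) (fun _ => true) ![p, q, r] x y} := fun x => by
    ext y
    exact thetaGraph_adj_iff p q r x y
  simp only [degree_eq_ncard, hset]
  refine ⟨?_, ?_, ?_⟩
  · rw [setOf_threadAdj_false, ← Set.image_univ, Set.ncard_image_of_injective, Set.ncard_univ,
      Nat.card_eq_fintype_card, Fintype.card_fin]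
    intro i j hij
    by_contra hne
    by_cases hi : ![p, q, r] i = 0
    · have hj : 0 < ![p, q, r] j := Nat.pos_of_ne_zero fun hj => hne (h i j hi hj)
      exact hne (threadVertex_inj_of_pos one_pos hj hij.symm).1.symm
    · exact hne (threadVertex_inj_of_pos one_pos (Nat.pos_of_ne_zero hi) hij).1
  · rw [setOf_threadAdj_true, ← Set.image_univ, Set.ncard_image_of_injective, Set.ncard_univ,
      Nat.card_eq_fintype_card, Fintype.card_fin]
    intro i j hij
    by_contra hne
    by_cases hi : ![p, q, r] i = 0
    · have hj : 0 < ![p, q, r] j := Nat.pos_of_ne_zero fun hj => hne (h i j hi hj)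
      exact hne (threadVertex_inj_of_pos hj le_rfl hij.symm).1.symm
    · exact hne (threadVertex_inj_of_pos (Nat.pos_of_ne_zero hi) le_rfl hij).1
  · rintro ((_ | _) | ⟨i, k⟩) h1 h2
    · exact absurd rfl h1
    · exact absurd rfl h2
    · rw [setOf_threadAdj_inr, Set.ncard_pair (threadVertex_inner_ne i k.2)]

theorem permanent_thetaGraph (h : ∀ i j, ![p, q, r] i = 0 → ![p, q, r] j = 0 → i = j)
    {R : Type*} [CommRing R] (x : R) :
    (relMat (thetaGraph p q r).Adj fun v => x - (thetaGraph p q r).degree v).permanent =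
      thetaPerm (x - 2) p q r := by
  obtain ⟨h1, h2, h3⟩ := degree_thetaGraph h
  have hd : (fun v => x - (thetaGraph p q r).degree v) =
      Sum.elim (fun _ => x - 2 - 1) fun _ => x - 2 := by
    ext v
    rcases v with (_ | _) | v
    · rw [h1]
      push_cast
      simp
      ring
    · rw [h2]
      push_cast
      simp
      ring
    · rw [h3 _ (by simp) (by simp)]
      simp
  rw [← permanent_thetaMat, hd]
  have hr : (thetaGraph p q r).Adj = threadAdj (fun _ => false) (fun _ => true) ![p, q, r] := by
    ext x y
    exact thetaGraph_adj_iff p q r x y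
  rw [hr, ← permanent_submatrix_equiv_self (threeThreadEquiv Bool ![p, q, r]),
    relMat_threadAdj_three _ _ _ h (by simp)]
  rfl

theorem thetaGraph_hyp (hpq : ¬(p = 0 ∧ q = 0)) (hpr : ¬(p = 0 ∧ r = 0)) (hqr : ¬(q = 0 ∧ r = 0)) :
    ∀ i j, ![p, q, r] i = 0 → ![p, q, r] j = 0 → i = j := by
  intro i j
  fin_cases i <;> fin_cases j <;> simp <;> tauto

/-- Graphs with three threads of the same lengths are isomorphic. -/
theorem nonempty_iso_thetaGraph {W : Type*} {H : SimpleGraph W} {l : Fin 3 → ℕ}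
    (e : (Bool ⊕ Σ i, Fin (l i)) ≃ W)
    (he : ∀ x y, H.Adj (e x) (e y) ↔ threadAdj (fun _ => false) (fun _ => true) l x y)
    (σ : Equiv.Perm (Fin 3)) (hσ : ∀ i, l (σ i) = ![p, q, r] i) :
    Nonempty (H ≃g thetaGraph p q r) := by
  let g : ThetaVertex ![p, q, r] ≃ (Bool ⊕ Σ i, Fin (l i)) :=
    Equiv.sumCongr (Equiv.refl _) ((Equiv.sigmaCongrRight fun i => finCongr (hσ i).symm).trans
      (Equiv.sigmaCongrLeft (β := fun i => Fin (l i)) σ))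
  have hg : ∀ i k, g (threadVertex (fun _ => false) (fun _ => true) ![p, q, r] i k) =
      threadVertex (fun _ => false) (fun _ => true) l (σ i) k := fun i k => by
    unfold threadVertex
    by_cases hk : k = 0
    · simp [hk, g]
    · by_cases hk' : k - 1 < l (σ i)
      · simp [hk, hk', ← hσ, g]
      · simp [hk, hk', ← hσ, g]
  have hadj : ∀ x y, (thetaGraph p q r).Adj x y ↔ H.Adj (e (g x)) (e (g y)) := fun x y => by
    rw [thetaGraph_adj_iff, he]
    constructor
    · rintro ⟨i, k, hk, h⟩
      refine ⟨σ i, k, hσ i ▸ hk, ?_⟩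
      rw [← hg, ← hg, g.apply_eq_iff_eq, g.apply_eq_iff_eq, g.apply_eq_iff_eq, g.apply_eq_iff_eq]
      exact h
    · rintro ⟨i, k, hk, h⟩
      obtain ⟨i, rfl⟩ := σ.surjective i
      refine ⟨i, k, hσ i ▸ hk, ?_⟩
      rw [← hg, ← hg, g.apply_eq_iff_eq, g.apply_eq_iff_eq, g.apply_eq_iff_eq,
        g.apply_eq_iff_eq] at h
      exact h
  exact ⟨(⟨g.trans e, fun {x y} => (hadj x y).symm⟩ : thetaGraph p q r ≃g H).symm⟩

end ThetaGraph

/-! ### The substitution `y = z - z⁻¹`. -/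

section Core

variable {R : Type*} [CommRing R]

/-- For a theta graph with paths of lengths `a`, `b`, `c` and `n` vertices, this is
`(1 + z ^ 2) ^ 3 * (-z) ^ n * per ((x - 2) I + D - A)` at `x - 2 = z - z⁻¹`. -/
def thetaPoly (z : R) (a b c : ℕ) : R :=
  (1 + z + 2 * z ^ 2) ^ 2
  - (-1) ^ a * (-1) ^ b * (-1) ^ c * (2 - z + z ^ 2) ^ 2 * (z ^ a * z ^ b * z ^ c) ^ 2
  - (1 + z) ^ 2 * z ^ 2 * ((-1) ^ a * (z ^ a) ^ 2 + (-1) ^ b * (z ^ b) ^ 2 + (-1) ^ c * (z ^ c) ^ 2)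
  + (1 - z) ^ 2 * ((-1) ^ b * (-1) ^ c * (z ^ b * z ^ c) ^ 2 + (-1) ^ a * (-1) ^ c *
    (z ^ a * z ^ c) ^ 2 + (-1) ^ a * (-1) ^ b * (z ^ a * z ^ b) ^ 2)
  + 2 * (1 + z ^ 2) ^ 2 * (z ^ b * z ^ c * (1 - (-1) ^ a * (z ^ a) ^ 2)
    + z ^ a * z ^ c * (1 - (-1) ^ b * (z ^ b) ^ 2) + z ^ a * z ^ b * (1 - (-1) ^ c * (z ^ c) ^ 2))

/-- For two cycles of lengths `a` and `b` joined by a path of length `c`, this is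
`(1 + z ^ 2) ^ 3 * (-z) ^ n * per ((x - 2) I + D - A)` at `x - 2 = z - z⁻¹`. -/
def dumbbellPoly (z : R) (a b c : ℕ) : R :=
  (1 + z + 2 * z ^ 2 + (-1) ^ a * (z ^ a) ^ 2 * (1 - z) + 2 * (1 + z ^ 2) * z ^ a) *
    (1 + z + 2 * z ^ 2 + (-1) ^ b * (z ^ b) ^ 2 * (1 - z) + 2 * (1 + z ^ 2) * z ^ b)
  - (-1) ^ c * (z ^ c) ^ 2 *
  ((z + z ^ 2 + (-1) ^ a * (z ^ a) ^ 2 * (2 - z + z ^ 2) + 2 * (1 + z ^ 2) * z ^ a) *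
    (z + z ^ 2 + (-1) ^ b * (z ^ b) ^ 2 * (2 - z + z ^ 2) + 2 * (1 + z ^ 2) * z ^ b))

/-- For a cycle with `k` vertices, this is `(-z) ^ k * per ((x - 2) I + D - A)` at
`x - 2 = z - z⁻¹`. -/
def cyclePoly (z : R) (k : ℕ) : R :=
  1 + 2 * z ^ k + (-1) ^ k * z ^ (2 * k)

theorem map_thetaPoly {S : Type*} [CommRing S] (f : R →+* S) (z : R) (a b c : ℕ) :
    f (thetaPoly z a b c) = thetaPoly (f z) a b c := by
  simp [thetaPoly, map_ofNat f 2]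

theorem map_dumbbellPoly {S : Type*} [CommRing S] (f : R →+* S) (z : R) (a b c : ℕ) :
    f (dumbbellPoly z a b c) = dumbbellPoly (f z) a b c := by
  simp [dumbbellPoly, map_ofNat f 2]

theorem map_cyclePoly {S : Type*} [CommRing S] (f : R →+* S) (z : R) (k : ℕ) :
    f (cyclePoly z k) = cyclePoly (f z) k := by
  simp [cyclePoly, map_ofNat f 2]

theorem map_prod_cyclePoly {S : Type*} [CommRing S] (f : R →+* S) (z : R) (ks : List ℕ) :
    f (ks.map (cyclePoly z)).prod = (ks.map (cyclePoly (f z))).prod := by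
  rw [map_list_prod, List.map_map]
  exact congrArg List.prod (List.map_congr_left fun k _ => map_cyclePoly f z k)

end Core

section Field

variable {K : Type*} [Field K] {z : K}

/-- The recurrence has characteristic equation $\lambda^2 = y\lambda + 1$, whose roots are $z$ and
$-z^{-1}$. -/
theorem contPoly_sub_inv (hz : z ≠ 0) (hw : 1 + z ^ 2 ≠ 0) (a : ℕ) :
    contPoly (z - z⁻¹) a = -z * (1 - (-1) ^ a * (z ^ a) ^ 2) / ((1 + z ^ 2) * (-z) ^ a) := by
  induction a using Nat.twoStepInduction with
  | zero => simp [contPoly]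
  | one =>
    simp only [contPoly]
    field_simp
    ring
  | more a h1 h2 =>
    have hv : (-z) ^ a ≠ 0 := pow_ne_zero _ (neg_ne_zero.2 hz)
    rw [contPoly, h1, h2]
    simp only [pow_succ (-z)]
    field_simp
    ring

/-- The previous value, rewritten over $(-z)^{a+1}$. All factors of one path then share this
denominator, and the powers can be generalized to free variables. -/
theorem contPoly_succ_sub_inv (hz : z ≠ 0) (hw : 1 + z ^ 2 ≠ 0) (a : ℕ) :
    contPoly (z - z⁻¹) a =
      (z ^ 2 + (-1) ^ (a + 1) * (z ^ (a + 1)) ^ 2) / ((1 + z ^ 2) * (-z) ^ (a + 1)) := by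
  have hv : (-z) ^ a ≠ 0 := pow_ne_zero _ (neg_ne_zero.2 hz)
  rw [contPoly_sub_inv hz hw]
  simp only [pow_succ (-z)]
  field_simp
  ring

theorem neg_one_pow_eq_div (hz : z ≠ 0) (a : ℕ) : (-1) ^ a = -z ^ (a + 1) / (-z) ^ (a + 1) := by
  have hz' : z ^ (a + 1) ≠ 0 := pow_ne_zero _ hz
  rw [neg_pow z (a + 1), ← neg_div_neg_eq, neg_neg, ← neg_mul, div_mul_cancel_right₀ hz', pow_succ]
  simp [← inv_pow, inv_neg]

open Matrix

theorem thetaPerm_sub_inv (hz : z ≠ 0) (hw : 1 + z ^ 2 ≠ 0) (a b c : ℕ) :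
    (1 + z ^ 2) ^ 3 * (-z) ^ (a + b + c + 2) * thetaPerm (z - z⁻¹) a b c =
      thetaPoly z (a + 1) (b + 1) (c + 1) := by
  have hz' := neg_ne_zero.2 hz
  have e : (-z) ^ (a + b + c + 2) = (-z) ^ (a + 1) * (-z) ^ (b + 1) * (-z) ^ (c + 1) / -z := by
    field_simp
    ring
  rw [thetaPerm, e, thetaPoly]
  simp only [contPoly_succ_sub_inv hz hw a, contPoly_succ_sub_inv hz hw b,
    contPoly_succ_sub_inv hz hw c, contPoly_sub_inv hz hw (_ + 1), neg_one_pow_eq_div hz a,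
    neg_one_pow_eq_div hz b, neg_one_pow_eq_div hz c]
  have ha := pow_ne_zero (a + 1) hz'
  have hb := pow_ne_zero (b + 1) hz'
  have hc := pow_ne_zero (c + 1) hz'
  generalize (-z) ^ (a + 1) = va at *
  generalize (-z) ^ (b + 1) = vb at *
  generalize (-z) ^ (c + 1) = vc at *
  generalize z ^ (a + 1) = ua at *
  generalize z ^ (b + 1) = ub at *
  generalize z ^ (c + 1) = uc at *
  generalize -z ^ (a + 1) / va = ea at *
  field_simp
  ring

theorem loopPerm_sub_inv (hz : z ≠ 0) (hw : 1 + z ^ 2 ≠ 0) (a : ℕ) :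
    loopPerm (z - z⁻¹) a = (1 + z + z ^ 2 + (-1) ^ (a + 1) * (z ^ (a + 1)) ^ 2 * (1 - z + z ^ 2) +
      2 * (1 + z ^ 2) * z ^ (a + 1)) / ((1 + z ^ 2) * (-z) ^ (a + 1)) := by
  have h : loopPerm (z - z⁻¹) a = (z - z⁻¹ - 1) * contPoly (z - z⁻¹) (a + 1) +
      2 * contPoly (z - z⁻¹) a + 2 * (z ^ (a + 1) / (-z) ^ (a + 1)) := by
    rw [loopPerm, pow_succ (-1) a, neg_one_pow_eq_div hz a]
    ring
  rw [h, contPoly_succ_sub_inv hz hw a, contPoly_sub_inv hz hw (a + 1)]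
  have ha := pow_ne_zero (a + 1) (neg_ne_zero.2 hz)
  generalize (-z) ^ (a + 1) = va at *
  generalize z ^ (a + 1) = ua at *
  field_simp
  ring

theorem dumbbellPerm_sub_inv (hz : z ≠ 0) (hw : 1 + z ^ 2 ≠ 0) (a b c : ℕ) :
    (1 + z ^ 2) ^ 3 * (-z) ^ (a + b + c + 2) * dumbbellPerm (z - z⁻¹) a b c =
      dumbbellPoly z (a + 1) (b + 1) (c + 1) := by
  have hz' := neg_ne_zero.2 hz
  have e : (-z) ^ (a + b + c + 2) = (-z) ^ (a + 1) * (-z) ^ (b + 1) * (-z) ^ (c + 1) / -z := by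
    field_simp
    ring
  rw [dumbbellPerm, loopPerm_sub_inv hz hw, loopPerm_sub_inv hz hw, e, dumbbellPoly]
  simp only [contPoly_succ_sub_inv hz hw c, contPoly_sub_inv hz hw (_ + 1)]
  have ha := pow_ne_zero (a + 1) hz'
  have hb := pow_ne_zero (b + 1) hz'
  have hc := pow_ne_zero (c + 1) hz'
  generalize (-z) ^ (a + 1) = va at *
  generalize (-z) ^ (b + 1) = vb at *
  generalize (-z) ^ (c + 1) = vc at *
  generalize z ^ (a + 1) = ua at *
  generalize z ^ (b + 1) = ub at *
  generalize z ^ (c + 1) = uc at *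
  field_simp
  ring

theorem cyclePerm_sub_inv (hz : z ≠ 0) (hw : 1 + z ^ 2 ≠ 0) (a : ℕ) :
    (-z) ^ (a + 1) * cyclePerm (z - z⁻¹) a = cyclePoly z (a + 1) := by
  rw [cyclePerm, cyclePoly, contPoly_succ_sub_inv hz hw a, contPoly_sub_inv hz hw (a + 1),
    pow_succ (-1) a, neg_one_pow_eq_div hz a, pow_mul' z 2]
  have ha := pow_ne_zero (a + 1) (neg_ne_zero.2 hz)
  generalize (-z) ^ (a + 1) = va at *
  generalize z ^ (a + 1) = ua at *
  field_simp
  ring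

theorem prod_cyclePerm_sub_inv (hz : z ≠ 0) (hw : 1 + z ^ 2 ≠ 0) {ks : List ℕ}
    (hk : ∀ k ∈ ks, 3 ≤ k) : (-z) ^ ks.sum * (ks.map fun k => cyclePerm (z - z⁻¹) (k - 1)).prod =
      (ks.map (cyclePoly z)).prod := by
  induction ks with
  | nil => simp
  | cons k ks ih =>
    have h3 := hk k (by simp)
    have h := cyclePerm_sub_inv hz hw (k - 1)
    rw [Nat.sub_add_cancel (by omega)] at h
    rw [List.sum_cons, List.map_cons, List.prod_cons, List.map_cons, List.prod_cons, ← h,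
      ← ih fun k hk' => hk k (by simp [hk'])]
    ring

end Field

section Polynomial

open Polynomial Matrix

variable {p q r a b c : ℕ} {ks : List ℕ}

theorem algebraMap_X_ne_zero : algebraMap ℤ[X] (FractionRing ℤ[X]) X ≠ 0 := by
  rw [ne_eq, FaithfulSMul.algebraMap_eq_zero_iff]
  exact X_ne_zero

theorem one_add_algebraMap_X_sq_ne_zero :
    1 + algebraMap ℤ[X] (FractionRing ℤ[X]) X ^ 2 ≠ 0 := by
  rw [← map_one (algebraMap ℤ[X] (FractionRing ℤ[X])), ← map_pow, ← map_add, ne_eq,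
    FaithfulSMul.algebraMap_eq_zero_iff]
  exact fun h => by simpa using congrArg (eval 1) h

/-- The identity holds over every ring, so it may be used at $z - z^{-1}$ for $z = X$ in the
fraction field of $\mathbb{Z}[X]$. Equal numbers of vertices make the powers of $-z$ match. -/
theorem thetaPoly_eq_thetaPoly_mul (hk : ∀ k ∈ ks, 3 ≤ k) (hn : p + q + r = a + b + c + ks.sum)
    (h : ∀ {R : Type} [CommRing R] (y : R), thetaPerm y p q r =
      thetaPerm y a b c * (ks.map fun k => cyclePerm y (k - 1)).prod) :
    thetaPoly (X : ℤ[X]) (p + 1) (q + 1) (r + 1) =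
      thetaPoly X (a + 1) (b + 1) (c + 1) * (ks.map (cyclePoly X)).prod := by
  apply FaithfulSMul.algebraMap_injective ℤ[X] (FractionRing ℤ[X])
  have hz := algebraMap_X_ne_zero
  have hw := one_add_algebraMap_X_sq_ne_zero
  rw [map_mul, map_prod_cyclePoly, map_thetaPoly, map_thetaPoly, ← thetaPerm_sub_inv hz hw,
    ← thetaPerm_sub_inv hz hw, ← prod_cyclePerm_sub_inv hz hw hk, h, hn]
  ring

theorem thetaPoly_eq_dumbbellPoly_mul (hk : ∀ k ∈ ks, 3 ≤ k)
    (hn : p + q + r = a + b + c + ks.sum)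
    (h : ∀ {R : Type} [CommRing R] (y : R), thetaPerm y p q r =
      dumbbellPerm y a b c * (ks.map fun k => cyclePerm y (k - 1)).prod) :
    thetaPoly (X : ℤ[X]) (p + 1) (q + 1) (r + 1) =
      dumbbellPoly X (a + 1) (b + 1) (c + 1) * (ks.map (cyclePoly X)).prod := by
  apply FaithfulSMul.algebraMap_injective ℤ[X] (FractionRing ℤ[X])
  have hz := algebraMap_X_ne_zero
  have hw := one_add_algebraMap_X_sq_ne_zero
  rw [map_mul, map_prod_cyclePoly, map_thetaPoly, map_dumbbellPoly, ← thetaPerm_sub_inv hz hw,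
    ← dumbbellPerm_sub_inv hz hw, ← prod_cyclePerm_sub_inv hz hw hk, h, hn]
  ring

end Polynomial

open Polynomial

/-! ### Low coefficients of products of cycle polynomials. -/

section CycleProd

variable {ks : List ℕ} {κ : ℕ}

theorem X_pow_dvd_sum_X_pow (h : ∀ k ∈ ks, κ ≤ k) : (X : ℤ[X]) ^ κ ∣ (ks.map fun k => X ^ k).sum :=
  List.dvd_sum fun _ hp => by
    obtain ⟨k, hk, rfl⟩ := List.mem_map.1 hp
    exact pow_dvd_pow X (h k hk)

/-- Every product of two cycle terms, and every $X^{2k}$, has degree at least $2\kappa$; below that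
only the linear terms are seen. -/
theorem X_pow_dvd_prod_cyclePoly_sub (h : ∀ k ∈ ks, κ ≤ k) :
    (X : ℤ[X]) ^ (2 * κ) ∣
      (ks.map (cyclePoly X)).prod - (1 + 2 * (ks.map fun k => X ^ k).sum) := by
  induction ks with
  | nil => simp
  | cons k ks ih =>
    have h' : ∀ k ∈ ks, κ ≤ k := fun k hk => h k (by simp [hk])
    have hk : κ ≤ k := h k (by simp)
    have h1 : (X : ℤ[X]) ^ (2 * κ) ∣ X ^ (2 * k) := pow_dvd_pow X (by omega)
    have h2 : (X : ℤ[X]) ^ (2 * κ) ∣ X ^ k * (ks.map fun k => X ^ k).sum := by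
      rw [two_mul, pow_add]
      exact mul_dvd_mul (pow_dvd_pow X hk) (X_pow_dvd_sum_X_pow h')
    obtain ⟨u, hu⟩ := ih h'
    obtain ⟨v, hv⟩ := h1
    obtain ⟨w, hw⟩ := h2
    refine ⟨(1 + 2 * X ^ k) * u + (-1) ^ k * v * (ks.map (cyclePoly X)).prod + 4 * w, ?_⟩
    rw [List.map_cons, List.prod_cons, List.map_cons, List.sum_cons, cyclePoly]
    linear_combination (1 + 2 * X ^ k) * hu + (-1) ^ k * (ks.map (cyclePoly X)).prod * hv + 4 * hw

theorem coeff_mul_sum_X_pow (P : ℤ[X]) (e : ℕ) :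
    (P * (ks.map fun k => X ^ k).sum).coeff e =
      (ks.map fun k => if k ≤ e then P.coeff (e - k) else 0).sum := by
  induction ks with
  | nil => simp
  | cons k ks ih => simp [mul_add, coeff_mul_X_pow', ih]

theorem coeff_mul_prod_cyclePoly {P : ℤ[X]} {j : ℕ} (h : ∀ k ∈ ks, κ ≤ k) (hj : j < κ) :
    (P * (ks.map (cyclePoly X)).prod).coeff (κ + j) = P.coeff (κ + j) +
      2 * (ks.map fun k => if k ≤ κ + j then P.coeff (κ + j - k) else 0).sum := by
  obtain ⟨u, hu⟩ := X_pow_dvd_prod_cyclePoly_sub h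
  have e : P * (ks.map (cyclePoly X)).prod =
      P + 2 * (P * (ks.map fun k => X ^ k).sum) + X ^ (2 * κ) * (P * u) := by
    linear_combination P * hu
  have h2 : (2 : ℤ[X]) = C 2 := rfl
  rw [e, coeff_add, coeff_add, h2, coeff_C_mul, coeff_mul_sum_X_pow, coeff_X_pow_mul',
    if_neg (by omega), add_zero]

theorem coeff_shift_nonneg {P : ℤ[X]} {j : ℕ} (h : ∀ k ∈ ks, κ ≤ k)
    (hP : ∀ i ≤ j, 0 ≤ P.coeff i) :
    ∀ x ∈ ks.map fun k => if k ≤ κ + j then P.coeff (κ + j - k) else 0, 0 ≤ x := by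
  intro x hx
  obtain ⟨k, hk, rfl⟩ := List.mem_map.1 hx
  split_ifs
  · exact hP _ (by have := h k hk; omega)
  · exact le_rfl

theorem coeff_le_coeff_mul_prod_cyclePoly {P : ℤ[X]} {j : ℕ} (h : ∀ k ∈ ks, κ ≤ k) (hj : j < κ)
    (hP : ∀ i ≤ j, 0 ≤ P.coeff i) :
    P.coeff (κ + j) ≤ (P * (ks.map (cyclePoly X)).prod).coeff (κ + j) := by
  rw [coeff_mul_prod_cyclePoly h hj]
  linarith [List.sum_nonneg (coeff_shift_nonneg h hP)]

theorem coeff_add_le_coeff_mul_prod_cyclePoly {P : ℤ[X]} {j : ℕ} (hκ : κ ∈ ks)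
    (h : ∀ k ∈ ks, κ ≤ k) (hj : j < κ) (hP : ∀ i ≤ j, 0 ≤ P.coeff i) :
    P.coeff (κ + j) + 2 * P.coeff j ≤ (P * (ks.map (cyclePoly X)).prod).coeff (κ + j) := by
  rw [coeff_mul_prod_cyclePoly h hj]
  linarith [List.single_le_sum (coeff_shift_nonneg h hP) (P.coeff j)
    (List.mem_map.2 ⟨κ, hκ, by simp⟩)]

end CycleProd

/-- The universal test ring is $\mathbb{Z}[X]/(X^M)$. In this form, truncation becomes rewriting of
monomials to zero in a ring where $X^M$ vanishes. -/
theorem coeff_eq_coeff_of_map_eq {P Q : ℤ[X]} {M e : ℕ}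
    (h : ∀ {S : Type} [CommRing S] (f : ℤ[X] →+* S), f X ^ M = 0 → f P = f Q) (he : e < M) :
    P.coeff e = Q.coeff e := by
  have h1 := h (Ideal.Quotient.mk (Ideal.span {(X : ℤ[X]) ^ M})) (by
    rw [← map_pow, Ideal.Quotient.eq_zero_iff_mem, Ideal.mem_span_singleton])
  rw [Ideal.Quotient.eq, Ideal.mem_span_singleton, X_pow_dvd_iff] at h1
  simpa [sub_eq_zero] using h1 e he

theorem coeff_comp_neg_X (P : ℤ[X]) (e : ℕ) : (P.comp (-X)).coeff e = (-1) ^ e * P.coeff e := by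
  have h : (-X : ℤ[X]) = C (-1) * X := by simp
  rw [h, comp_C_mul_X_coeff, mul_comm]

/-! ### Odd coefficients when all lengths are even. -/

section OddCoeff

variable {a b c e : ℕ}

/-- The odd coefficients of `thetaPoly X a b c` for even `a`, `b`, `c`. -/
theorem coeff_thetaPoly_of_odd (ha : Even a) (hb : Even b) (hc : Even c) (he : Odd e) :
    (thetaPoly (X : ℤ[X]) a b c).coeff e =
      (if e = 1 then 2 else 0) + (if e = 3 then 4 else 0)
      + (if e = 2 * (a + b + c) + 1 then 4 else 0) + (if e = 2 * (a + b + c) + 3 then 2 else 0)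
      - 2 * ((if e = 2 * a + 3 then 1 else 0) + (if e = 2 * b + 3 then 1 else 0)
        + (if e = 2 * c + 3 then 1 else 0) + (if e = 2 * (b + c) + 1 then 1 else 0)
        + (if e = 2 * (a + c) + 1 then 1 else 0) + (if e = 2 * (a + b) + 1 then 1 else 0)) := by
  have h1 : (thetaPoly (X : ℤ[X]) a b c).comp (-X) = thetaPoly (-X) a b c := by
    simpa using map_thetaPoly (compRingHom (-X : ℤ[X])) X a b c
  -- The difference $P(X) - P(-X)$ is twice the odd part of $P$; for even lengths most terms cancel
  -- in it.
  have h2 : thetaPoly (X : ℤ[X]) a b c - thetaPoly (-X) a b c =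
      C 2 * (C 2 * X ^ 1 + C 4 * X ^ 3 + C 4 * X ^ (2 * (a + b + c) + 1) +
        C 2 * X ^ (2 * (a + b + c) + 3) - C 2 * (X ^ (2 * a + 3) + X ^ (2 * b + 3) + X ^ (2 * c + 3)
          + X ^ (2 * (b + c) + 1) + X ^ (2 * (a + c) + 1) + X ^ (2 * (a + b) + 1))) := by
    simp only [thetaPoly, ha.neg_one_pow, hb.neg_one_pow, hc.neg_one_pow, ha.neg_pow, hb.neg_pow,
      hc.neg_pow, map_ofNat]
    ring
  have h3 := congrArg (fun p => p.coeff e) h2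
  simp only [← h1, coeff_sub, coeff_comp_neg_X, he.neg_one_pow, coeff_C_mul, coeff_add,
    coeff_X_pow] at h3
  simp only [mul_ite, mul_one, mul_zero] at h3 ⊢
  linarith

theorem coeff_one_add_X_add_sq (P : ℤ[X]) (hP : P = (1 + X + 2 * X ^ 2) ^ 2) :
    P.coeff 0 = 1 ∧ P.coeff 1 = 2 ∧ P.coeff 2 = 5 ∧ P.coeff 3 = 4 := by
  have h : P = C 1 * X ^ 0 + C 2 * X ^ 1 + C 5 * X ^ 2 + C 4 * X ^ 3 + C 4 * X ^ 4 := by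
    rw [hP]
    simp only [map_ofNat, map_one]
    ring
  simp [h, coeff_X, coeff_one, coeff_X_pow, -eq_intCast]

theorem coeff_thetaPoly_of_lt_four (ha : 2 ≤ a) (hb : 2 ≤ b) (hc : 2 ≤ c) (he : e < 4) :
    (thetaPoly (X : ℤ[X]) a b c).coeff e = ((1 + X + 2 * X ^ 2) ^ 2 : ℤ[X]).coeff e := by
  refine coeff_eq_coeff_of_map_eq (fun f hz => ?_) he
  rw [map_thetaPoly]
  simp only [map_pow, map_add, map_mul, map_one, map_ofNat]
  generalize f X = z at *
  have h1 : z ^ a * z ^ b = 0 := by rw [← pow_add]; exact pow_eq_zero_of_le (by omega) hz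
  have h2 : z ^ a * z ^ c = 0 := by rw [← pow_add]; exact pow_eq_zero_of_le (by omega) hz
  have h3 : z ^ b * z ^ c = 0 := by rw [← pow_add]; exact pow_eq_zero_of_le (by omega) hz
  have h4 : (z ^ a) ^ 2 = 0 := by rw [← pow_mul]; exact pow_eq_zero_of_le (by omega) hz
  have h5 : (z ^ b) ^ 2 = 0 := by rw [← pow_mul]; exact pow_eq_zero_of_le (by omega) hz
  have h6 : (z ^ c) ^ 2 = 0 := by rw [← pow_mul]; exact pow_eq_zero_of_le (by omega) hz
  rw [thetaPoly, h1, h2, h3, h4, h5, h6]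
  ring

/-- The products of two of $X^a, X^b$, and those of $X^{2c}$ with $X^a$ or $X^b$, have degree at
least $\kappa + 4$. -/
theorem coeff_dumbbellPoly_of_le (ha : 4 ≤ a) (hb : 4 ≤ b) (hc : 2 ≤ c) (hc' : Even c) {κ : ℕ}
    (hκa : κ ≤ a) (hκb : κ ≤ b) (he : e < κ + 4) :
    (dumbbellPoly (X : ℤ[X]) a b c).coeff e = ((1 + X + 2 * X ^ 2) ^ 2 +
      2 * (1 + X ^ 2) * (1 + X + 2 * X ^ 2) * (X ^ a + X ^ b) -
        X ^ (2 * c + 2) * (1 + X) ^ 2 : ℤ[X]).coeff e := by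
  refine coeff_eq_coeff_of_map_eq (fun f hz => ?_) he
  rw [map_dumbbellPoly]
  simp only [map_pow, map_add, map_sub, map_mul, map_one, map_ofNat]
  generalize f X = z at *
  have h1 : z ^ a * z ^ b = 0 := by rw [← pow_add]; exact pow_eq_zero_of_le (by omega) hz
  have h2 : (z ^ c) ^ 2 * z ^ a = 0 := by
    rw [← pow_mul, ← pow_add]; exact pow_eq_zero_of_le (by omega) hz
  have h3 : (z ^ c) ^ 2 * z ^ b = 0 := by
    rw [← pow_mul, ← pow_add]; exact pow_eq_zero_of_le (by omega) hz
  have h4 : (z ^ a) ^ 2 = 0 := by rw [← pow_mul]; exact pow_eq_zero_of_le (by omega) hz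
  have h5 : (z ^ b) ^ 2 = 0 := by rw [← pow_mul]; exact pow_eq_zero_of_le (by omega) hz
  rw [dumbbellPoly, h4, h5, hc'.neg_one_pow, pow_add, pow_mul']
  generalize z ^ a = u at *
  generalize z ^ b = v at *
  generalize (z ^ c) ^ 2 = w at *
  linear_combination (4 * (1 + z ^ 2) ^ 2 * (1 - w)) * h1 - 2 * (1 + z ^ 2) * (z + z ^ 2) * (h2 + h3)

/-- The positive odd terms sit in degrees 1 and 3 and above `2 * (a + b + c)`. -/
theorem coeff_thetaPoly_nonpos (ha : Even a) (hb : Even b) (hc : Even c) (he : Odd e) (h5 : 5 ≤ e)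
    (heN : e ≤ 2 * (a + b + c)) : (thetaPoly (X : ℤ[X]) a b c).coeff e ≤ 0 := by
  rw [coeff_thetaPoly_of_odd ha hb hc he, if_neg (by omega), if_neg (by omega), if_neg (by omega),
    if_neg (by omega)]
  have h (P : Prop) [Decidable P] : 0 ≤ if P then (1 : ℤ) else 0 := by split_ifs <;> simp
  linarith [h (e = 2 * a + 3), h (e = 2 * b + 3), h (e = 2 * c + 3), h (e = 2 * (b + c) + 1),
    h (e = 2 * (a + c) + 1), h (e = 2 * (a + b) + 1)]

/-- Of the six exponents with coefficient `-2`, three are 3 and three are 1 modulo 4, so at most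
three coincide. -/
theorem neg_six_le_coeff_thetaPoly (ha : Even a) (hb : Even b) (hc : Even c) (he : Odd e) :
    -6 ≤ (thetaPoly (X : ℤ[X]) a b c).coeff e := by
  rw [coeff_thetaPoly_of_odd ha hb hc he]
  obtain ⟨a, rfl⟩ := ha
  obtain ⟨b, rfl⟩ := hb
  obtain ⟨c, rfl⟩ := hc
  have h (P : Prop) [Decidable P] (x : ℤ) (hx : 0 ≤ x) : 0 ≤ if P then x else 0 := by
    split_ifs <;> simp [hx]
  have h' (P Q : Prop) [Decidable P] [Decidable Q] (hPQ : P → ¬ Q) :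
      (if P then 1 else 0) + (if Q then 1 else 0) ≤ (1 : ℤ) := by
    split_ifs <;> simp_all
  linarith [h (e = 1) 2 (by simp), h (e = 3) 4 (by simp),
    h (e = 2 * (a + a + (b + b) + (c + c)) + 1) 4 (by simp),
    h (e = 2 * (a + a + (b + b) + (c + c)) + 3) 2 (by simp),
    h' (e = 2 * (a + a) + 3) (e = 2 * (b + b + (c + c)) + 1) (by omega),
    h' (e = 2 * (b + b) + 3) (e = 2 * (a + a + (c + c)) + 1) (by omega),
    h' (e = 2 * (c + c) + 3) (e = 2 * (a + a + (b + b)) + 1) (by omega)]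

theorem coeff_dumbbellPoly_of_odd (ha : 4 ≤ a) (hb : 4 ≤ b) (hc : 2 ≤ c) (ha' : Even a)
    (hb' : Even b) (hc' : Even c) {κ : ℕ} (hκa : κ ≤ a) (hκb : κ ≤ b) (he : e < κ + 4)
    (he' : Odd e) (he5 : 5 ≤ e) :
    (dumbbellPoly (X : ℤ[X]) a b c).coeff e =
      2 * ((if e = a + 1 then 1 else 0) + (if e = b + 1 then 1 else 0)
        + (if e = a + 3 then 1 else 0) + (if e = b + 3 then 1 else 0)
        - (if e = 2 * c + 3 then 1 else 0)) := by
  rw [coeff_dumbbellPoly_of_le ha hb hc hc' hκa hκb he]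
  have h : ((1 + X + 2 * X ^ 2) ^ 2 : ℤ[X]) + 2 * (1 + X ^ 2) * (1 + X + 2 * X ^ 2) * (X ^ a + X ^ b) -
      X ^ (2 * c + 2) * (1 + X) ^ 2 = C 1 * X ^ 0 + C 2 * X ^ 1 + C 5 * X ^ 2 + C 4 * X ^ 3 +
        C 4 * X ^ 4 + C 2 * X ^ a + C 2 * X ^ (a + 1) + C 6 * X ^ (a + 2) + C 2 * X ^ (a + 3) +
        C 4 * X ^ (a + 4) + C 2 * X ^ b + C 2 * X ^ (b + 1) + C 6 * X ^ (b + 2) +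
        C 2 * X ^ (b + 3) + C 4 * X ^ (b + 4) - C 1 * X ^ (2 * c + 2) - C 2 * X ^ (2 * c + 3) -
        C 1 * X ^ (2 * c + 4) := by
    simp only [map_ofNat, map_one]
    ring
  obtain ⟨a, rfl⟩ := ha'
  obtain ⟨b, rfl⟩ := hb'
  obtain ⟨c, rfl⟩ := hc'
  obtain ⟨e, rfl⟩ := he'
  simp only [h, coeff_sub, coeff_add, coeff_C_mul, coeff_X_pow]
  rw [if_neg (by omega), if_neg (by omega), if_neg (by omega), if_neg (by omega),
    if_neg (by omega), if_neg (c := 2 * e + 1 = a + a) (by omega),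
    if_neg (c := 2 * e + 1 = a + a + 2) (by omega), if_neg (c := 2 * e + 1 = a + a + 4) (by omega),
    if_neg (c := 2 * e + 1 = b + b) (by omega),
    if_neg (c := 2 * e + 1 = b + b + 2) (by omega), if_neg (c := 2 * e + 1 = b + b + 4) (by omega),
    if_neg (c := 2 * e + 1 = 2 * (c + c) + 2) (by omega),
    if_neg (c := 2 * e + 1 = 2 * (c + c) + 4) (by omega)]
  ring

end OddCoeff

/-! ### The comparison when all lengths are even. -/

section AllEven

variable {a b c a' b' c' : ℕ} {ks : List ℕ}

theorem exists_min_of_ne_nil (h : ks ≠ []) : ∃ κ ∈ ks, ∀ k ∈ ks, κ ≤ k := by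
  obtain ⟨κ, hκ, h⟩ := ks.toFinset.exists_min_image id
    (List.toFinset_nonempty_iff ks |>.2 h)
  exact ⟨κ, by simpa using hκ, fun k hk => h k (by simpa using hk)⟩

/-- A shortest extra cycle, of length `κ`, copies twice the coefficient 5 at `j = 2` or 4 at `j = 3`
to the place `κ + j`. Choosing `j` so that this place is odd, the coefficient there is at least `-6
+ 8`, against the non-positive one of a theta polynomial. -/
theorem eq_nil_of_thetaPoly_eq_of_even (ha : Even a) (hb : Even b) (hc : Even c) (ha' : Even a')
    (hb' : Even b') (hc' : Even c') (ha2 : 2 ≤ a') (hb2 : 2 ≤ b') (hc2 : 2 ≤ c')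
    (hk : ∀ k ∈ ks, 3 ≤ k) (hN : a + b + c = a' + b' + c' + ks.sum)
    (h : thetaPoly (X : ℤ[X]) a b c = thetaPoly X a' b' c' * (ks.map (cyclePoly X)).prod) :
    ks = [] := by
  by_contra hks
  obtain ⟨κ, hκ, hmin⟩ := exists_min_of_ne_nil hks
  have h3 := hk κ hκ
  have hκs : κ ≤ ks.sum := List.single_le_sum (fun _ _ => Nat.zero_le _) κ hκ
  obtain ⟨e0, e1, e2, e3⟩ := coeff_one_add_X_add_sq _ rfl
  have hlow := fun i hi => coeff_thetaPoly_of_lt_four (e := i) ha2 hb2 hc2 hi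
  have key : ∀ j, 2 ≤ j → j ≤ 3 → j < κ → Odd (κ + j) →
      (thetaPoly (X : ℤ[X]) a' b' c').coeff j ≤ 3 := fun j hj2 hj hjκ hodd => by
    have h1 := coeff_add_le_coeff_mul_prod_cyclePoly (P := thetaPoly X a' b' c') hκ hmin hjκ
      (fun i hi => by
        have hi3 : i ≤ 3 := by omega
        rw [hlow i (by omega)]
        interval_cases i <;> simp [e0, e1, e2, e3])
    have h2 := neg_six_le_coeff_thetaPoly ha' hb' hc' hodd
    have h3 := coeff_thetaPoly_nonpos ha hb hc hodd (by omega) (by omega)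
    rw [h] at h3
    omega
  rcases Nat.even_or_odd κ with hev | hod
  · have := key 3 (by omega) le_rfl (by obtain ⟨k, rfl⟩ := hev; omega) (hev.add_odd (by decide))
    rw [hlow 3 (by omega), e3] at this
    omega
  · have := key 2 le_rfl (by omega) (by omega) (hod.add_even (by decide))
    rw [hlow 2 (by omega), e2] at this
    omega

/-- Let `κ` be the shortest cycle length, loops included. A loop of length `κ` contributes `+2` at
both `κ + 1` and `κ + 3`, while the bridge supplies a single `-2`, at `2 * c' + 3`; an extra cycle
of length `κ` contributes at least 8 at `κ + 3` or `κ + 2`. Either way a forbidden positive odd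
coefficient appears. -/
theorem thetaPoly_ne_dumbbellPoly_of_even (ha : Even a) (hb : Even b) (hc : Even c) (ha' : Even a')
    (hb' : Even b') (hc' : Even c') (ha3 : 3 ≤ a') (hb3 : 3 ≤ b') (hc1 : 1 ≤ c')
    (hk : ∀ k ∈ ks, 3 ≤ k) (hN : a + b + c = a' + b' + c' + ks.sum) :
    thetaPoly (X : ℤ[X]) a b c ≠ dumbbellPoly X a' b' c' * (ks.map (cyclePoly X)).prod := by
  intro h
  have ha4 : 4 ≤ a' := by obtain ⟨k, rfl⟩ := ha'; omega
  have hb4 : 4 ≤ b' := by obtain ⟨k, rfl⟩ := hb'; omega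
  have hc2 : 2 ≤ c' := by obtain ⟨k, rfl⟩ := hc'; omega
  obtain ⟨κ, hκ, hmin⟩ := exists_min_of_ne_nil (ks := a' :: b' :: ks) (by simp)
  have hκa := hmin a' (by simp)
  have hκb := hmin b' (by simp)
  have hmin' : ∀ k ∈ ks, κ ≤ k := fun k hk => hmin k (by simp [hk])
  have h3 : 3 ≤ κ := by
    simp only [List.mem_cons] at hκ
    rcases hκ with rfl | rfl | hκ
    exacts [ha3, hb3, hk _ hκ]
  obtain ⟨e0, e1, e2, e3⟩ := coeff_one_add_X_add_sq _ rfl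
  have hlow : ∀ i < 4, (dumbbellPoly (X : ℤ[X]) a' b' c').coeff i =
      ((1 + X + 2 * X ^ 2) ^ 2 : ℤ[X]).coeff i := fun i hi => by
    -- The instance `κ = 0` covers the first four coefficients.
    rw [coeff_dumbbellPoly_of_le ha4 hb4 hc2 hc' (Nat.zero_le _) (Nat.zero_le _)
      (by omega : i < 0 + 4)]
    simp only [coeff_sub, coeff_add, mul_add (2 * (1 + X ^ 2) * (1 + X + 2 * X ^ 2) : ℤ[X]),
      coeff_mul_X_pow', coeff_X_pow_mul']
    rw [if_neg (by omega), if_neg (by omega), if_neg (by omega)]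
    ring
  have hpos : ∀ i < 4, 0 ≤ (dumbbellPoly (X : ℤ[X]) a' b' c').coeff i := fun i hi => by
    rw [hlow i hi]
    interval_cases i <;> simp [e0, e1, e2, e3]
  have hle : ∀ j < 4, Odd (κ + j) → 5 ≤ κ + j →
      (dumbbellPoly (X : ℤ[X]) a' b' c' * (ks.map (cyclePoly X)).prod).coeff (κ + j) ≤ 0 :=
    fun j hj hodd h5 => by
      rw [← h]
      exact coeff_thetaPoly_nonpos ha hb hc hodd h5 (by omega)
  have hge : ∀ j, j < κ → j < 4 → (dumbbellPoly (X : ℤ[X]) a' b' c').coeff (κ + j) ≤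
        (dumbbellPoly (X : ℤ[X]) a' b' c' * (ks.map (cyclePoly X)).prod).coeff (κ + j) :=
    fun j hj hj4 => coeff_le_coeff_mul_prod_cyclePoly hmin' hj fun i hi => hpos i (by omega)
  have hge' : ∀ j, j < κ → j < 4 → κ ∈ ks → (dumbbellPoly (X : ℤ[X]) a' b' c').coeff (κ + j) +
      2 * (dumbbellPoly (X : ℤ[X]) a' b' c').coeff j ≤
        (dumbbellPoly (X : ℤ[X]) a' b' c' * (ks.map (cyclePoly X)).prod).coeff (κ + j) :=
    fun j hj hj4 hκ =>
      coeff_add_le_coeff_mul_prod_cyclePoly hκ hmin' hj fun i hi => hpos i (by omega)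
  have hval : ∀ j < 4, Odd (κ + j) → 5 ≤ κ + j → _ := fun j hj hodd h5 =>
    coeff_dumbbellPoly_of_odd ha4 hb4 hc2 ha' hb' hc' hκa hκb (e := κ + j) (by omega) hodd h5
  rcases Nat.even_or_odd κ with hev | hod
  · have h4 : 4 ≤ κ := by obtain ⟨k, rfl⟩ := hev; omega
    have o1 : Odd (κ + 1) := hev.add_odd (by decide)
    have o3 : Odd (κ + 3) := hev.add_odd (by decide)
    have v1 := hval 1 (by omega) o1 (by omega)
    have v3 := hval 3 (by omega) o3 (by omega)
    have l1 := hle 1 (by omega) o1 (by omega)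
    have l3 := hle 3 (by omega) o3 (by omega)
    simp only [List.mem_cons] at hκ
    rcases hκ with hκ | hκ | hκ
    · have g1 := hge 1 (by omega) (by omega)
      have g3 := hge 3 (by omega) (by omega)
      rw [if_pos (by omega : κ + 1 = a' + 1)] at v1
      rw [if_pos (by omega : κ + 3 = a' + 3)] at v3
      split_ifs at v1 v3 <;> omega
    · have g1 := hge 1 (by omega) (by omega)
      have g3 := hge 3 (by omega) (by omega)
      rw [if_pos (by omega : κ + 1 = b' + 1)] at v1
      rw [if_pos (by omega : κ + 3 = b' + 3)] at v3
      split_ifs at v1 v3 <;> omega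
    · have g3 := hge' 3 (by omega) (by omega) hκ
      rw [hlow 3 (by omega), e3] at g3
      split_ifs at v3 <;> omega
  · have o2 : Odd (κ + 2) := hod.add_even (by decide)
    have v2 := hval 2 (by omega) o2 (by omega)
    have l2 := hle 2 (by omega) o2 (by omega)
    simp only [List.mem_cons] at hκ
    rcases hκ with rfl | rfl | hκ
    · exact absurd ha' (Nat.not_even_iff_odd.2 hod)
    · exact absurd hb' (Nat.not_even_iff_odd.2 hod)
    · have g2 := hge' 2 (by omega) (by omega) hκ
      rw [hlow 2 (by omega), e2] at g2
      split_ifs at v2 <;> omega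

end AllEven

/-! ### Parity information from the value at `z = 1`. -/

section ParityValues

variable {a b c a' b' c' : ℕ} {ks : List ℕ}

theorem thetaPoly_one (a b c : ℕ) : thetaPoly (1 : ℤ) a b c =
    40 - 4 * ((-1) ^ a * (-1) ^ b * (-1) ^ c) - 12 * ((-1) ^ a + (-1) ^ b + (-1) ^ c) := by
  simp only [thetaPoly, one_pow]
  ring

theorem dumbbellPoly_one (a b c : ℕ) : dumbbellPoly (1 : ℤ) a b c =
    64 - (-1) ^ c * (6 + 2 * (-1) ^ a) * (6 + 2 * (-1) ^ b) := by
  simp only [dumbbellPoly, one_pow]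
  ring

theorem prod_cyclePoly_one (ks : List ℕ) : 0 < (ks.map (cyclePoly (1 : ℤ))).prod ∧
    (ks = [] ∨ 2 ∣ (ks.map (cyclePoly (1 : ℤ))).prod) := by
  induction ks with
  | nil => simp
  | cons k ks ih =>
    rw [List.map_cons, List.prod_cons]
    have h : cyclePoly (1 : ℤ) k = 2 ∨ cyclePoly (1 : ℤ) k = 4 := by
      rcases neg_one_pow_eq_or ℤ k with h | h <;> simp [cyclePoly, h]
    rcases h with h | h <;> rw [h] <;> refine ⟨by linarith, .inr (Dvd.dvd.mul_right (by decide) _)⟩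

theorem neg_one_pow_int_cases (a : ℕ) : Even a ∧ (-1 : ℤ) ^ a = 1 ∨ Odd a ∧ (-1 : ℤ) ^ a = -1 :=
  (Nat.even_or_odd a).imp (fun h => ⟨h, h.neg_one_pow⟩) fun h => ⟨h, h.neg_one_pow⟩

/-- Theta values are 0, 32, 48 or 80, as none, one, two or three lengths are odd. No quotient of
nonzero values is an even integer, so extra cycles force the value 0 on both sides. -/
theorem even_or_eq_nil_of_thetaPoly_eq
    (h : thetaPoly (X : ℤ[X]) a b c = thetaPoly X a' b' c' * (ks.map (cyclePoly X)).prod) :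
    (Even a ∧ Even b ∧ Even c ∧ Even a' ∧ Even b' ∧ Even c') ∨ ks = [] := by
  have h1 := congrArg (evalRingHom (1 : ℤ)) h
  rw [map_mul, map_prod_cyclePoly, map_thetaPoly, map_thetaPoly] at h1
  simp only [coe_evalRingHom, eval_X, thetaPoly_one] at h1
  obtain ⟨hpos, hnil | ⟨m, hm⟩⟩ := prod_cyclePoly_one ks
  · exact .inr hnil
  rw [hm] at h1 hpos
  left
  rcases neg_one_pow_int_cases a with ⟨ha, ea⟩ | ⟨ha, ea⟩ <;>
  rcases neg_one_pow_int_cases b with ⟨hb, eb⟩ | ⟨hb, eb⟩ <;>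
  rcases neg_one_pow_int_cases c with ⟨hc, ec⟩ | ⟨hc, ec⟩ <;>
  rcases neg_one_pow_int_cases a' with ⟨ha', ea'⟩ | ⟨ha', ea'⟩ <;>
  rcases neg_one_pow_int_cases b' with ⟨hb', eb'⟩ | ⟨hb', eb'⟩ <;>
  rcases neg_one_pow_int_cases c' with ⟨hc', ec'⟩ | ⟨hc', ec'⟩ <;>
  first
  | exact ⟨ha, hb, hc, ha', hb', hc'⟩
  | (rw [ea, eb, ec, ea', eb', ec'] at h1; omega)

/-- The dumbbell values are 0, 32, 48 for even `c'` and 80, 96, 128 for odd `c'`, and 0 occurs only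
when all three lengths are even. Again no nonzero theta value is an even multiple of one of them. -/
theorem parity_of_thetaPoly_eq_dumbbellPoly
    (h : thetaPoly (X : ℤ[X]) a b c = dumbbellPoly X a' b' c' * (ks.map (cyclePoly X)).prod) :
    (Even a ∧ Even b ∧ Even c ∧ Even a' ∧ Even b' ∧ Even c') ∨ ks = [] ∧
      dumbbellPoly (1 : ℤ) a' b' c' = thetaPoly (1 : ℤ) a b c ∧ thetaPoly (1 : ℤ) a b c ≠ 0 := by
  have h1 := congrArg (evalRingHom (1 : ℤ)) h
  rw [map_mul, map_prod_cyclePoly, map_thetaPoly, map_dumbbellPoly] at h1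
  simp only [coe_evalRingHom, eval_X] at h1
  obtain ⟨hpos, hnil⟩ := prod_cyclePoly_one ks
  by_cases h0 : thetaPoly (1 : ℤ) a b c = 0
  · left
    rw [h0, eq_comm, mul_eq_zero_iff_right hpos.ne'] at h1
    rw [thetaPoly_one] at h0
    rw [dumbbellPoly_one] at h1
    rcases neg_one_pow_int_cases a with ⟨ha, ea⟩ | ⟨ha, ea⟩ <;>
    rcases neg_one_pow_int_cases b with ⟨hb, eb⟩ | ⟨hb, eb⟩ <;>
    rcases neg_one_pow_int_cases c with ⟨hc, ec⟩ | ⟨hc, ec⟩ <;>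
    first
    | (rw [ea, eb, ec] at h0; omega)
    | skip
    rcases neg_one_pow_int_cases a' with ⟨ha', ea'⟩ | ⟨ha', ea'⟩ <;>
    rcases neg_one_pow_int_cases b' with ⟨hb', eb'⟩ | ⟨hb', eb'⟩ <;>
    rcases neg_one_pow_int_cases c' with ⟨hc', ec'⟩ | ⟨hc', ec'⟩ <;>
    first
    | exact ⟨ha, hb, hc, ha', hb', hc'⟩
    | (rw [ea', eb', ec'] at h1; omega)
  · right
    rcases hnil with rfl | ⟨m, hm⟩
    · exact ⟨rfl, by simpa using h1.symm, h0⟩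
    · exfalso
      rw [hm] at h1 hpos
      rw [thetaPoly_one] at h0 h1
      rw [dumbbellPoly_one] at h1
      rcases neg_one_pow_int_cases a with ⟨ha, ea⟩ | ⟨ha, ea⟩ <;>
      rcases neg_one_pow_int_cases b with ⟨hb, eb⟩ | ⟨hb, eb⟩ <;>
      rcases neg_one_pow_int_cases c with ⟨hc, ec⟩ | ⟨hc, ec⟩ <;>
      rcases neg_one_pow_int_cases a' with ⟨ha', ea'⟩ | ⟨ha', ea'⟩ <;>
      rcases neg_one_pow_int_cases b' with ⟨hb', eb'⟩ | ⟨hb', eb'⟩ <;>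
      rcases neg_one_pow_int_cases c' with ⟨hc', ec'⟩ | ⟨hc', ec'⟩ <;>
      rw [ea, eb, ec] at h0 h1 <;> rw [ea', eb', ec'] at h1 <;> omega

end ParityValues

/-! ### Odd parts after multiplication by `(1 - z) ^ 2`. -/

section OddParts

variable {R : Type*} [CommRing R]

/-- The contribution of one of the three cycles of a theta graph to `thetaOddPart`: its length is
`l`, and `a` is the length of the path it avoids. -/
def cycleOddPart (z : R) (a l : ℕ) : R :=
  if Even l then 2 * z * (1 + z ^ 2) * z ^ l * (1 - (-1) ^ a * (z ^ a) ^ 2) + 2 * z * (z ^ l) ^ 2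
  else -((1 + z ^ 2) ^ 2 * z ^ l * (1 - (-1) ^ a * (z ^ a) ^ 2)) - 2 * z * (z ^ l) ^ 2

/-- Up to the factor `-2 * (1 + z ^ 2)`, the odd part of `(1 - z) ^ 2 * thetaPoly z a b c`. -/
def thetaOddPart (z : R) (a b c : ℕ) : R :=
  2 * z ^ 3 - 2 * ((-1) ^ a * (-1) ^ b * (-1) ^ c) * z * (3 + z ^ 2) * (z ^ a * z ^ b * z ^ c) ^ 2
  + (cycleOddPart z a (b + c) + cycleOddPart z b (a + c) + cycleOddPart z c (a + b))

/-- The factor $(1-z)^2$ makes the terms with $(1+z)^2 z^{2a+2}$ even, so they drop out. It also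
reduces the constant block to one monomial, because $(1-z)(1+z+2z^2) = 1+z^2-2z^3$. -/
theorem thetaPoly_oddPart (z : R) (a b c : ℕ) :
    (1 + z) ^ 2 * thetaPoly (-z) a b c - (1 - z) ^ 2 * thetaPoly z a b c =
      4 * (1 + z ^ 2) * thetaOddPart z a b c := by
  simp only [thetaPoly, thetaOddPart, cycleOddPart, Nat.even_add]
  rcases Nat.even_or_odd a with ha | ha <;> rcases Nat.even_or_odd b with hb | hb <;>
  rcases Nat.even_or_odd c with hc | hc <;>
  simp only [ha.neg_one_pow, hb.neg_one_pow, hc.neg_one_pow, ha.neg_pow, hb.neg_pow, hc.neg_pow,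
    ha, hb, hc, Nat.not_even_iff_odd.2, iff_true, iff_false, if_true, if_false, not_true] <;>
  ring

/-- The even part of the contribution of a loop to `dumbbellOddPart`. -/
def loopEvenPart (z : R) (a : ℕ) : R :=
  if Even a then (1 + z ^ a) ^ 2 else 1 - 2 * z * z ^ a - (z ^ a) ^ 2

/-- The odd part of the contribution of a loop to `dumbbellOddPart`. -/
def loopOddPart (z : R) (a : ℕ) : R :=
  if Even a then z * (z ^ 2 + z ^ a) * (1 + z ^ a) else
    z ^ 3 - z * (z ^ a) ^ 2 - (1 + z ^ 2) * z ^ a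

/-- The even part of the contribution of a loop, at the bridge, to `dumbbellOddPart`. -/
def bridgeEvenPart (z : R) (a : ℕ) : R :=
  if Even a then z ^ a * (1 + z ^ a) else -(z ^ a * (z ^ a + z))

/-- The odd part of the contribution of a loop, at the bridge, to `dumbbellOddPart`. -/
def bridgeOddPart (z : R) (a : ℕ) : R :=
  if Even a then z * (1 + z ^ a) * (1 - z ^ 2 - (3 + z ^ 2) * z ^ a) else
    z * (1 - z ^ 2) + z * (3 + z ^ 2) * (z ^ a) ^ 2 + 2 * (1 + z ^ 2) * z ^ a

/-- Up to the factor `-2 * (1 + z ^ 2)`, the odd part of `(1 - z) ^ 2 * dumbbellPoly z a b c`. -/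
def dumbbellOddPart (z : R) (a b c : ℕ) : R :=
  loopEvenPart z a * loopOddPart z b + loopOddPart z a * loopEvenPart z b +
  (-1) ^ c * (z ^ c) ^ 2 *
    (bridgeEvenPart z a * bridgeOddPart z b + bridgeOddPart z a * bridgeEvenPart z b)

theorem dumbbellPoly_oddPart (z : R) (a b c : ℕ) :
    (1 + z) ^ 2 * dumbbellPoly (-z) a b c - (1 - z) ^ 2 * dumbbellPoly z a b c =
      4 * (1 + z ^ 2) * dumbbellOddPart z a b c := by
  simp only [dumbbellPoly, dumbbellOddPart, loopEvenPart, loopOddPart, bridgeEvenPart,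
    bridgeOddPart]
  rcases Nat.even_or_odd a with ha | ha <;> rcases Nat.even_or_odd b with hb | hb <;>
  rcases Nat.even_or_odd c with hc | hc <;>
  simp only [ha.neg_one_pow, hb.neg_one_pow, hc.neg_one_pow, ha.neg_pow, hb.neg_pow, hc.neg_pow,
    ha, hb, Nat.not_even_iff_odd.2, if_true, if_false] <;>
  ring

theorem map_cycleOddPart {S : Type*} [CommRing S] (f : R →+* S) (z : R) (a l : ℕ) :
    f (cycleOddPart z a l) = cycleOddPart (f z) a l := by
  unfold cycleOddPart
  split_ifs <;> simp [map_ofNat f 2]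

theorem map_thetaOddPart {S : Type*} [CommRing S] (f : R →+* S) (z : R) (a b c : ℕ) :
    f (thetaOddPart z a b c) = thetaOddPart (f z) a b c := by
  simp [thetaOddPart, map_cycleOddPart, map_ofNat f 2, map_ofNat f 3]

theorem map_dumbbellOddPart {S : Type*} [CommRing S] (f : R →+* S) (z : R) (a b c : ℕ) :
    f (dumbbellOddPart z a b c) = dumbbellOddPart (f z) a b c := by
  unfold dumbbellOddPart loopEvenPart loopOddPart bridgeEvenPart bridgeOddPart
  split_ifs <;> simp [map_ofNat f 2, map_ofNat f 3]

end OddParts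

section CompareOddParts

theorem four_mul_one_add_X_sq_ne_zero : 4 * (1 + X ^ 2 : ℤ[X]) ≠ 0 :=
  fun h => by simpa using congrArg (eval 1) h

variable {a b c a' b' c' : ℕ}

theorem thetaOddPart_eq_thetaOddPart (h : thetaPoly (X : ℤ[X]) a b c = thetaPoly X a' b' c') :
    thetaOddPart (X : ℤ[X]) a b c = thetaOddPart X a' b' c' := by
  have h' := congrArg (compRingHom (-X : ℤ[X])) h
  rw [map_thetaPoly, map_thetaPoly] at h'
  simp only [coe_compRingHom, X_comp] at h'
  apply mul_left_cancel₀ four_mul_one_add_X_sq_ne_zero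
  rw [← thetaPoly_oddPart, ← thetaPoly_oddPart, h, h']

theorem thetaOddPart_eq_dumbbellOddPart
    (h : thetaPoly (X : ℤ[X]) a b c = dumbbellPoly X a' b' c') :
    thetaOddPart (X : ℤ[X]) a b c = dumbbellOddPart X a' b' c' := by
  have h' := congrArg (compRingHom (-X : ℤ[X])) h
  rw [map_thetaPoly, map_dumbbellPoly] at h'
  simp only [coe_compRingHom, X_comp] at h'
  apply mul_left_cancel₀ four_mul_one_add_X_sq_ne_zero
  rw [← thetaPoly_oddPart, ← dumbbellPoly_oddPart, h, h']

end CompareOddParts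

/-- The low coefficients of the contribution of a cycle of length `l` to `thetaOddPart`. -/
def cycleCoeff (l e : ℕ) : ℤ :=
  if Even l then
    2 * ((if e = l + 1 then 1 else 0) + (if e = l + 3 then 1 else 0)
      + (if e = 2 * l + 1 then 1 else 0))
  else
    -((if e = l then 1 else 0) + 2 * (if e = l + 2 then 1 else 0) + (if e = l + 4 then 1 else 0)
      + 2 * (if e = 2 * l + 1 then 1 else 0))

/-- The avoided path enters only through $z^{l+2a}$, whose degree exceeds $N$, so up to degree $N$
the cycle length alone matters. -/
theorem coeff_cycleOddPart {a l N e : ℕ} (hN : N = l + a) (ha : 1 ≤ a) (he : e ≤ N) :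
    (cycleOddPart (X : ℤ[X]) a l).coeff e = cycleCoeff l e := by
  rw [coeff_eq_coeff_of_map_eq (Q := if Even l then C 2 * X ^ (l + 1) + C 2 * X ^ (l + 3) +
    C 2 * X ^ (2 * l + 1) else -(C 1 * X ^ l + C 2 * X ^ (l + 2) + C 1 * X ^ (l + 4) +
    C 2 * X ^ (2 * l + 1))) ?_ (Nat.lt_add_one_of_le he)]
  · unfold cycleCoeff
    by_cases h : Even l
    · simp only [if_pos h, coeff_add, coeff_C_mul, coeff_X_pow]
      ring
    · simp only [if_neg h, coeff_neg, coeff_add, coeff_C_mul, coeff_X_pow]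
      ring
  · intro S _ f hz
    rw [map_cycleOddPart]
    have h1 : f X ^ l * (f X ^ a) ^ 2 = 0 := by
      rw [← pow_mul, ← pow_add]; exact pow_eq_zero_of_le (by omega) hz
    unfold cycleOddPart
    split_ifs
    · simp only [map_add, map_mul, map_pow, map_ofNat]
      linear_combination (-2 * f X * (1 + f X ^ 2) * (-1) ^ a) * h1
    · simp only [map_add, map_mul, map_pow, map_ofNat, map_neg, map_one]
      linear_combination ((1 + f X ^ 2) ^ 2 * (-1) ^ a) * h1

theorem coeff_thetaOddPart {a b c e : ℕ} (ha : 1 ≤ a) (hb : 1 ≤ b) (hc : 1 ≤ c)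
    (he : e ≤ a + b + c) : (thetaOddPart (X : ℤ[X]) a b c).coeff e =
      (if e = 3 then 2 else 0) + (cycleCoeff (b + c) e + cycleCoeff (a + c) e +
        cycleCoeff (a + b) e) := by
  rw [← coeff_cycleOddPart (l := b + c) (a := a) (by omega) ha he,
    ← coeff_cycleOddPart (l := a + c) (a := b) (by omega) hb he,
    ← coeff_cycleOddPart (l := a + b) (a := c) (by omega) hc he, ← coeff_add,
    ← coeff_add]
  have h : (if e = 3 then 2 else 0) = (C 2 * X ^ 3 : ℤ[X]).coeff e := by
    simp only [coeff_C_mul, coeff_X_pow, mul_ite, mul_one, mul_zero]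
  rw [h, ← coeff_add]
  refine coeff_eq_coeff_of_map_eq (fun f hz => ?_) (Nat.lt_add_one_of_le he)
  rw [map_thetaOddPart, thetaOddPart]
  simp only [map_add, map_mul, map_pow, map_ofNat, map_cycleOddPart]
  have h1 : (f X ^ a * f X ^ b * f X ^ c) ^ 2 = 0 := by
    rw [← pow_add, ← pow_add, ← pow_mul]; exact pow_eq_zero_of_le (by omega) hz
  rw [h1]
  ring

/-- The low coefficients of the contribution of an odd loop of length `l` to `dumbbellOddPart`. -/
def oddLoopCoeff (l e : ℕ) : ℤ :=
  (if e = l then 1 else 0) + (if e = l + 2 then 1 else 0) + 2 * (if e = l + 4 then 1 else 0) +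
    (if e = 2 * l + 1 then 1 else 0)

theorem coeff_dumbbellOddPart_le {a b c e : ℕ} (ha : Odd a) (hb : Odd b) (hc : 1 ≤ c)
    (hea : e ≤ a) (heb : e ≤ b) : (dumbbellOddPart (X : ℤ[X]) a b c).coeff e =
      (if e = 3 then 2 else 0) - (if e = a then 1 else 0) - (if e = b then 1 else 0) := by
  rw [coeff_eq_coeff_of_map_eq (Q := C 2 * X ^ 3 - X ^ a - X ^ b) ?_ (Nat.lt_add_one e)]
  · simp only [coeff_sub, coeff_C_mul, coeff_X_pow, mul_ite, mul_one, mul_zero]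
  · intro S _ f hz
    rw [map_dumbbellOddPart]
    simp only [map_sub, map_mul, map_pow, map_ofNat, dumbbellOddPart, loopEvenPart, loopOddPart,
      bridgeEvenPart, bridgeOddPart, Nat.not_even_iff_odd.2, ha, hb, if_false]
    generalize f X = z at *
    have h1 : z ^ a * z = 0 := by rw [← pow_succ]; exact pow_eq_zero_of_le (by omega) hz
    have h2 : z ^ b * z = 0 := by rw [← pow_succ]; exact pow_eq_zero_of_le (by omega) hz
    obtain ⟨a, rfl⟩ := ha
    obtain ⟨b, rfl⟩ := hb
    obtain ⟨c, rfl⟩ := Nat.exists_eq_add_of_le hc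
    generalize hu : z ^ (2 * a + 1) = u at *
    generalize hv : z ^ (2 * b + 1) = v at *
    have h3 : u * u = 0 := by
      nth_rw 1 [← hu]; rw [pow_succ]; linear_combination z ^ (2 * a) * h1
    have h4 : v * v = 0 := by
      nth_rw 1 [← hv]; rw [pow_succ]; linear_combination z ^ (2 * b) * h2
    have h5 : u * v = 0 := by
      nth_rw 1 [← hu]; rw [pow_succ]; linear_combination z ^ (2 * a) * h2
    have hw : z ^ (1 + c) = z * z ^ c := by ring
    rw [hw]
    generalize z ^ c = w
    grind

/-- Modulo $X^{g+5}$ all bridge terms vanish, so the parity of `c` plays no role. -/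
theorem coeff_dumbbellOddPart_odd_odd {a b c g e : ℕ} (ha : Odd a) (hb : Odd b) (ha3 : 3 ≤ a)
    (hb3 : 3 ≤ b) (hc : 2 ≤ c) (hga : g ≤ a) (hgb : g ≤ b) (he : e ≤ g + 4) :
    (dumbbellOddPart (X : ℤ[X]) a b c).coeff e = (if e = 3 then 2 else 0) -
      (oddLoopCoeff a e + oddLoopCoeff b e) + (if e = a + b + 1 then 4 else 0) := by
  rw [coeff_eq_coeff_of_map_eq (Q := C 2 * X ^ 3 - (X ^ a + X ^ (a + 2) + C 2 * X ^ (a + 4) +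
    X ^ (2 * a + 1) + (X ^ b + X ^ (b + 2) + C 2 * X ^ (b + 4) + X ^ (2 * b + 1))) +
    C 4 * X ^ (a + b + 1)) ?_ (Nat.lt_add_one_of_le he)]
  · simp only [oddLoopCoeff, coeff_add, coeff_sub, coeff_C_mul, coeff_X_pow, mul_ite, mul_one,
      mul_zero]
  · intro S _ f hz
    rw [map_dumbbellOddPart]
    simp only [map_add, map_sub, map_mul, map_pow, map_ofNat, dumbbellOddPart, loopEvenPart,
      loopOddPart, bridgeEvenPart, bridgeOddPart, Nat.not_even_iff_odd.2, ha, hb, if_false]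
    have hz' : ∀ n, g + 5 ≤ n → f X ^ n = 0 := fun n hn => pow_eq_zero_of_le hn hz
    generalize f X = z at *
    have h1 : (z ^ c) ^ 2 * z ^ a * z = 0 := by
      rw [← pow_mul, ← pow_add, ← pow_succ]; exact hz' _ (by omega)
    have h2 : (z ^ c) ^ 2 * z ^ b * z = 0 := by
      rw [← pow_mul, ← pow_add, ← pow_succ]; exact hz' _ (by omega)
    have h3 : (z ^ c) ^ 2 * z ^ a * z ^ b = 0 := by
      rw [← pow_mul, ← pow_add, ← pow_add]; exact hz' _ (by omega)
    have h4 : z ^ a * (z ^ b) ^ 2 = 0 := by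
      rw [← pow_mul, ← pow_add]; exact hz' _ (by omega)
    have h5 : (z ^ a) ^ 2 * z ^ b = 0 := by
      rw [← pow_mul, ← pow_add]; exact hz' _ (by omega)
    have h6 : z ^ a * z ^ b * z ^ 2 = 0 := by
      rw [← pow_add, ← pow_add]; exact hz' _ (by omega)
    have h7 : (z ^ a) ^ 2 * z ^ 2 = 0 := by
      rw [← pow_mul, ← pow_add]; exact hz' _ (by omega)
    have h8 : (z ^ b) ^ 2 * z ^ 2 = 0 := by
      rw [← pow_mul, ← pow_add]; exact hz' _ (by omega)
    simp only [pow_add, pow_mul', pow_one]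
    generalize z ^ a = u at *
    generalize z ^ b = v at *
    generalize (z ^ c) ^ 2 = w at *
    generalize (-1) ^ c = ε
    grind

/-- Here the bridge term $X^{2c+a+1}$ may survive in the last degree considered, and its sign needs
the parity of `c`. -/
theorem coeff_dumbbellOddPart_even_odd {a b c g e : ℕ} (ha : Even a) (hb : Odd b) (ha4 : 4 ≤ a)
    (hb3 : 3 ≤ b) (hc : 2 ≤ c) (hc' : Even c) (hga : g ≤ a + 1) (hgb : g ≤ b) (he : e ≤ g + 4) :
    (dumbbellOddPart (X : ℤ[X]) a b c).coeff e = (if e = 3 then 2 else 0) +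
      ((if e = a + 1 then 1 else 0) + (if e = a + 3 then 3 else 0) +
        (if e = 2 * a + 1 then 1 else 0)) - oddLoopCoeff b e - (if e = a + b then 2 else 0) +
        (if e = 2 * c + a + 1 then 1 else 0) := by
  rw [coeff_eq_coeff_of_map_eq (Q := C 2 * X ^ 3 + (X ^ (a + 1) + C 3 * X ^ (a + 3) +
    X ^ (2 * a + 1)) - (X ^ b + X ^ (b + 2) + C 2 * X ^ (b + 4) + X ^ (2 * b + 1)) -
    C 2 * X ^ (a + b) + X ^ (2 * c + a + 1)) ?_ (Nat.lt_add_one_of_le he)]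
  · simp only [oddLoopCoeff, coeff_add, coeff_sub, coeff_C_mul, coeff_X_pow, mul_ite, mul_one,
      mul_zero]
  · intro S _ f hz
    rw [map_dumbbellOddPart]
    simp only [map_add, map_sub, map_mul, map_pow, map_ofNat, dumbbellOddPart, loopEvenPart,
      loopOddPart, bridgeEvenPart, bridgeOddPart, Nat.not_even_iff_odd.2, ha, hb, if_false,
      if_true, hc'.neg_one_pow]
    have hz' : ∀ n, g + 5 ≤ n → f X ^ n = 0 := fun n hn => pow_eq_zero_of_le hn hz
    generalize f X = z at *
    have h1 : (z ^ c) ^ 2 * z ^ a * z ^ 2 = 0 := by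
      rw [← pow_mul, ← pow_add, ← pow_add]; exact hz' _ (by omega)
    have h2 : (z ^ c) ^ 2 * z ^ b * z = 0 := by
      rw [← pow_mul, ← pow_add, ← pow_succ]; exact hz' _ (by omega)
    have h3 : (z ^ c) ^ 2 * z ^ a * z ^ b = 0 := by
      rw [← pow_mul, ← pow_add, ← pow_add]; exact hz' _ (by omega)
    have h3' : (z ^ c) ^ 2 * (z ^ a) ^ 2 = 0 := by
      rw [← pow_mul, ← pow_mul, ← pow_add]; exact hz' _ (by omega)
    have h4 : z ^ a * (z ^ b) ^ 2 = 0 := by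
      rw [← pow_mul, ← pow_add]; exact hz' _ (by omega)
    have h5 : (z ^ a) ^ 2 * z ^ b = 0 := by
      rw [← pow_mul, ← pow_add]; exact hz' _ (by omega)
    have h6 : z ^ a * z ^ b * z = 0 := by
      rw [← pow_add, ← pow_succ]; exact hz' _ (by omega)
    have h7 : (z ^ a) ^ 2 * z ^ 2 = 0 := by
      rw [← pow_mul, ← pow_add]; exact hz' _ (by omega)
    have h8 : (z ^ b) ^ 2 * z ^ 2 = 0 := by
      rw [← pow_mul, ← pow_add]; exact hz' _ (by omega)
    simp only [pow_add, pow_mul', pow_one]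
    generalize z ^ a = u at *
    generalize z ^ b = v at *
    generalize (z ^ c) ^ 2 = w at *
    grind

/-! ### Combinatorics of the low coefficients. -/

section Lengths

variable {l l₀ l₁ l₂ a b c e m : ℕ}

theorem cycleCoeff_of_even_of_le (hl : Even l) (h1 : 1 ≤ l) (he : e ≤ l + 1) :
    cycleCoeff l e = if e = l + 1 then 2 else 0 := by
  rw [cycleCoeff, if_pos hl, if_neg (c := e = l + 3) (by omega)]
  split_ifs <;> omega

theorem cycleCoeff_of_odd_of_le (hl : Odd l) (he : e ≤ l) :
    cycleCoeff l e = if e = l then -1 else 0 := by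
  have := hl.pos
  rw [cycleCoeff, if_neg (Nat.not_even_iff_odd.2 hl), if_neg (c := e = l + 2) (by omega),
    if_neg (c := e = l + 4) (by omega), if_neg (c := e = 2 * l + 1) (by omega)]
  split_ifs <;> rfl

theorem cycleCoeff_of_lt (h1 : 1 ≤ l) (he : e < l) : cycleCoeff l e = 0 := by
  rcases Nat.even_or_odd l with hl | hl
  · rw [cycleCoeff_of_even_of_le hl h1 (by omega), if_neg (by omega)]
  · rw [cycleCoeff_of_odd_of_le hl he.le, if_neg he.ne]

theorem cycleCoeff_nonneg (hl : Even l) (e : ℕ) : 0 ≤ cycleCoeff l e := by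
  rw [cycleCoeff, if_pos hl]
  positivity

theorem oddLoopCoeff_of_lt (he : e < l) : oddLoopCoeff l e = 0 := by
  rw [oddLoopCoeff, if_neg he.ne, if_neg (by omega), if_neg (by omega), if_neg (by omega)]
  rfl

/-- The leading terms are `2` at `l₀ + 1` and `-1` at each odd length. They cancel only as `2 - 1 -
1`, with both odd lengths equal to `l₀ + 1`. -/
theorem cycleCoeff_add_eq_zero (h₀ : Even l₀) (h₁ : Odd l₁) (h₂ : Odd l₂) (h₀1 : 1 ≤ l₀)
    (h₁₂ : l₁ ≤ l₂)
    (h : ∀ e < m, cycleCoeff l₀ e + cycleCoeff l₁ e + cycleCoeff l₂ e = 0) :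
    (m ≤ l₀ + 1 ∧ m ≤ l₁) ∨ (l₁ = l₀ + 1 ∧ l₂ = l₀ + 1 ∧ l₀ + 2 ≤ m) := by
  rcases Nat.lt_or_ge l₀ l₁ with hlt | hge
  · by_cases hm : m ≤ l₀ + 1
    · exact .inl ⟨hm, by omega⟩
    · have := h (l₀ + 1) (by omega)
      rw [cycleCoeff_of_even_of_le h₀ h₀1 le_rfl, cycleCoeff_of_odd_of_le h₁ (by omega),
        cycleCoeff_of_odd_of_le h₂ (by omega)] at this
      split_ifs at this <;> omega
  · by_cases hm : m ≤ l₁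
    · exact .inl ⟨by omega, hm⟩
    · have := h l₁ (by omega)
      rw [cycleCoeff_of_even_of_le h₀ h₀1 (by omega), cycleCoeff_of_odd_of_le h₁ le_rfl,
        cycleCoeff_of_odd_of_le h₂ h₁₂, if_neg (by omega), if_pos rfl] at this
      split_ifs at this <;> omega

/-- The lowest coefficient forces `l₁ = a`. Then the profile `-1, -2, -1` of an odd cycle at `a`, `a
+ 2`, `a + 4` has to match `-1, -1, -2` of an odd loop; the other terms cannot repair this within
the given total length. -/
theorem not_odd_odd_loops (h₀ : Even l₀) (h₁ : Odd l₁) (h₂ : Odd l₂) (h₀2 : 2 ≤ l₀)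
    (h₁₂ : l₁ ≤ l₂) (hs : l₀ + l₁ + l₂ = 2 * (a + b + c)) (h₀N : l₀ < a + b + c)
    (h₂N : l₂ < a + b + c) (ha : Odd a) (hb : Odd b) (ha3 : 3 ≤ a) (hab : a ≤ b) (hc : 2 ≤ c)
    (h : ∀ e ≤ a + 4, cycleCoeff l₀ e + cycleCoeff l₁ e + cycleCoeff l₂ e =
      -(oddLoopCoeff a e + oddLoopCoeff b e) + if e = a + b + 1 then 4 else 0) : False := by
  rcases cycleCoeff_add_eq_zero (m := a) h₀ h₁ h₂ (by omega) h₁₂ (fun e he => by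
    rw [h e (by omega), oddLoopCoeff_of_lt he, oddLoopCoeff_of_lt (by omega), if_neg (by omega)]
    rfl) with ⟨hm, hm'⟩ | ⟨rfl, rfl, hm⟩
  swap
  · omega
  rw [Nat.even_iff] at h₀
  rw [Nat.odd_iff] at h₁ h₂ ha hb
  simp only [cycleCoeff, oddLoopCoeff, Nat.even_iff, h₀, h₁, h₂, if_true, one_ne_zero,
    if_false] at h
  have h0 := h a (by omega)
  have h2 := h (a + 2) (by omega)
  have h4 := h (a + 4) (by omega)
  clear h
  have hl : l₁ = a := by
    clear h2 h4
    grind (splits := 40)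
  subst hl
  grind (splits := 40)

/-- As before, with the profile `2, 2` of an even cycle at `l + 1`, `l + 3` against `1, 3` of an
even loop. -/
theorem not_even_odd_loops (h₀ : Even l₀) (h₁ : Odd l₁) (h₂ : Odd l₂) (h₀2 : 2 ≤ l₀)
    (h₁₂ : l₁ ≤ l₂) (hs : l₀ + l₁ + l₂ = 2 * (a + b + c)) (h₀N : l₀ < a + b + c)
    (h₂N : l₂ < a + b + c) (ha : Even a) (hb : Odd b) (ha4 : 4 ≤ a) (hb3 : 3 ≤ b) (hc : 2 ≤ c)
    (h : ∀ e ≤ a + 5, e ≤ b + 4 → cycleCoeff l₀ e + cycleCoeff l₁ e + cycleCoeff l₂ e =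
      ((if e = a + 1 then 1 else 0) + (if e = a + 3 then 3 else 0) +
        (if e = 2 * a + 1 then 1 else 0)) - oddLoopCoeff b e - (if e = a + b then 2 else 0) +
        (if e = 2 * c + a + 1 then 1 else 0)) : False := by
  rcases cycleCoeff_add_eq_zero (m := min (a + 1) b) h₀ h₁ h₂ (by omega) h₁₂ (fun e he => by
    rw [h e (by omega) (by omega), oddLoopCoeff_of_lt (by omega), if_neg (by omega),
      if_neg (by omega), if_neg (by omega), if_neg (by omega), if_neg (by omega)]
    rfl) with ⟨hm, hm'⟩ | ⟨rfl, rfl, hm⟩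
  swap
  · omega
  rw [Nat.even_iff] at h₀ ha
  rw [Nat.odd_iff] at h₁ h₂ hb
  simp only [cycleCoeff, oddLoopCoeff, Nat.even_iff, h₀, h₁, h₂, if_true, one_ne_zero,
    if_false] at h
  -- The loops start at `b` with `-1` and at `a + 1` with `+1`; in the middle case these leading
  -- terms cancel.
  rcases lt_trichotomy b (a + 1) with hlt | hlt | hlt
  · have h0 := h b (by omega) (by omega)
    have h2 := h (b + 2) (by omega) (by omega)
    have h4 := h (b + 4) (by omega) (by omega)
    clear h
    have hl : l₁ = b := by
      clear h2 h4
      grind (splits := 40)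
    subst hl
    grind (splits := 40)
  · have hm : a ≤ l₀ := by omega
    have hm' : a + 1 ≤ l₁ := by omega
    have h0 := h (a + 1) (by omega) (by omega)
    have h2 := h (a + 3) (by omega) (by omega)
    have h4 := h (a + 5) (by omega) (by omega)
    clear h
    by_cases hl : l₀ = a
    · subst hl
      grind (splits := 40)
    · grind (splits := 40)
  · have hm : a ≤ l₀ := by omega
    have hm' : a + 1 ≤ l₁ := by omega
    have h0 := h (a + 1) (by omega) (by omega)
    have h2 := h (a + 3) (by omega) (by omega)
    clear h
    have hl : l₀ = a := by
      clear h2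
      grind (splits := 40)
    subst hl
    grind (splits := 40)

theorem cycleCoeff_succ_of_le {x : ℕ} (hx : Even x) (hx1 : 1 ≤ x) (h : x ≤ l) :
    cycleCoeff l (x + 1) = if l = x then 2 else if Odd l ∧ l = x + 1 then -1 else 0 := by
  rcases Nat.even_or_odd l with hl | hl
  · rw [cycleCoeff_of_even_of_le hl (by omega) (by omega),
      if_neg (c := Odd l ∧ l = x + 1) fun h => Nat.not_even_iff_odd.2 h.1 hl]
    split_ifs <;> omega
  · have hne : l ≠ x := by
      rintro rfl
      exact Nat.not_even_iff_odd.2 hl hx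
    rw [cycleCoeff_of_odd_of_le hl (by omega), if_neg hne]
    simp only [hl, true_and, eq_comm]

theorem cycleCoeff_of_le_of_odd {x : ℕ} (hx : Odd x) (h : x ≤ l) :
    cycleCoeff l x = if l = x then -1 else 0 := by
  rcases Nat.even_or_odd l with hl | hl
  · have hne : l ≠ x := by
      rintro rfl
      exact Nat.not_even_iff_odd.2 hx hl
    have := hx.pos
    rw [cycleCoeff_of_even_of_le hl (by omega) (by omega), if_neg (by omega), if_neg hne]
  · rw [cycleCoeff_of_odd_of_le hl h]
    simp only [eq_comm]

theorem cycleCoeff_succ_nonpos {x : ℕ} (hx : Even x) (hx1 : 1 ≤ x) (h : x < l) :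
    cycleCoeff l (x + 1) ≤ 0 := by
  rw [cycleCoeff_succ_of_le hx hx1 h.le, if_neg h.ne']
  split_ifs <;> simp

variable {x y z x' y' z' N : ℕ}

theorem le_of_cycleCoeff_add_eq (hxy : x ≤ y) (hxy' : x' ≤ y') (hx : 1 ≤ x)
    (hs : x + y = x' + y') (hy : x < N)
    (h : ∀ e ≤ N, cycleCoeff x e + cycleCoeff y e = cycleCoeff x' e + cycleCoeff y' e) :
    x' ≤ x := by
  by_contra! hlt
  rcases Nat.even_or_odd x with he | ho
  · have := h (x + 1) (by omega)
    rw [cycleCoeff_succ_of_le he hx le_rfl, cycleCoeff_succ_of_le he hx hxy,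
      cycleCoeff_succ_of_le he hx hlt.le, cycleCoeff_succ_of_le he hx (by omega)] at this
    split_ifs at this <;> omega
  · have := h x (by omega)
    rw [cycleCoeff_of_le_of_odd ho le_rfl, cycleCoeff_of_le_of_odd ho hxy,
      cycleCoeff_of_lt (by omega) hlt, cycleCoeff_of_lt (by omega) (by omega)] at this
    split_ifs at this <;> omega

/-- If all primed lengths exceeded `x`, they could not produce the leading term of `x`. For even `x`
it could be cancelled only by `y = z = x + 1`, and then the sum `3 * x + 2` would be too small for
the primed lengths. -/
theorem le_of_cycleCoeff_add_add_eq (hxy : x ≤ y) (hyz : y ≤ z) (hxy' : x' ≤ y')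
    (hyz' : y' ≤ z') (hx : 1 ≤ x) (hs : x + y + z = x' + y' + z') (hN : x < N)
    (h : ∀ e ≤ N, cycleCoeff x e + cycleCoeff y e + cycleCoeff z e =
      cycleCoeff x' e + cycleCoeff y' e + cycleCoeff z' e) : x' ≤ x := by
  by_contra! hlt
  rcases Nat.even_or_odd x with he | ho
  · have := h (x + 1) (by omega)
    have h1 := cycleCoeff_succ_nonpos he hx hlt
    have h2 := cycleCoeff_succ_nonpos he hx (hlt.trans_le hxy')
    have h3 := cycleCoeff_succ_nonpos he hx (hlt.trans_le (hxy'.trans hyz'))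
    have h4 : cycleCoeff x (x + 1) + cycleCoeff y (x + 1) + cycleCoeff z (x + 1) ≤ 0 := by
      linarith
    clear h this h1 h2 h3
    rw [cycleCoeff_succ_of_le he hx le_rfl, cycleCoeff_succ_of_le he hx hxy,
      cycleCoeff_succ_of_le he hx (hxy.trans hyz), if_pos rfl] at h4
    split_ifs at h4 <;> omega
  · have := h x hN.le
    clear h
    rw [cycleCoeff_of_le_of_odd ho le_rfl, cycleCoeff_of_le_of_odd ho hxy,
      cycleCoeff_of_le_of_odd ho (hxy.trans hyz),
      cycleCoeff_of_lt (by omega) hlt, cycleCoeff_of_lt (by omega) (by omega),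
      cycleCoeff_of_lt (by omega) (by omega)] at this
    split_ifs at this <;> omega

/-- The low coefficients of `thetaOddPart` determine the lengths of the three cycles. -/
theorem eq_of_cycleCoeff_add_add_eq (hxy : x ≤ y) (hyz : y ≤ z) (hxy' : x' ≤ y') (hyz' : y' ≤ z')
    (hx : 1 ≤ x) (hx' : 1 ≤ x') (hs : x + y + z = x' + y' + z') (hy : y < N) (hy' : y' < N)
    (h : ∀ e ≤ N, cycleCoeff x e + cycleCoeff y e + cycleCoeff z e =
      cycleCoeff x' e + cycleCoeff y' e + cycleCoeff z' e) : x = x' ∧ y = y' ∧ z = z' := by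
  obtain rfl : x = x' := le_antisymm
    (le_of_cycleCoeff_add_add_eq hxy' hyz' hxy hyz hx' hs.symm (by omega) fun e he => (h e he).symm)
    (le_of_cycleCoeff_add_add_eq hxy hyz hxy' hyz' hx hs (by omega) h)
  have h' : ∀ e ≤ N, cycleCoeff y e + cycleCoeff z e = cycleCoeff y' e + cycleCoeff z' e :=
    fun e he => by linarith [h e he]
  obtain rfl : y = y' := le_antisymm
    (le_of_cycleCoeff_add_eq hyz' hyz (by omega) (by omega) hy' fun e he => (h' e he).symm)
    (le_of_cycleCoeff_add_eq hyz hyz' (by omega) (by omega) hy h')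
  exact ⟨rfl, rfl, by omega⟩

end Lengths

/-! ### A theta polynomial determines its path lengths. -/

section Theta

variable {d d' : Fin 3 → ℕ} {N : ℕ}

theorem exists_perm_of_sum_cycleCoeff_eq (h1 : ∀ i, 1 ≤ d i) (h1' : ∀ i, 1 ≤ d' i)
    (hN : d 0 + d 1 + d 2 = N) (hN' : d' 0 + d' 1 + d' 2 = N)
    (h : ∀ e ≤ N, ∑ i, cycleCoeff (N - d i) e = ∑ i, cycleCoeff (N - d' i) e) :
    ∃ σ : Equiv.Perm (Fin 3), ∀ i, d (σ i) = d' i := by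
  have hs : ∀ {f : Fin 3 → ℕ} (σ : Equiv.Perm (Fin 3)) (F : ℕ → ℤ), (∑ i, F (f i)) =
      F (f (σ 0)) + F (f (σ 1)) + F (f (σ 2)) := fun σ F => by
    rw [← Equiv.sum_comp σ, Fin.sum_univ_three]
  have hn : ∀ {f : Fin 3 → ℕ} (σ : Equiv.Perm (Fin 3)),
      f (σ 0) + f (σ 1) + f (σ 2) = f 0 + f 1 + f 2 := fun {f} σ => by
    rw [← Fin.sum_univ_three f, ← Equiv.sum_comp σ, Fin.sum_univ_three]
  have hm := Tuple.monotone_sort d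
  have hm' := Tuple.monotone_sort d'
  generalize Tuple.sort d = σ at hm
  generalize Tuple.sort d' = σ' at hm'
  have m1 : d (σ 0) ≤ d (σ 1) := hm (by decide)
  have m2 : d (σ 1) ≤ d (σ 2) := hm (by decide)
  have m1' : d' (σ' 0) ≤ d' (σ' 1) := hm' (by decide)
  have m2' : d' (σ' 1) ≤ d' (σ' 2) := hm' (by decide)
  have n1 := hn (f := d) σ
  have n2 := hn (f := d') σ'
  have p0 := h1 (σ 0)
  have p0' := h1' (σ' 0)
  -- A cycle has length `N` minus the path it avoids, so the sorted order is reversed; positive path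
  -- lengths keep the cycles shorter than `N`.
  obtain ⟨e1, e2, e3⟩ := eq_of_cycleCoeff_add_add_eq (x := N - d (σ 2)) (y := N - d (σ 1))
    (z := N - d (σ 0)) (x' := N - d' (σ' 2)) (y' := N - d' (σ' 1)) (z' := N - d' (σ' 0)) (N := N)
    (by omega) (by omega) (by omega) (by omega) (by omega) (by omega) (by omega) (by omega)
    (by omega) fun e he => by
      have := h e he
      rw [hs σ fun x => cycleCoeff (N - x) e, hs σ' fun x => cycleCoeff (N - x) e] at this
      linarith
  have key : ∀ i, d (σ i) = d' (σ' i) := by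
    intro i
    fin_cases i <;> simp <;> omega
  exact ⟨σ'.symm.trans σ, fun i => by simp [key]⟩

theorem coeff_thetaOddPart_eq_sum (h1 : ∀ i, 1 ≤ d i) (hN : d 0 + d 1 + d 2 = N) {e : ℕ}
    (he : e ≤ N) : (thetaOddPart (X : ℤ[X]) (d 0) (d 1) (d 2)).coeff e =
      (if e = 3 then 2 else 0) + ∑ i, cycleCoeff (N - d i) e := by
  rw [coeff_thetaOddPart (h1 0) (h1 1) (h1 2) (by omega), Fin.sum_univ_three,
    show N - d 0 = d 1 + d 2 by omega, show N - d 1 = d 0 + d 2 by omega,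
    show N - d 2 = d 0 + d 1 by omega]

/-- A theta polynomial that is the product of a theta polynomial and cycle polynomials determines
the lengths of the paths. -/
theorem exists_perm_of_thetaPoly_eq {ks : List ℕ} (h1 : ∀ i, 1 ≤ d i) (h1' : ∀ i, 1 ≤ d' i)
    (hk : ∀ k ∈ ks, 3 ≤ k) (hN : d 0 + d 1 + d 2 = d' 0 + d' 1 + d' 2 + ks.sum)
    (h : thetaPoly (X : ℤ[X]) (d 0) (d 1) (d 2) =
      thetaPoly X (d' 0) (d' 1) (d' 2) * (ks.map (cyclePoly X)).prod) :
    ks = [] ∧ ∃ σ : Equiv.Perm (Fin 3), ∀ i, d' (σ i) = d i := by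
  have hks : ks = [] := by
    have two_le : ∀ {n : ℕ}, Even n → 1 ≤ n → 2 ≤ n := fun {n} hn h1 => by
      obtain ⟨m, rfl⟩ := hn
      omega
    rcases even_or_eq_nil_of_thetaPoly_eq h with ⟨e0, e1, e2, e0', e1', e2'⟩ | hks
    · exact eq_nil_of_thetaPoly_eq_of_even e0 e1 e2 e0' e1' e2' (two_le e0' (h1' 0))
        (two_le e1' (h1' 1)) (two_le e2' (h1' 2)) hk hN h
    · exact hks
  subst hks
  simp only [List.map_nil, List.prod_nil, mul_one, List.sum_nil, add_zero] at h hN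
  refine ⟨rfl, exists_perm_of_sum_cycleCoeff_eq h1' h1 hN.symm rfl fun e he => ?_⟩
  have := congrArg (fun p => p.coeff e) (thetaOddPart_eq_thetaOddPart h)
  simp only [coeff_thetaOddPart_eq_sum h1 rfl he, coeff_thetaOddPart_eq_sum h1' hN.symm he] at this
  linarith

end Theta

/-! ### Theta polynomials are not dumbbell polynomials. -/

section Dumbbell

theorem dumbbellOddPart_comm {R : Type*} [CommRing R] (z : R) (a b c : ℕ) :
    dumbbellOddPart z a b c = dumbbellOddPart z b a c := by
  unfold dumbbellOddPart
  ring

variable {l₀ l₁ l₂ a b c N : ℕ}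

theorem false_of_coeff_dumbbellOddPart (h₀ : Even l₀) (h₁ : Odd l₁) (h₂ : Odd l₂) (h₀2 : 2 ≤ l₀)
    (hs : l₀ + l₁ + l₂ = 2 * N) (h₀N : l₀ < N) (h₁N : l₁ < N) (h₂N : l₂ < N)
    (hN : a + b + c = N) (ha3 : 3 ≤ a) (hb3 : 3 ≤ b) (hc1 : 1 ≤ c) (hc : Even c)
    (hab : Odd a ∨ Odd b)
    (h : ∀ e ≤ N, (if e = 3 then 2 else 0) + (cycleCoeff l₀ e + cycleCoeff l₁ e + cycleCoeff l₂ e) =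
      (dumbbellOddPart (X : ℤ[X]) a b c).coeff e) : False := by
  have hc2 : 2 ≤ c := by
    obtain ⟨m, rfl⟩ := hc
    omega
  wlog h₁₂ : l₁ ≤ l₂ generalizing l₁ l₂
  · exact this h₂ h₁ (by omega) h₂N h₁N (fun e he => by rw [← h e he]; ring) (by omega)
  wlog hb : Odd b generalizing a b
  · refine this (a := b) (b := a) (by omega) hb3 ha3 hab.symm (fun e he => ?_)
      (hab.resolve_right hb)
    rw [h e he, dumbbellOddPart_comm]
  rcases Nat.even_or_odd a with ha | ha
  · have ha4 : 4 ≤ a := by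
      obtain ⟨m, rfl⟩ := ha
      omega
    subst hN
    refine not_even_odd_loops h₀ h₁ h₂ h₀2 h₁₂ hs h₀N h₂N ha hb ha4 hb3 hc2 fun e he he' => ?_
    have := h e (by omega)
    rw [coeff_dumbbellOddPart_even_odd (g := min (a + 1) b) ha hb ha4 hb3 hc2 hc (by omega)
      (by omega) (by omega)] at this
    linarith
  · wlog hab' : a ≤ b generalizing a b
    · refine this (a := b) (b := a) (by omega) hb3 ha3 (.inl hb) (fun e he => ?_) ha hb (by omega)
      rw [h e he, dumbbellOddPart_comm]
    subst hN
    refine not_odd_odd_loops h₀ h₁ h₂ h₀2 h₁₂ hs h₀N h₂N ha hb ha3 hab' hc2 fun e he => ?_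
    have := h e (by omega)
    rw [coeff_dumbbellOddPart_odd_odd (g := a) ha hb ha3 hb3 hc2 le_rfl hab' he] at this
    linarith

variable {p q r : ℕ}

theorem thetaPoly_ne_dumbbellPoly_mul {ks : List ℕ} (hp : 1 ≤ p) (hq : 1 ≤ q) (hr : 1 ≤ r)
    (ha : 3 ≤ a) (hb : 3 ≤ b) (hc : 1 ≤ c) (hk : ∀ k ∈ ks, 3 ≤ k)
    (hN : p + q + r = a + b + c + ks.sum) :
    thetaPoly (X : ℤ[X]) p q r ≠ dumbbellPoly X a b c * (ks.map (cyclePoly X)).prod := by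
  intro h
  rcases parity_of_thetaPoly_eq_dumbbellPoly h with ⟨e0, e1, e2, e0', e1', e2'⟩ | ⟨rfl, hv, hv0⟩
  · exact thetaPoly_ne_dumbbellPoly_of_even e0 e1 e2 e0' e1' e2' ha hb hc hk hN h
  simp only [List.map_nil, List.prod_nil, mul_one, List.sum_nil, add_zero] at h hN
  have hco : ∀ e ≤ p + q + r, (if e = 3 then 2 else 0) + (cycleCoeff (q + r) e +
      cycleCoeff (p + r) e + cycleCoeff (p + q) e) =
        (dumbbellOddPart (X : ℤ[X]) a b c).coeff e := fun e he => by
    rw [← coeff_thetaOddPart hp hq hr he, thetaOddPart_eq_dumbbellOddPart h]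
  -- If all three are odd, the value at 1 is 80 and both loops are odd. The three cycles of the
  -- theta graph are then even and contribute non-negatively, but the dumbbell has a negative
  -- contribution at the shorter loop length.
  by_cases hodd : Odd p ∧ Odd q ∧ Odd r
  · obtain ⟨op, oq, or⟩ := hodd
    have hab : Odd a ∧ Odd b := by
      rw [dumbbellPoly_one, thetaPoly_one, op.neg_one_pow, oq.neg_one_pow, or.neg_one_pow] at hv
      rcases neg_one_pow_int_cases a with ⟨ha, ea⟩ | ⟨ha, ea⟩ <;>
      rcases neg_one_pow_int_cases b with ⟨hb, eb⟩ | ⟨hb, eb⟩ <;>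
      rcases neg_one_pow_int_cases c with ⟨hc, ec⟩ | ⟨hc, ec⟩ <;>
      first
      | exact ⟨ha, hb⟩
      | (rw [ea, eb, ec] at hv; omega)
    have h1 := hco (min a b) (by omega)
    rw [coeff_dumbbellOddPart_le hab.1 hab.2 hc (by omega) (by omega)] at h1
    have n1 := cycleCoeff_nonneg (oq.add_odd or) (min a b)
    have n2 := cycleCoeff_nonneg (op.add_odd or) (min a b)
    have n3 := cycleCoeff_nonneg (op.add_odd oq) (min a b)
    rcases le_total a b with hle | hle
    · rw [min_eq_left hle] at *
      rw [if_pos rfl] at h1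
      split_ifs at h1 <;> omega
    · rw [min_eq_right hle] at *
      rw [if_pos (c := b = b) rfl] at h1
      split_ifs at h1 <;> omega
  · have hev : ¬ (Even p ∧ Even q ∧ Even r) := fun ⟨ep, eq, er⟩ => hv0 (by
      rw [thetaPoly_one, ep.neg_one_pow, eq.neg_one_pow, er.neg_one_pow]
      norm_num)
    have hab : Even c ∧ (Odd a ∨ Odd b) := by
      rw [dumbbellPoly_one, thetaPoly_one] at hv
      rcases neg_one_pow_int_cases p with ⟨hp, ep⟩ | ⟨hp, ep⟩ <;>
      rcases neg_one_pow_int_cases q with ⟨hq, eq⟩ | ⟨hq, eq⟩ <;>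
      rcases neg_one_pow_int_cases r with ⟨hr, er⟩ | ⟨hr, er⟩ <;>
      first
      | exact (hodd ⟨hp, hq, hr⟩).elim
      | exact (hev ⟨hp, hq, hr⟩).elim
      | skip
      all_goals
        rcases neg_one_pow_int_cases a with ⟨ha, ea⟩ | ⟨ha, ea⟩ <;>
        rcases neg_one_pow_int_cases b with ⟨hb, eb⟩ | ⟨hb, eb⟩ <;>
        rcases neg_one_pow_int_cases c with ⟨hc, ec⟩ | ⟨hc, ec⟩ <;>
        first
        | exact ⟨hc, .inl ha⟩
        | exact ⟨hc, .inr hb⟩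
        | (rw [ep, eq, er, ea, eb, ec] at hv; omega)
    -- With mixed parities exactly one of the three cycles is even; it is put first.
    have key : ∀ l₀ l₁ l₂, Even l₀ → Odd l₁ → Odd l₂ → 2 ≤ l₀ → l₀ + l₁ + l₂ = 2 * (p + q + r) →
        l₀ < p + q + r → l₁ < p + q + r → l₂ < p + q + r →
        (∀ e, cycleCoeff l₀ e + cycleCoeff l₁ e + cycleCoeff l₂ e =
          cycleCoeff (q + r) e + cycleCoeff (p + r) e + cycleCoeff (p + q) e) → False :=
      fun l₀ l₁ l₂ h₀ h₁ h₂ h₀2 hs h₀N h₁N h₂N hl =>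
        false_of_coeff_dumbbellOddPart h₀ h₁ h₂ h₀2 hs h₀N h₁N h₂N hN.symm ha hb hc hab.1 hab.2
          fun e he => by rw [hl, hco e he]
    rcases Nat.even_or_odd p with ep | ep <;> rcases Nat.even_or_odd q with eq | eq <;>
      rcases Nat.even_or_odd r with er | er
    · exact hev ⟨ep, eq, er⟩
    · exact key _ _ _ (ep.add eq) (eq.add_odd er) (ep.add_odd er) (by omega) (by omega)
        (by omega) (by omega) (by omega) fun e => by ring
    · exact key _ _ _ (ep.add er) (eq.add_even er) (ep.add_odd eq) (by omega) (by omega)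
        (by omega) (by omega) (by omega) fun e => by ring
    · exact key _ _ _ (eq.add_odd er) (ep.add_odd er) (ep.add_odd eq) (by omega) (by omega)
        (by omega) (by omega) (by omega) fun e => by ring
    · exact key _ _ _ (eq.add er) (ep.add_even er) (ep.add_even eq) (by omega) (by omega)
        (by omega) (by omega) (by omega) fun e => by ring
    · exact key _ _ _ (ep.add_odd er) (eq.add_odd er) (ep.add_even eq) (by omega) (by omega)
        (by omega) (by omega) (by omega) fun e => by ring
    · exact key _ _ _ (ep.add_odd eq) (eq.add_even er) (ep.add_even er) (by omega) (by omega)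
        (by omega) (by omega) (by omega) fun e => by ring
    · exact hodd ⟨ep, eq, er⟩

end Dumbbell

/-! ### Conclusion. -/

open Matrix SimpleGraph

theorem theorem1p4 (p q r : ℕ)
    (hpq : ¬(p = 0 ∧ q = 0)) (hpr : ¬(p = 0 ∧ r = 0)) (hqr : ¬(q = 0 ∧ r = 0))
    {W : Type*} [Fintype W] [DecidableEq W] (H : SimpleGraph W) [DecidableRel H.Adj]
    (hH : H.signlessLapPermPoly = (thetaGraph p q r).signlessLapPermPoly) :
    Nonempty (H ≃g thetaGraph p q r) := by
  have hz := thetaGraph_hyp hpq hpr hqr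
  obtain ⟨d0, d1, d2⟩ := degree_thetaGraph hz
  obtain ⟨u, v, huv, hu, hv, h2⟩ := degrees_of_signlessLapPermPoly_eq H hH (by simp) d0 d1 d2
  obtain ⟨hcard, -⟩ := permPolyRev_eq_of_signlessLapPermPoly_eq H hH
  -- At $x = y + 2$ the diagonal entry $x - d$ is $y$ for degree 2 and $y - 1$ for degree 3.
  have hper : ∀ {R : Type} [CommRing R] (y : R), thetaPerm y p q r =
      (relMat H.Adj fun w => if w = u ∨ w = v then y - 1 else y).permanent := fun {R} _ y => by
    have h := congrArg (eval₂RingHom (Int.castRingHom R) (y + 2)) hH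
    rw [map_signlessLapPermPoly, map_signlessLapPermPoly, coe_eval₂RingHom, eval₂_X,
      permanent_thetaGraph hz, add_sub_cancel_right] at h
    rw [← h]
    congr 2
    ext w
    split_ifs with hw
    · rw [show H.degree w = 3 by rcases hw with rfl | rfl <;> assumption]
      push_cast
      ring
    · rw [not_or] at hw
      rw [h2 w hw.1 hw.2]
      push_cast
      ring
  simp only [degree_eq_ncard] at hu hv h2
  have hn : p + q + r + 2 = Fintype.card W := by
    rw [hcard]
    simp [Fin.sum_univ_three]
    ring
  obtain ⟨l, ks, hk, hl, ⟨-, hθ, hiso⟩ | ⟨hl0, hl1, hD⟩⟩ :=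
    exists_permanent_eq_theta_or_dumbbell huv hu hv h2
  · have key := thetaPoly_eq_thetaPoly_mul (p := p) (q := q) (r := r)
      (a := l 0) (b := l 1) (c := l 2) hk (by omega) fun y => by rw [hper, hθ]
    obtain ⟨hks, σ, hσ⟩ := exists_perm_of_thetaPoly_eq (d := fun i => ![p, q, r] i + 1)
      (d' := fun i => l i + 1) (by simp) (by simp) hk (by simp; omega) key
    obtain ⟨e, he⟩ := hiso hks
    exact nonempty_iso_thetaGraph e he σ fun i => Nat.succ_injective (hσ i)
  · have key := thetaPoly_eq_dumbbellPoly_mul (p := p) (q := q) (r := r)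
      (a := l 0) (b := l 1) (c := l 2) hk (by omega) fun y => by rw [hper, hD]
    -- The arguments are lengths in edges, one more than the numbers of inner vertices, so loops
    -- have length at least 3.
    exact absurd key (thetaPoly_ne_dumbbellPoly_mul (by omega) (by omega) (by omega) (by omega)
      (by omega) (by omega) hk (by omega))
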